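/- Let $i\mathsf{RCA}_0$ be the following theory of second order arithmetic in two-sorted intuitionistic logic with equality between numbers, with variables for natural numbers and for functions $\mathbb N\to\mathbb N$: its terms are built from $0$, successor, application of function variables, and primitive recursion of type $0$ (with number and function parameters); its axioms are the successor axioms, the defining equations of primitive recursion, induction for quantifier-free formulas, and the choice scheme $\forall x\,\exists y\,\varphi(x,y)\to\exists\alpha\,\forall x\,\varphi(x,\alpha(x))$ for quantifier-free $\varphi$ (parameters allowed). A graph with vertex set $\mathbb N$ is coded by a function $e:\mathbb N\to\mathbb N$: for $a<b$, the pair $(a,b)$ is an edge if and only if $e$ is nonzero at the code of $(a,b)$. A $k$-coloring is a function on the vertices with values in $\{0,\dots,k-1\}$ that takes different values at the two ends of every edge. The graph $G$ is locally $k$-colorable if for every $m$ the subgraph induced on $\{0,\dots,m\}$ has a $k$-coloring (a finite function, coded by a number). A binary tree $T$ is coded by a function $t:\mathbb N\to\mathbb N$: a finite binary sequence is in $T$ if and only if $t$ is positive at the code of the sequence and at the codes of all its initial segments. $\mathsf{WKL}$ is the statement: for every binary tree $T$, if for every $m$ there is a sequence of length $m$ in $T$, then there is a function $p:\mathbb N\to\{0,1\}$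 all of whose initial segments are in $T$. Then $i\mathsf{RCA}_0$ proves: for every $k\ge 2$, $\mathsf{WKL}$ is equivalent to the statement that for every sequence $\langle G_i\rangle_{i\in\mathbb N}$ of locally $k$-colorable graphs with vertex set $\mathbb N$ there is a function $f:\mathbb N\times\mathbb N\to\mathbb N$ such that for each $i$ the function $n\mapsto f(i,n)$ is a $k$-coloring of $G_i$. -/

import Mathlib

/-! # Intuitionistic second order arithmetic with quantifier free choice

`iRCA0` is the second order part of Kohlenbach's system for higher order reverse mathematics,
with intuitionistic logic: two sorts (natural numbers, and functions from numbers to numbers),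
primitive recursion of type 0 with number and function parameters, induction for quantifier free
formulas, and choice from numbers to numbers for quantifier free formulas. Variables are
de Bruijn indices, with separate counts for the two sorts. -/

namespace IRCA

/-- Number terms. `var n` is a number variable, `app α t` is the value at `t` of the function
variable with index `α`. `recur a b t` is primitive recursion on `t` with initial value `a` and
step `b`; the step binds two number variables, index `0` for the previous value and index `1` for
the recursion argument. -/
inductive Tm : Type
  | var (n : ℕ) : Tm
  | zero : Tm
  | succ (t : Tm) : Tm
  | app (α : ℕ) (t : Tm) : Tm
  | recur (a b t : Tm) : Tm

/-- A renaming moved under one binder. -/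
def lift (r : ℕ → ℕ) : ℕ → ℕ
  | 0 => 0
  | n + 1 => r n + 1

namespace Tm

/-- Rename number variables by `r` and function variables by `ρ`. -/
def rename : (ℕ → ℕ) → (ℕ → ℕ) → Tm → Tm
  | r, _, var n => var (r n)
  | _, _, zero => zero
  | r, ρ, succ t => succ (rename r ρ t)
  | r, ρ, app α t => app (ρ α) (rename r ρ t)
  | r, ρ, recur a b t =>
      recur (rename r ρ a) (rename (lift (lift r)) ρ b) (rename r ρ t)

/-- Weaken a term by `n` fresh number variables and `f` fresh function variables. -/
def shift (n f : ℕ) (t : Tm) : Tm := t.rename (fun i => i + n) (fun i => i + f)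

/-- A substitution moved under one number binder. -/
def up (σ : ℕ → Tm) : ℕ → Tm
  | 0 => var 0
  | n + 1 => (σ n).shift 1 0

/-- Substitute terms for number variables by `σ` and rename function variables by `ρ`. -/
def subst : (ℕ → Tm) → (ℕ → ℕ) → Tm → Tm
  | σ, _, var n => σ n
  | _, _, zero => zero
  | σ, ρ, succ t => succ (subst σ ρ t)
  | σ, ρ, app α t => app (ρ α) (subst σ ρ t)
  | σ, ρ, recur a b t => recur (subst σ ρ a) (subst (up (up σ)) ρ b) (subst σ ρ t)

end Tm

/-- Put one term in front of a substitution. -/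
def scons {X : Type} (x : X) (σ : ℕ → X) : ℕ → X
  | 0 => x
  | n + 1 => σ n

/-- Formulas: equations between number terms, the connectives, and quantifiers over numbers
(`allN`, `exN`) and over functions (`allF`, `exF`). -/
inductive Fm : Type
  | eq (s t : Tm) : Fm
  | bot : Fm
  | and (φ ψ : Fm) : Fm
  | or (φ ψ : Fm) : Fm
  | imp (φ ψ : Fm) : Fm
  | allN (φ : Fm) : Fm
  | exN (φ : Fm) : Fm
  | allF (φ : Fm) : Fm
  | exF (φ : Fm) : Fm

namespace Fm

/-- Capture avoiding substitution. -/
def subst : (ℕ → Tm) → (ℕ → ℕ) → Fm → Fm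
  | σ, ρ, eq s t => eq (s.subst σ ρ) (t.subst σ ρ)
  | _, _, bot => bot
  | σ, ρ, and φ ψ => and (subst σ ρ φ) (subst σ ρ ψ)
  | σ, ρ, or φ ψ => or (subst σ ρ φ) (subst σ ρ ψ)
  | σ, ρ, imp φ ψ => imp (subst σ ρ φ) (subst σ ρ ψ)
  | σ, ρ, allN φ => allN (subst (Tm.up σ) ρ φ)
  | σ, ρ, exN φ => exN (subst (Tm.up σ) ρ φ)
  | σ, ρ, allF φ => allF (subst (fun n => (σ n).shift 0 1) (lift ρ) φ)
  | σ, ρ, exF φ => exF (subst (fun n => (σ n).shift 0 1) (lift ρ) φ)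

/-- Weaken by a fresh number variable. -/
def shiftN (φ : Fm) : Fm := φ.subst (fun n => Tm.var (n + 1)) id

/-- Weaken by a fresh function variable. -/
def shiftF (φ : Fm) : Fm := φ.subst Tm.var Nat.succ

/-- Instantiate number variable `0` by the term `t`. -/
def instN (φ : Fm) (t : Tm) : Fm := φ.subst (scons t Tm.var) id

/-- Instantiate function variable `0` by the function variable `α`. -/
def instF (φ : Fm) (α : ℕ) : Fm := φ.subst Tm.var (scons α id)

def neg (φ : Fm) : Fm := imp φ bot

def iff (φ ψ : Fm) : Fm := and (imp φ ψ) (imp ψ φ)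

/-- Quantifier free formulas. -/
def QF : Fm → Prop
  | eq _ _ => True
  | bot => True
  | and φ ψ => QF φ ∧ QF ψ
  | or φ ψ => QF φ ∧ QF ψ
  | imp φ ψ => QF φ ∧ QF ψ
  | allN _ => False
  | exN _ => False
  | allF _ => False
  | exF _ => False

end Fm

/-- Intuitionistic natural deduction with equality, from hypotheses `Γ`, over a theory `T`.
Members of `T` may have free variables and are understood as universally closed. -/
inductive Derivable (T : Set Fm) : List Fm → Fm → Prop
  | ofTheory {Γ φ} : φ ∈ T → Derivable T Γ φ
  | hyp {Γ φ} : φ ∈ Γ → Derivable T Γ φ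
  | botE {Γ φ} : Derivable T Γ Fm.bot → Derivable T Γ φ
  | andI {Γ φ ψ} : Derivable T Γ φ → Derivable T Γ ψ → Derivable T Γ (Fm.and φ ψ)
  | andL {Γ φ ψ} : Derivable T Γ (Fm.and φ ψ) → Derivable T Γ φ
  | andR {Γ φ ψ} : Derivable T Γ (Fm.and φ ψ) → Derivable T Γ ψ
  | orL {Γ φ ψ} : Derivable T Γ φ → Derivable T Γ (Fm.or φ ψ)
  | orR {Γ φ ψ} : Derivable T Γ ψ → Derivable T Γ (Fm.or φ ψ)
  | orE {Γ φ ψ χ} : Derivable T Γ (Fm.or φ ψ) → Derivable T (φ :: Γ) χ →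
      Derivable T (ψ :: Γ) χ → Derivable T Γ χ
  | impI {Γ φ ψ} : Derivable T (φ :: Γ) ψ → Derivable T Γ (Fm.imp φ ψ)
  | impE {Γ φ ψ} : Derivable T Γ (Fm.imp φ ψ) → Derivable T Γ φ → Derivable T Γ ψ
  | allNI {Γ φ} : Derivable T (Γ.map Fm.shiftN) φ → Derivable T Γ (Fm.allN φ)
  | allNE {Γ φ} (t : Tm) : Derivable T Γ (Fm.allN φ) → Derivable T Γ (φ.instN t)
  | exNI {Γ φ} (t : Tm) : Derivable T Γ (φ.instN t) → Derivable T Γ (Fm.exN φ)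
  | exNE {Γ φ ψ} : Derivable T Γ (Fm.exN φ) →
      Derivable T (φ :: Γ.map Fm.shiftN) ψ.shiftN → Derivable T Γ ψ
  | allFI {Γ φ} : Derivable T (Γ.map Fm.shiftF) φ → Derivable T Γ (Fm.allF φ)
  | allFE {Γ φ} (α : ℕ) : Derivable T Γ (Fm.allF φ) → Derivable T Γ (φ.instF α)
  | exFI {Γ φ} (α : ℕ) : Derivable T Γ (φ.instF α) → Derivable T Γ (Fm.exF φ)
  | exFE {Γ φ ψ} : Derivable T Γ (Fm.exF φ) →
      Derivable T (φ :: Γ.map Fm.shiftF) ψ.shiftF → Derivable T Γ ψ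
  | eqRefl {Γ} (t : Tm) : Derivable T Γ (Fm.eq t t)
  | eqSubst {Γ} (φ : Fm) {s t : Tm} : Derivable T Γ (Fm.eq s t) →
      Derivable T Γ (φ.instN s) → Derivable T Γ (φ.instN t)

/-- The theory `iRCA0`. -/
inductive iRCA0 : Set Fm
  /-- Zero is not a successor. -/
  | succ_ne_zero (t : Tm) : iRCA0 (Fm.neg (Fm.eq (Tm.succ t) Tm.zero))
  /-- The successor is injective. -/
  | succ_inj (s t : Tm) : iRCA0 (Fm.imp (Fm.eq (Tm.succ s) (Tm.succ t)) (Fm.eq s t))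
  /-- The recursion equation at zero. -/
  | recur_zero (a b : Tm) : iRCA0 (Fm.eq (Tm.recur a b Tm.zero) a)
  /-- The recursion equation at a successor. -/
  | recur_succ (a b t : Tm) : iRCA0 (Fm.eq (Tm.recur a b (Tm.succ t))
      (b.subst (scons (Tm.recur a b t) (scons t Tm.var)) id))
  /-- Induction for a quantifier free formula `φ(x)`, where `x` is number variable `0`. -/
  | induction (φ : Fm) : φ.QF → iRCA0 (Fm.imp
      (Fm.and (φ.instN Tm.zero)
        (Fm.allN (Fm.imp φ
          (φ.subst (scons (Tm.succ (Tm.var 0)) (fun n => Tm.var (n + 1))) id))))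
      (Fm.allN φ))
  /-- Choice `∀ x, ∃ y, φ(x, y) → ∃ α, ∀ x, φ(x, α x)` for a quantifier free formula `φ`, where
  `y` is number variable `0` and `x` is number variable `1`. -/
  | choice (φ : Fm) : φ.QF → iRCA0 (Fm.imp
      (Fm.allN (Fm.exN φ))
      (Fm.exF (Fm.allN (φ.subst
        (scons (Tm.app 0 (Tm.var 0)) (scons (Tm.var 0) (fun n => Tm.var (n + 1)))) Nat.succ))))

/-! ## Primitive recursive terms -/

namespace Tm

def one : Tm := succ zero

def two : Tm := succ one

def pred (a : Tm) : Tm := recur zero (var 1) a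

def add (a b : Tm) : Tm := recur a (succ (var 0)) b

/-- Truncated subtraction. -/
def sub (a b : Tm) : Tm := recur a (pred (var 0)) b

def mul (a b : Tm) : Tm := recur zero (add (var 0) (a.shift 2 0)) b

def pow (a b : Tm) : Tm := recur one (mul (var 0) (a.shift 2 0)) b

/-- The quotient of `a` by `b` when `b` is positive: the number of `i < a` such that
`(i + 1) * b ≤ a`. -/
def quo (a b : Tm) : Tm :=
  recur zero (add (var 0) (sub one (sub (mul (succ (var 1)) (b.shift 2 0)) (a.shift 2 0)))) a

/-- The remainder of `a` modulo `b`. -/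
def rem (a b : Tm) : Tm := sub a (mul b (quo a b))

/-- The sum of all `i < b`, which is `b * (b - 1) / 2`. -/
def tri (b : Tm) : Tm := recur zero (add (var 0) (var 1)) b

/-- The code `b * (b - 1) / 2 + a` of an increasing pair `a < b`. These pairs correspond
bijectively to the natural numbers. -/
def edgeCode (a b : Tm) : Tm := add (tri b) a

/-- The code `(i + n) * (i + n + 1) / 2 + i` of an arbitrary pair `(i, n)`; again a bijection. -/
def pair (i n : Tm) : Tm := edgeCode i (succ (add i n))

/-- The digit of `s` at place `a` in base `k`. For `k` positive, a number `s` codes a finite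
function `a ↦ digit k s a` from `{0, …, m}` to `{0, …, k - 1}`, and all such functions have
codes. -/
def digit (k s a : Tm) : Tm := rem (quo s (pow k a)) k

/-- Binary sequences are coded bijectively by numbers: the empty sequence by `0`, and `σ`
followed by the bit `b` by `2 * c + 1 + b` where `c` codes `σ`. So `c + 1` in binary is `1`
followed by `σ`. The term `ancestor c j` codes `σ` with its last `j` bits deleted. -/
def ancestor (c j : Tm) : Tm := recur c (quo (pred (var 0)) two) j

/-- The code of the binary sequence `p 0, …, p (m - 1)`, for the function variable `p`. -/
def initSeg (p : ℕ) (m : Tm) : Tm := recur zero (succ (add (mul two (var 0)) (app p (var 1)))) m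

end Tm

/-! ## The formulas -/

namespace Fm

open Tm (var one two pow edgeCode pair digit ancestor initSeg)

def le (a b : Tm) : Fm := eq (Tm.sub a b) Tm.zero

def lt (a b : Tm) : Fm := le (Tm.succ a) b

def ne (a b : Tm) : Fm := neg (eq a b)

/-- The binary sequence coded by `c` has length `m`. -/
def hasLength (c m : Tm) : Fm :=
  and (le (pow two m) (Tm.succ c)) (lt (Tm.succ c) (pow two (Tm.succ m)))

/-- The binary sequence coded by `c` is in the tree coded by the function variable `t`: the
function `t` is positive on the codes of this sequence and of all its initial segments. -/
def inTree (t : ℕ) (c : Tm) : Fm :=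
  allN (ne (Tm.app t (ancestor (c.shift 1 0) (var 0))) Tm.zero)

/-- Weak König's Lemma: if a binary tree has sequences of every length, there is a function with
values in `{0, 1}` all of whose initial segments are in the tree. -/
def WKL : Fm :=
  allF (imp
    (allN (exN (and (hasLength (var 0) (var 1)) (inTree 0 (var 0)))))
    (exF (and
      (allN (lt (Tm.app 0 (var 0)) two))
      (allN (inTree 1 (initSeg 0 (var 0)))))))

/-- For `a < b`, the pair `(a, b)` is an edge of the graph with index `i` in the sequence of
graphs with vertex set `ℕ` coded by the function variable `e`. -/
def edge (e : ℕ) (i a b : Tm) : Fm := ne (Tm.app e (pair i (edgeCode a b))) Tm.zero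

/-- The subgraph on `{0, …, m}` of the graph with index `i` has a `k`-coloring, coded by `s`
(number variable `2`, with `b` and `a` as number variables `1` and `0`). -/
def colorableUpTo (k : Tm) (e : ℕ) (i m : Tm) : Fm :=
  exN (allN (allN
    (imp (lt (var 0) (var 1))
      (imp (le (var 1) (m.shift 3 0))
        (imp (edge e (i.shift 3 0) (var 0) (var 1))
          (ne (digit (k.shift 3 0) (var 2) (var 0)) (digit (k.shift 3 0) (var 2) (var 1))))))))

/-- The function `n ↦ f(i, n)` is a `k`-coloring of the graph with index `i`. -/
def isColoring (k : Tm) (e : ℕ) (i : Tm) (f : ℕ) : Fm :=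
  and
    (allN (lt (Tm.app f (pair (i.shift 1 0) (var 0))) (k.shift 1 0)))
    (allN (allN
      (imp (lt (var 0) (var 1))
        (imp (edge e (i.shift 2 0) (var 0) (var 1))
          (ne (Tm.app f (pair (i.shift 2 0) (var 0)))
            (Tm.app f (pair (i.shift 2 0) (var 1))))))))

/-- For every sequence of locally `k`-colorable graphs with vertex set `ℕ` there is a function
`f(i, n)` such that for each `i` the function `n ↦ f(i, n)` is a `k`-coloring of the graph with
index `i`. -/
def seqColoring (k : Tm) : Fm :=
  allF (imp
    (allN (allN (colorableUpTo (k.shift 2 1) 0 (var 1) (var 0))))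
    (exF (allN (isColoring (k.shift 1 2) 1 (var 0) 0))))

end Fm

end IRCA

namespace IRCA

/-! From trees to colorings: quantifier-free choice collects codes `S(i, m)` of colorings of `G_i`
up to `m`. Consider binary sequences whose bit at place `((i, a), j)` says that color `j` is allowed
for the vertex `a` of `G_i`. Those that allow no common color at the two ends of an edge, and allow
some color as soon as all places of a vertex are present, define a tree. For each `m` the codes
`S(i, m)`, for all `i` together, yield a sequence of length `m` in it (`partialColoring_seg`). Along
a path every vertex has an allowed color (`exists_color`) and adjacent vertices share none
(`color_ne`), so any choice of allowed colors gives the colorings.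

From colorings to trees: one cannot decide which child of a node has arbitrarily long extensions,
but a coloring can make a safe choice. For the node `σ` of length `m`, the graph with index `(m, σ)`
has a clique `0, …, k - 3` joined to everything, a decision vertex `k - 2`, and the vertices from `k
- 1` on, which are joined exactly when their distances from `k - 1` have different parity. The
clique leaves two colors, which alternate on the later vertices (`no_three_colors`). If at stage `s`
the left child has no extension of length `s` and the right child has one, the decision vertex is
joined to the odd vertex `k - 1 + (2 * s + 1)`; in the opposite case it is joined to the even vertex
`k - 1 + 2 * s`. Only one of the two cases can ever occur (`Outlives.not`), and finitely many stages
can be searched, so the graph is locally `k`-colorable (`ne_of_joined`). In a full coloring,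
equality of the colors of `k - 2` and `k - 1` means that the right child is safe, inequality that
the left one is (`not_outlives_of_coloring`). Following safe children from the root stays among
nodes with extensions of every length (`alive_seg`).

To obtain intuitionistic derivations without writing them out, most of the work is done in term
models. If `χ` is not derivable from `Γ`, Zorn's lemma gives a prime theory containing `Γ` and
omitting `χ` (`exists_mod`); terms modulo its equations form a model with number quantifiers only.
Equality is decidable in the theory (`dec_eq`), so truth and membership agree for quantifier-free
formulas (`Fm.absolute_qf`), and `complete` turns truth in all models into derivability for the
class `Fm.Goal`. The models satisfy induction for predicates definable by quantifier-free formulas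
with parameters (`sat_induction`, `ind`), and these are closed under bounded quantifiers.
Existential hypotheses, function quantifiers, choice, and the two principles themselves are handled
by explicit steps in the calculus. -/

theorem scons_zero {X : Type} (x : X) (σ : ℕ → X) : scons x σ 0 = x := rfl

theorem scons_succ {X : Type} (x : X) (σ : ℕ → X) (n : ℕ) : scons x σ (n + 1) = σ n := rfl

attribute [simp] scons_zero scons_succ

theorem scons_head_tail {X : Type} (σ : ℕ → X) : scons (σ 0) (fun n => σ (n + 1)) = σ := by
  funext n; cases n <;> rfl

/-! ### Substitution calculus for terms and formulas -/

namespace Tm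

theorem up_var_comp (r : ℕ → ℕ) : up (fun i => var (r i)) = fun i => var (lift r i) := by
  funext n; cases n <;> rfl

theorem rename_eq_subst (t : Tm) (r ρ : ℕ → ℕ) : t.rename r ρ = t.subst (fun i => var (r i)) ρ := by
  induction t generalizing r <;> simp_all [rename, subst, up_var_comp]

theorem shift_eq_subst (t : Tm) (n f : ℕ) :
    t.shift n f = t.subst (fun i => var (i + n)) (fun i => i + f) :=
  rename_eq_subst _ _ _

theorem up_var : up var = var := by
  funext n; cases n <;> rfl

theorem subst_id (t : Tm) : t.subst var id = t := by
  induction t <;> simp_all [subst, up_var]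

theorem subst_id' (t : Tm) : t.subst var (fun i => i) = t := subst_id t

theorem lift_comp (r r' : ℕ → ℕ) : (fun i => lift r' (lift r i)) = lift (fun i => r' (r i)) := by
  funext n; cases n <;> rfl

theorem up_lift (σ : ℕ → Tm) (r : ℕ → ℕ) :
    (fun i => up σ (lift r i)) = up (fun i => σ (r i)) := by
  funext n; cases n <;> rfl

theorem subst_rename (t : Tm) (r ρ : ℕ → ℕ) (σ : ℕ → Tm) (ρ' : ℕ → ℕ) :
    (t.rename r ρ).subst σ ρ' = t.subst (fun i => σ (r i)) (fun i => ρ' (ρ i)) := by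
  induction t generalizing r σ <;> simp_all [rename, subst, up_lift]

theorem rename_rename (t : Tm) (r ρ r' ρ' : ℕ → ℕ) :
    (t.rename r ρ).rename r' ρ' = t.rename (fun i => r' (r i)) (fun i => ρ' (ρ i)) := by
  induction t generalizing r r' <;> simp_all [rename, lift_comp]

theorem rename_up (σ : ℕ → Tm) (r ρ : ℕ → ℕ) :
    (fun i => (up σ i).rename (lift r) ρ) = up (fun i => (σ i).rename r ρ) := by
  funext n
  cases n with
  | zero => rfl
  | succ n => simp [up, shift, rename_rename, lift]

theorem rename_subst (t : Tm) (σ : ℕ → Tm) (ρ : ℕ → ℕ) (r ρ' : ℕ → ℕ) :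
    (t.subst σ ρ).rename r ρ' = t.subst (fun i => (σ i).rename r ρ') (fun i => ρ' (ρ i)) := by
  induction t generalizing r σ <;> simp_all [rename, subst, rename_up]

theorem subst_up (σ σ' : ℕ → Tm) (ρ' : ℕ → ℕ) :
    (fun i => (up σ i).subst (up σ') ρ') = up (fun i => (σ i).subst σ' ρ') := by
  funext n
  cases n with
  | zero => rfl
  | succ n => simp [up, shift, rename_subst, subst_rename]

theorem subst_subst (t : Tm) (σ σ' : ℕ → Tm) (ρ ρ' : ℕ → ℕ) :
    (t.subst σ ρ).subst σ' ρ' = t.subst (fun i => (σ i).subst σ' ρ') (fun i => ρ' (ρ i)) := by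
  induction t generalizing σ σ' <;> simp_all [subst, subst_up]

theorem subst_shift (t : Tm) (n f : ℕ) (σ : ℕ → Tm) (ρ : ℕ → ℕ) :
    (t.shift n f).subst σ ρ = t.subst (fun i => σ (i + n)) (fun i => ρ (i + f)) :=
  subst_rename _ _ _ _ _

theorem shift_subst (t : Tm) (n f : ℕ) (σ : ℕ → Tm) (ρ : ℕ → ℕ) :
    (t.subst σ ρ).shift n f = t.subst (fun i => (σ i).shift n f) (fun i => ρ i + f) :=
  rename_subst _ _ _ _ _

theorem shift_shift (t : Tm) (n f m g : ℕ) : (t.shift n f).shift m g = t.shift (n + m) (f + g) := by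
  simp [shift, rename_rename, Nat.add_assoc]

theorem up_up_add_two (σ : ℕ → Tm) (i : ℕ) : up (up σ) (i + 2) = (σ i).shift 2 0 := by
  simp [up, shift_shift]

theorem shift_two_subst_up_up (t : Tm) (σ : ℕ → Tm) (ρ : ℕ → ℕ) :
    (t.shift 2 0).subst (up (up σ)) ρ = (t.subst σ ρ).shift 2 0 := by
  rw [subst_shift, shift_subst]; simp [up_up_add_two]

theorem shift_one_subst_up (t : Tm) (σ : ℕ → Tm) (ρ : ℕ → ℕ) :
    (t.shift 1 0).subst (up σ) ρ = (t.subst σ ρ).shift 1 0 := by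
  rw [subst_shift, shift_subst]; rfl

end Tm

namespace Fm

theorem subst_shiftF_comp (σ σ' : ℕ → Tm) (ρ' : ℕ → ℕ) :
    (fun n => ((σ n).shift 0 1).subst (fun m => (σ' m).shift 0 1) (lift ρ')) =
      fun n => ((σ n).subst σ' ρ').shift 0 1 := by
  funext n
  rw [Tm.subst_shift, Tm.shift_subst]; rfl

theorem subst_subst (φ : Fm) (σ σ' : ℕ → Tm) (ρ ρ' : ℕ → ℕ) :
    (φ.subst σ ρ).subst σ' ρ' = φ.subst (fun i => (σ i).subst σ' ρ') (fun i => ρ' (ρ i)) := by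
  induction φ generalizing σ σ' ρ ρ' <;>
    simp_all [subst, Tm.subst_subst, Tm.subst_up, subst_shiftF_comp, Tm.lift_comp]

theorem lift_id : lift (fun i => i) = fun i => i := by
  funext n; cases n <;> rfl

theorem subst_id' (φ : Fm) : φ.subst Tm.var (fun i => i) = φ := by
  induction φ <;> simp_all [subst, Tm.subst_id', Tm.up_var, lift_id, Tm.shift, Tm.rename]

theorem subst_id (φ : Fm) : φ.subst Tm.var id = φ := subst_id' φ

theorem QF.subst {φ : Fm} (h : φ.QF) (σ : ℕ → Tm) (ρ : ℕ → ℕ) : (φ.subst σ ρ).QF := by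
  induction φ <;> simp_all [Fm.subst, QF]

end Fm

/-! ### Structural rules of the calculus -/

/-- Provability from `Γ` in `iRCA0`. -/
abbrev Prov (Γ : List Fm) (φ : Fm) : Prop := Derivable iRCA0 Γ φ

theorem Prov.mono {Γ Δ : List Fm} {φ : Fm} (h : Prov Γ φ) (hs : Γ ⊆ Δ) : Prov Δ φ := by
  induction h generalizing Δ with
  | ofTheory h => exact .ofTheory h
  | hyp h => exact .hyp (hs h)
  | botE _ ih => exact .botE (ih hs)
  | andI _ _ ih1 ih2 => exact .andI (ih1 hs) (ih2 hs)
  | andL _ ih => exact .andL (ih hs)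
  | andR _ ih => exact .andR (ih hs)
  | orL _ ih => exact .orL (ih hs)
  | orR _ ih => exact .orR (ih hs)
  | orE _ _ _ ih ih1 ih2 =>
    exact .orE (ih hs) (ih1 (List.cons_subset_cons _ hs)) (ih2 (List.cons_subset_cons _ hs))
  | impI _ ih => exact .impI (ih (List.cons_subset_cons _ hs))
  | impE _ _ ih1 ih2 => exact .impE (ih1 hs) (ih2 hs)
  | allNI _ ih => exact .allNI (ih (List.map_subset _ hs))
  | allNE t _ ih => exact .allNE t (ih hs)
  | exNI t _ ih => exact .exNI t (ih hs)
  | exNE _ _ ih ih1 => exact .exNE (ih hs) (ih1 (List.cons_subset_cons _ (List.map_subset _ hs)))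
  | allFI _ ih => exact .allFI (ih (List.map_subset _ hs))
  | allFE t _ ih => exact .allFE t (ih hs)
  | exFI t _ ih => exact .exFI t (ih hs)
  | exFE _ _ ih ih1 => exact .exFE (ih hs) (ih1 (List.cons_subset_cons _ (List.map_subset _ hs)))
  | eqRefl t => exact .eqRefl t
  | eqSubst φ _ _ ih1 ih2 => exact .eqSubst φ (ih1 hs) (ih2 hs)

theorem Prov.cut {Γ L : List Fm} {φ : Fm} (h : Prov L φ) (hL : ∀ ψ ∈ L, Prov Γ ψ) : Prov Γ φ := by
  induction L generalizing φ with
  | nil => exact h.mono (List.nil_subset _)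
  | cons a L ih =>
    exact .impE (ih (.impI h) fun ψ hψ => hL ψ (List.mem_cons_of_mem _ hψ)) (hL a List.mem_cons_self)

theorem Prov.induction {Γ : List Fm} {φ : Fm} (hφ : φ.QF) (h0 : Prov Γ (φ.instN Tm.zero))
    (hs : Prov (φ :: Γ.map Fm.shiftN)
      (φ.subst (scons (Tm.succ (Tm.var 0)) (fun n => Tm.var (n + 1))) id)) (t : Tm) :
    Prov Γ (φ.instN t) :=
  .allNE t (.impE (.ofTheory (.induction φ hφ)) (.andI h0 (.allNI (.impI hs))))

theorem Prov.choice {Γ : List Fm} {φ ψ : Fm} (hφ : φ.QF) (h : Prov Γ (.allN (.exN φ)))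
    (hs : Prov (.allN (φ.subst (scons (Tm.app 0 (Tm.var 0))
      (scons (Tm.var 0) (fun n => Tm.var (n + 1)))) Nat.succ) :: Γ.map Fm.shiftF) ψ.shiftF) :
    Prov Γ ψ :=
  .exFE (.impE (.ofTheory (.choice φ hφ)) h) hs

/-! ### Prime theories -/

/-- Provability from a set of hypotheses. -/
def SetProv (U : Set Fm) (φ : Fm) : Prop := ∃ L : List Fm, (∀ ψ ∈ L, ψ ∈ U) ∧ Prov L φ

/-- A consistent prime theory closed under provability. -/
structure Mod where
  U : Set Fm
  closed : ∀ {L : List Fm} {φ : Fm}, Prov L φ → (∀ ψ ∈ L, ψ ∈ U) → φ ∈ U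
  prime : ∀ {φ ψ : Fm}, Fm.or φ ψ ∈ U → φ ∈ U ∨ ψ ∈ U
  cons : Fm.bot ∉ U

theorem SetProv.insert_iff {U : Set Fm} {φ ψ : Fm} (h : SetProv (insert φ U) ψ) :
    SetProv U (.imp φ ψ) := by
  classical
  obtain ⟨L, hL, h⟩ := h
  refine ⟨L.filter (fun x => x ≠ φ), fun χ hχ => ?_, .impI (h.mono fun x hx => ?_)⟩
  · rw [List.mem_filter] at hχ
    have h2 := hL χ hχ.1
    simp at hχ
    exact h2.resolve_left hχ.2
  · by_cases hxφ : x = φ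
    · simp [hxφ]
    · simp [hxφ, hx]

theorem SetProv.cut {U : Set Fm} {L : List Fm} {φ : Fm} (h : Prov L φ)
    (hL : ∀ ψ ∈ L, SetProv U ψ) : SetProv U φ := by
  induction L generalizing φ with
  | nil => exact ⟨[], by simp, h⟩
  | cons a L ih =>
    obtain ⟨L1, h1, h2⟩ := ih (.impI h) fun ψ hψ => hL ψ (List.mem_cons_of_mem _ hψ)
    obtain ⟨L2, h3, h4⟩ := hL a List.mem_cons_self
    refine ⟨L1 ++ L2, fun ψ hψ => (List.mem_append.1 hψ).elim (h1 ψ) (h3 ψ),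
      .impE (h2.mono (by simp)) (h4.mono (by simp))⟩

/-- A set maximal among those that do not prove `χ` is deductively closed and prime, because every
formula outside it implies `χ` over it. -/
theorem exists_mod {Γ : List Fm} {χ : Fm} (h : ¬ Prov Γ χ) :
    ∃ M : Mod, (∀ φ ∈ Γ, φ ∈ M.U) ∧ χ ∉ M.U := by
  obtain ⟨U, hΓU, hU⟩ := zorn_subset_nonempty {U : Set Fm | ¬ SetProv U χ} (by
    intro c hc hch hne
    refine ⟨⋃₀ c, ?_, fun s hs => Set.subset_sUnion_of_mem hs⟩
    rintro ⟨L, hL, hp⟩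
    -- A derivation uses finitely many hypotheses, so one member of the chain contains them all.
    have : ∃ s ∈ c, ∀ ψ ∈ L, ψ ∈ s := by
      clear hp
      induction L with
      | nil => exact ⟨_, hne.some_mem, by simp⟩
      | cons a L ih =>
        obtain ⟨s, hs, h1⟩ := ih fun ψ hψ => hL ψ (List.mem_cons_of_mem _ hψ)
        obtain ⟨s', hs', h2⟩ := hL a List.mem_cons_self
        rcases hch.total hs hs' with h | h
        · exact ⟨s', hs', by simpa [h2] using fun ψ hψ => h (h1 ψ hψ)⟩
        · exact ⟨s, hs, by simpa [h h2] using h1⟩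
    obtain ⟨s, hs, h1⟩ := this
    exact hc hs ⟨L, h1, hp⟩) {φ | φ ∈ Γ} (by
      rintro ⟨L, hL, hp⟩
      exact h (hp.mono hL))
  have hmax : ∀ φ, φ ∉ U → SetProv U (.imp φ χ) := fun φ hφ => by
    by_contra hcon
    exact hφ (hU.2 (y := insert φ U) (fun hc => hcon hc.insert_iff) (Set.subset_insert _ _)
      (Set.mem_insert _ _))
  have hno : ¬ SetProv U χ := hU.1
  have hcl : ∀ φ, SetProv U φ → φ ∈ U := fun φ hφ => by
    by_contra hcon
    refine hno (SetProv.cut (L := [.imp φ χ, φ]) (.impE (.hyp (φ := .imp φ χ) (by simp))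
      (.hyp (by simp))) ?_)
    simpa using ⟨hmax φ hcon, hφ⟩
  have hmem : ∀ φ ∈ U, SetProv U φ := fun φ hφ => ⟨[φ], by simpa, .hyp (by simp)⟩
  refine ⟨⟨U, fun h hL => hcl _ ⟨_, hL, h⟩, fun {φ ψ} hor => ?_, fun hb => ?_⟩, hΓU,
    fun hχ => hno (hmem _ hχ)⟩
  -- If neither disjunct belonged to `U`, both would imply `χ`, and case distinction would prove
  -- `χ`.
  · by_contra! hcon
    refine hno (SetProv.cut (L := [.or φ ψ, .imp φ χ, .imp ψ χ])
      (.orE (.hyp (φ := .or φ ψ) (by simp)) (.impE (.hyp (φ := .imp φ χ) (by simp)) (.hyp (by simp)))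
        (.impE (.hyp (φ := .imp ψ χ) (by simp)) (.hyp (by simp)))) ?_)
    simpa using ⟨hmem _ hor, hmax _ hcon.1, hmax _ hcon.2⟩
  · exact hno (SetProv.cut (L := [.bot]) (.botE (.hyp (by simp))) (by simpa using hmem _ hb))

/-! ## Models: terms modulo a prime theory -/

/-- Finitely many variables occur in a term; this reduces simultaneous replacement of equals to
finitely many single replacements. -/
theorem Tm.exists_bound (t : Tm) : ∃ N, ∀ (σ σ' : ℕ → Tm) (ρ : ℕ → ℕ),
    (∀ i < N, σ i = σ' i) → t.subst σ ρ = t.subst σ' ρ := by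
  induction t with
  | var n => exact ⟨n + 1, fun σ σ' ρ h => h n (Nat.lt_succ_self n)⟩
  | zero => exact ⟨0, fun σ σ' ρ h => rfl⟩
  | succ t ih => obtain ⟨N, h⟩ := ih; exact ⟨N, fun σ σ' ρ h' => by simp [subst, h _ _ ρ h']⟩
  | app α t ih => obtain ⟨N, h⟩ := ih; exact ⟨N, fun σ σ' ρ h' => by simp [subst, h _ _ ρ h']⟩
  | recur a b t iha ihb iht =>
    obtain ⟨N1, h1⟩ := iha
    obtain ⟨N2, h2⟩ := ihb
    obtain ⟨N3, h3⟩ := iht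
    refine ⟨N1 + N2 + N3, fun σ σ' ρ h' => ?_⟩
    simp only [subst]
    rw [h1 σ σ' ρ fun i hi => h' i (by omega), h3 σ σ' ρ fun i hi => h' i (by omega),
      h2 (up (up σ)) (up (up σ')) ρ]
    rintro (_ | _ | i) hi
    · rfl
    · rfl
    · rw [up_up_add_two, up_up_add_two, h' i (by omega)]

namespace Mod

variable (M : Mod)

theorem mem_of_prov {φ : Fm} (h : Prov [] φ) : φ ∈ M.U := M.closed h (by simp)

theorem eq_refl (t : Tm) : Fm.eq t t ∈ M.U := M.mem_of_prov (.eqRefl t)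

variable {M}

theorem mem_of_eq {s t : Tm} (φ : Fm) (h : Fm.eq s t ∈ M.U) (h' : φ.instN s ∈ M.U) :
    φ.instN t ∈ M.U :=
  M.closed (L := [.eq s t, φ.instN s])
    (.eqSubst φ (s := s) (.hyp (by simp)) (.hyp (by simp))) (by simp [h, h'])

theorem mp {φ ψ : Fm} (h : Fm.imp φ ψ ∈ M.U) (h' : φ ∈ M.U) : ψ ∈ M.U :=
  M.closed (L := [.imp φ ψ, φ])
    (.impE (.hyp (φ := .imp φ ψ) (by simp)) (.hyp (by simp))) (by simp [h, h'])

theorem subst_one_shift (t s : Tm) : (t.shift 1 0).subst (scons s Tm.var) id = t := by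
  rw [Tm.subst_shift]; exact Tm.subst_id t

theorem eq_symm {s t : Tm} (h : Fm.eq s t ∈ M.U) : Fm.eq t s ∈ M.U := by
  have := mem_of_eq (.eq (.var 0) (s.shift 1 0)) h
  simp only [Fm.instN, Fm.subst, Tm.subst, subst_one_shift, scons_zero] at this
  exact this (M.eq_refl s)

theorem eq_trans {s t u : Tm} (h : Fm.eq s t ∈ M.U) (h' : Fm.eq t u ∈ M.U) :
    Fm.eq s u ∈ M.U := by
  have := mem_of_eq (.eq (s.shift 1 0) (.var 0)) h'
  simp only [Fm.instN, Fm.subst, Tm.subst, subst_one_shift, scons_zero] at this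
  exact this h

theorem eq_congr_one {s t : Tm} (u : Tm) (h : Fm.eq s t ∈ M.U) :
    Fm.eq (u.subst (scons s Tm.var) id) (u.subst (scons t Tm.var) id) ∈ M.U := by
  have := mem_of_eq (.eq ((u.subst (scons s Tm.var) id).shift 1 0) u) h
  simp only [Fm.instN, Fm.subst, subst_one_shift] at this
  exact this (M.eq_refl _)

theorem eq_congr {σ σ' : ℕ → Tm} (t : Tm) (h : ∀ i, Fm.eq (σ i) (σ' i) ∈ M.U) :
    Fm.eq (t.subst σ id) (t.subst σ' id) ∈ M.U := by
  obtain ⟨N, hN⟩ := t.exists_bound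
  -- The equality rule replaces one variable only, so the two substitutions are interpolated
  -- variable by variable.
  have key : ∀ n, Fm.eq (t.subst σ id) (t.subst (fun i => if i < n then σ' i else σ i) id) ∈ M.U := by
    intro n
    induction n with
    | zero => simpa using M.eq_refl _
    | succ n ih =>
      refine eq_trans ih ?_
      have := eq_congr_one (t.subst (fun i => if i = n then .var 0 else
        (if i < n then σ' i else σ i).shift 1 0) id) (h n)
      rw [Tm.subst_subst, Tm.subst_subst] at this
      convert this using 2
      · congr 1; funext i
        by_cases hi : i = n
        · simp [hi, Tm.subst]
        · simp [hi, subst_one_shift]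
      · congr 1; funext i
        by_cases hi : i = n
        · simp [hi, Tm.subst]
        · have : i < n + 1 ↔ i < n := by omega
          simp [hi, subst_one_shift, this]
  have := key N
  rwa [hN (fun i => if i < N then σ' i else σ i) σ' id (fun i hi => by simp [hi])] at this

variable (M)

def setoid : Setoid Tm where
  r s t := Fm.eq s t ∈ M.U
  iseqv := ⟨M.eq_refl, eq_symm, eq_trans⟩

/-- The carrier of the model. -/
def C : Type := Quotient M.setoid

variable {M}

def cls (t : Tm) : M.C := Quotient.mk M.setoid t

theorem cls_eq {s t : Tm} : (cls s : M.C) = cls t ↔ Fm.eq s t ∈ M.U := Quotient.eq (r := M.setoid)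

noncomputable def rep (x : M.C) : Tm := Quotient.out x

theorem cls_rep (x : M.C) : cls (rep x) = x := Quotient.out_eq x

/-- The value of a term. -/
noncomputable def eval (env : ℕ → M.C) (t : Tm) : M.C := cls (t.subst (fun i => rep (env i)) id)

/-- By congruence, values do not depend on the representatives that `rep` picks. -/
theorem eval_cls (σ : ℕ → Tm) (t : Tm) :
    eval (fun i => (cls (σ i) : M.C)) t = cls (t.subst σ id) :=
  cls_eq.2 (eq_congr t fun _ => cls_eq.1 (cls_rep _))

@[simp] theorem eval_var (env : ℕ → M.C) (n : ℕ) : eval env (.var n) = env n := cls_rep _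

theorem eval_subst (env : ℕ → M.C) (σ : ℕ → Tm) (t : Tm) :
    eval env (t.subst σ id) = eval (fun i => eval env (σ i)) t := by
  conv_rhs => rw [show (fun i => eval env (σ i)) =
    fun i => cls ((σ i).subst (fun i => rep (env i)) id) from rfl, eval_cls]
  rw [eval, Tm.subst_subst]; rfl

theorem eval_shift (env : ℕ → M.C) (n : ℕ) (t : Tm) :
    eval env (t.shift n 0) = eval (fun i => env (i + n)) t := by
  rw [Tm.shift_eq_subst]
  exact (eval_subst env (fun i => .var (i + n)) t).trans (by simp)

noncomputable instance : Zero M.C := ⟨cls .zero⟩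

/-- The successor function of the model. -/
noncomputable def suc (x : M.C) : M.C := eval (fun _ => x) (.succ (.var 0))

/-- The interpretation of a function variable. -/
noncomputable def fn (α : ℕ) (x : M.C) : M.C := eval (fun _ => x) (.app α (.var 0))

@[simp] theorem eval_zero (env : ℕ → M.C) : eval env .zero = 0 := rfl

theorem eval_succ' (env : ℕ → M.C) (t : Tm) : eval env (.succ t) = suc (eval env t) :=
  eval_subst env (fun _ => t) (.succ (.var 0))

@[simp] theorem eval_app (env : ℕ → M.C) (α : ℕ) (t : Tm) :
    eval env (.app α t) = fn α (eval env t) :=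
  eval_subst env (fun _ => t) (.app α (.var 0))

/-- The interpretation of primitive recursion. -/
noncomputable def prec (env : ℕ → M.C) (a b : Tm) (x : M.C) : M.C :=
  eval (scons x env) (.recur (a.shift 1 0) (b.subst (Tm.up (Tm.up fun i => .var (i + 1))) id) (.var 0))

theorem eval_recur (env : ℕ → M.C) (a b t : Tm) :
    eval env (.recur a b t) = prec env a b (eval env t) := by
  have := eval_subst env (scons t .var)
    (.recur (a.shift 1 0) (b.subst (Tm.up (Tm.up fun i => .var (i + 1))) id) (.var 0))
  rw [prec]
  convert this using 1
  · congr 1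
    simp only [Tm.subst, subst_one_shift, scons_zero, Tm.subst_subst, id]
    congr 1
    conv_lhs => rw [← Tm.subst_id' b]
    congr 1
    funext i
    rcases i with _ | _ | i <;> rfl
  · congr 1; funext i; cases i <;> simp

theorem cls_env (env : ℕ → M.C) : env = fun i => cls (rep (env i)) := by
  funext i; exact (cls_rep _).symm

theorem prec_zero (env : ℕ → M.C) (a b : Tm) : prec env a b 0 = eval env a := by
  rw [← eval_zero env, ← eval_recur]
  exact cls_eq.2 (M.mem_of_prov (.ofTheory (.recur_zero _ _)))

theorem prec_suc (env : ℕ → M.C) (a b : Tm) (x : M.C) :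
    prec env a b (suc x) = eval (scons (prec env a b x) (scons x env)) b := by
  have h : eval (scons x env) (.recur (a.shift 1 0) (b.subst (Tm.up (Tm.up fun i => .var (i + 1))) id)
      (.succ (.var 0))) = prec env a b (suc x) := by
    have := eval_recur (scons x env) (a.shift 1 0)
      (b.subst (Tm.up (Tm.up fun i => .var (i + 1))) id) (.succ (.var 0))
    rw [this, prec, prec, eval_succ', eval_var]
    have h2 := eval_subst (scons (suc x) (scons x env)) (scons (.var 0) fun i => .var (i + 2))
      (.recur (a.shift 1 0) (b.subst (Tm.up (Tm.up fun i => .var (i + 1))) id) (.var 0))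
    rw [show (fun i => eval (scons (suc x) (scons x env)) (scons (Tm.var 0) (fun i => Tm.var (i + 2)) i))
      = scons (suc x) env by funext i; cases i <;> simp] at h2
    rw [scons_zero, ← h2]
    congr 1
    simp only [Tm.subst, scons_zero, Tm.subst_subst, id, Tm.subst_shift, Tm.shift_shift]
    congr 1
    · rw [Tm.shift_eq_subst]; rfl
    · congr 1
      funext i
      rcases i with _ | _ | i <;> rfl
  rw [← h]
  refine (cls_eq.2 (M.mem_of_prov (.ofTheory (.recur_succ _ _ _)))).trans ?_
  rw [Tm.subst_subst, Tm.subst_subst]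
  refine (eval_cls _ b).symm.trans ?_
  congr 1
  funext i
  rcases i with _ | _ | i
  · rfl
  · exact cls_rep _
  · change cls ((Tm.up (Tm.up fun i => rep (scons x env i)) (i + 1 + 2)).subst
      (scons _ (scons _ Tm.var)) id) = env i
    rw [Tm.up_up_add_two, Tm.subst_shift]
    exact (congrArg cls (Tm.subst_id _)).trans (cls_rep _)

theorem suc_ne_zero (x : M.C) : suc x ≠ 0 := fun h =>
  M.cons (mp (M.mem_of_prov (.ofTheory (.succ_ne_zero (rep x)))) (cls_eq.1 h))

/-! ### Satisfaction -/

/-- Tarskian satisfaction of formulas with number quantifiers only. -/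
def sat : (ℕ → M.C) → Fm → Prop
  | env, .eq s t => eval env s = eval env t
  | _, .bot => False
  | env, .and φ ψ => sat env φ ∧ sat env ψ
  | env, .or φ ψ => sat env φ ∨ sat env ψ
  | env, .imp φ ψ => sat env φ → sat env ψ
  | env, .allN φ => ∀ x, sat (scons x env) φ
  | env, .exN φ => ∃ x, sat (scons x env) φ
  -- The values at function quantifiers are placeholders: none of the formula classes for which
  -- truth is compared with membership or provability contains them.
  | _, .allF _ => True
  | _, .exF _ => True

theorem eval_up (env : ℕ → M.C) (σ : ℕ → Tm) (x : M.C) :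
    (fun i => eval (scons x env) (Tm.up σ i)) = scons x fun i => eval env (σ i) := by
  funext i
  cases i with
  | zero => exact eval_var _ _
  | succ i => exact eval_shift _ _ _

theorem sat_subst (env : ℕ → M.C) (σ : ℕ → Tm) (φ : Fm) :
    sat env (φ.subst σ id) ↔ sat (fun i => eval env (σ i)) φ := by
  induction φ generalizing env σ <;> simp_all [sat, Fm.subst, eval_subst, eval_up]

theorem sat_shiftN (env : ℕ → M.C) (φ : Fm) :
    sat env φ.shiftN ↔ sat (fun i => env (i + 1)) φ := by
  rw [Fm.shiftN, sat_subst]; simp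

theorem sat_instN (env : ℕ → M.C) (φ : Fm) (t : Tm) :
    sat env (φ.instN t) ↔ sat (scons (eval env t) env) φ := by
  rw [Fm.instN, sat_subst]
  rw [show (fun i => eval env (scons t Tm.var i)) = scons (eval env t) env by
    funext i; cases i <;> simp]

theorem mem_and {φ ψ : Fm} : Fm.and φ ψ ∈ M.U ↔ φ ∈ M.U ∧ ψ ∈ M.U := by
  refine ⟨fun h => ⟨M.closed (L := [.and φ ψ]) (.andL (ψ := ψ) (.hyp (by simp))) (by simpa),
    M.closed (L := [.and φ ψ]) (.andR (φ := φ) (.hyp (by simp))) (by simpa)⟩, fun h =>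
    M.closed (L := [φ, ψ]) (.andI (.hyp (by simp)) (.hyp (by simp))) (by simpa using h)⟩

theorem mem_or {φ ψ : Fm} : Fm.or φ ψ ∈ M.U ↔ φ ∈ M.U ∨ ψ ∈ M.U := by
  refine ⟨M.prime, ?_⟩
  rintro (h | h)
  · exact M.closed (L := [φ]) (.orL (.hyp (by simp))) (by simpa)
  · exact M.closed (L := [ψ]) (.orR (.hyp (by simp))) (by simpa)

end Mod

/-! ### Truth compared with membership -/

/-- A class of quantifier free formulas, closed under substitution, for which satisfaction in
models is membership. -/
structure Absolute (P : Fm → Prop) : Prop where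
  qf : ∀ {φ}, P φ → φ.QF
  subst : ∀ {φ}, P φ → ∀ σ ρ, P (φ.subst σ ρ)
  sat_iff : ∀ {φ}, P φ → ∀ (M : Mod) (σ : ℕ → Tm),
    Mod.sat (fun i => (Mod.cls (σ i) : M.C)) φ ↔ φ.subst σ id ∈ M.U

/-- A prime theory that contains `Γ` and omits `χ` refutes `χ` in its own term model, with every
variable denoting its own class. -/
theorem Absolute.complete {P : Fm → Prop} (hP : Absolute P) {Γ : List Fm} {χ : Fm} (hχ : P χ)
    (hΓ : ∀ ψ ∈ Γ, P ψ)
    (h : ∀ (M : Mod) (env : ℕ → M.C), (∀ ψ ∈ Γ, Mod.sat env ψ) → Mod.sat env χ) : Prov Γ χ := by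
  by_contra hcon
  obtain ⟨M, h1, h2⟩ := exists_mod hcon
  apply h2
  have := h M (fun i => Mod.cls (.var i)) fun ψ hψ => by
    rw [hP.sat_iff (hΓ ψ hψ), Fm.subst_id]; exact h1 ψ hψ
  rwa [hP.sat_iff hχ, Fm.subst_id] at this

/-- Induction on a formula, with both premises checked in all models. -/
theorem Absolute.induction {P : Fm → Prop} (hP : Absolute P) {φ : Fm} (hφ : P φ)
    (h0 : ∀ (M : Mod) (env : ℕ → M.C), Mod.sat (scons 0 env) φ)
    (hs : ∀ (M : Mod) (env : ℕ → M.C) (x : M.C), Mod.sat (scons x env) φ →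
      Mod.sat (scons (Mod.suc x) env) φ)
    {M : Mod} (env : ℕ → M.C) (x : M.C) : Mod.sat (scons x env) φ := by
  -- Parameters become representing terms. As the premises hold in all models, they are derivable
  -- without hypotheses, and the induction axiom then applies inside the theory of `M`.
  set σ : ℕ → Tm := fun i => Mod.rep (env i)
  have hφ' := hP.subst hφ (Tm.up σ) id
  have h := Prov.induction (Γ := []) (φ := φ.subst (Tm.up σ) id) (hP.qf hφ') ?_ ?_ (Mod.rep x)
  · rw [Mod.cls_env (scons x env), hP.sat_iff hφ]
    refine M.mem_of_prov ?_
    rw [Fm.instN, Fm.subst_subst] at h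
    convert h using 1
    congr 1
    funext i
    cases i with
    | zero => rfl
    | succ i => exact (Mod.subst_one_shift _ _).symm
  · refine hP.complete (hP.subst hφ' _ _) (by simp) fun M env _ => ?_
    rw [Mod.sat_instN, Mod.sat_subst, Mod.eval_up]
    exact h0 M _
  · refine hP.complete (hP.subst hφ' _ _) (by simpa using hφ') fun M env h => ?_
    have h := h _ List.mem_cons_self
    rw [← scons_head_tail env, Mod.sat_subst, Mod.eval_up] at h
    rw [Mod.sat_subst, show (fun i => Mod.eval env
        (scons (Tm.var 0).succ (fun n => Tm.var (n + 1)) i)) =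
      scons (Mod.suc (env 0)) fun i => env (i + 1) by funext i; cases i <;> simp [Mod.eval_succ'],
      Mod.sat_subst, Mod.eval_up]
    exact hs M _ _ h

namespace Mod

variable {M : Mod}

/-! ### The basic operations -/

/-- Arithmetical terms such as `Tm.add` contain their arguments inside a recursion; this moves the
arguments to the environment, so that each operation becomes a function on the carrier. -/
theorem prec_subst (env : ℕ → M.C) (σ : ℕ → Tm) (a b : Tm) (x : M.C) :
    prec env (a.subst σ id) (b.subst (Tm.up (Tm.up σ)) id) x =
      prec (fun i => eval env (σ i)) a b x := by
  have := eval_subst (scons x env) (scons (.var 0) fun i => (σ i).shift 1 0)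
    (.recur (a.shift 1 0) (b.subst (Tm.up (Tm.up fun i => .var (i + 1))) id) (.var 0))
  rw [show (fun i => eval (scons x env) (scons (Tm.var 0) (fun i => (σ i).shift 1 0) i)) =
    scons x fun i => eval env (σ i) by
      funext i; cases i <;> simp [eval_shift]] at this
  rw [prec, prec, ← this]
  congr 1
  simp only [Tm.subst, Tm.subst_subst, Tm.subst_shift, Tm.shift_subst, scons_zero, scons_succ, id]
  congr 2
  funext i
  rcases i with _ | _ | i
  · rfl
  · rfl
  · simp only [Tm.up_up_add_two, Tm.subst_shift, Tm.subst, scons_succ]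
    rw [Tm.shift_shift]
    simp [Tm.shift_eq_subst, Tm.subst]

noncomputable instance : One M.C := ⟨suc 0⟩

noncomputable instance : Add M.C :=
  ⟨fun x y => prec (fun _ => x) (.var 0) (.succ (.var 0)) y⟩

/-- The predecessor. -/
noncomputable def prd (x : M.C) : M.C := prec (fun _ => 0) .zero (.var 1) x

noncomputable instance : Sub M.C :=
  ⟨fun x y => prec (fun _ => x) (.var 0) (.pred (.var 0)) y⟩

noncomputable instance : Mul M.C :=
  ⟨fun x y => prec (fun _ => x) .zero (.add (.var 0) (.var 2)) y⟩

theorem eval_add (env : ℕ → M.C) (a b : Tm) : eval env (.add a b) = eval env a + eval env b :=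
  (eval_recur _ _ _ _).trans (prec_subst env (fun _ => a) (.var 0) (.succ (.var 0)) _)

theorem eval_pred (env : ℕ → M.C) (a : Tm) : eval env (.pred a) = prd (eval env a) :=
  (eval_recur _ _ _ _).trans (prec_subst env (fun _ => .zero) .zero (.var 1) _)

theorem eval_sub (env : ℕ → M.C) (a b : Tm) : eval env (.sub a b) = eval env a - eval env b :=
  (eval_recur _ _ _ _).trans (prec_subst env (fun _ => a) (.var 0) (.pred (.var 0)) _)

theorem eval_mul (env : ℕ → M.C) (a b : Tm) : eval env (.mul a b) = eval env a * eval env b := by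
  refine (eval_recur _ _ _ _).trans ?_
  have := prec_subst env (fun _ => a) .zero (.add (.var 0) (.var 2)) (eval env b)
  rw [← Tm.up_up_add_two (fun _ => a) 0]
  exact this

theorem one_eq : (1 : M.C) = suc 0 := rfl

theorem add_zero' (x : M.C) : x + 0 = x := (prec_zero _ _ _).trans (eval_var _ _)

theorem add_suc (x y : M.C) : x + suc y = suc (x + y) := by
  refine (prec_suc _ _ _ _).trans ?_
  rw [eval_succ', eval_var]; rfl

theorem suc_eq (x : M.C) : suc x = x + 1 := by rw [one_eq, add_suc, add_zero']

theorem prd_zero : prd (0 : M.C) = 0 := prec_zero _ _ _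

theorem prd_suc (x : M.C) : prd (suc x) = x := (prec_suc _ _ _ _).trans (eval_var _ _)

theorem sub_zero' (x : M.C) : x - 0 = x := (prec_zero _ _ _).trans (eval_var _ _)

theorem sub_suc (x y : M.C) : x - suc y = prd (x - y) := by
  refine (prec_suc _ _ _ _).trans ?_
  rw [eval_pred, eval_var]; rfl

theorem mul_zero' (x : M.C) : x * 0 = 0 := (prec_zero _ _ _).trans (eval_zero _)

theorem mul_suc (x y : M.C) : x * suc y = x * y + x := by
  refine (prec_suc _ _ _ _).trans ?_
  rw [eval_add, eval_var, eval_var]; rfl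

attribute [simp] eval_succ' eval_add eval_pred eval_sub eval_mul

end Mod

/-! ### Positive formulas -/

/-- Quantifier free formulas without implications. -/
def Fm.Pos : Fm → Prop
  | eq _ _ => True
  | bot => True
  | and φ ψ => Pos φ ∧ Pos ψ
  | or φ ψ => Pos φ ∧ Pos ψ
  | _ => False

/-- Without implications primeness alone suffices. This class supports the arithmetic that proves
decidability of equality, after which all quantifier-free formulas become available. -/
theorem Fm.absolute_pos : Absolute Fm.Pos where
  qf {φ} h := by induction φ <;> simp_all [QF, Pos]
  subst {φ} h σ ρ := by induction φ <;> simp_all [Fm.subst, Pos]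
  sat_iff {φ} h M σ := by
    induction φ <;> simp_all [Fm.Pos, Mod.sat, Fm.subst, Mod.mem_and, Mod.mem_or, M.cons,
      Mod.eval_cls, Mod.cls_eq]

namespace Mod

variable {M : Mod}

open Tm (var)

/-! ### Equality is decidable -/

theorem zero_add' (x : M.C) : 0 + x = x := by
  have := Fm.absolute_pos.induction (φ := .eq (.add .zero (var 0)) (var 0)) trivial
    (fun M env => by simp [sat, add_zero']) (fun M env x => by simp +contextual [sat, add_suc])
    (fun _ => 0) x
  simpa [sat] using this

theorem suc_add (x y : M.C) : suc x + y = suc (x + y) := by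
  have := Fm.absolute_pos.induction
    (φ := .eq (.add (.succ (var 1)) (var 0)) (.succ (.add (var 1) (var 0)))) trivial
    (fun M env => by simp [sat, add_zero']) (fun M env x => by simp +contextual [sat, add_suc])
    (fun _ => x) y
  simpa [sat] using this

theorem suc_sub_suc (x y : M.C) : suc x - suc y = x - y := by
  have := Fm.absolute_pos.induction
    (φ := .eq (.sub (.succ (var 1)) (.succ (var 0))) (.sub (var 1) (var 0))) trivial
    (fun M env => by simp [sat, sub_zero', sub_suc, prd_suc])
    (fun M env x h => by
      simp [sat] at h
      simp only [sat, eval_sub, eval_succ', eval_var, scons_zero, scons_succ]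
      rw [sub_suc, h, ← sub_suc])
    (fun _ => x) y
  simpa [sat] using this

theorem add_sub_self (x y : M.C) : x + y - y = x := by
  have := Fm.absolute_pos.induction (φ := .eq (.sub (.add (var 1) (var 0)) (var 0)) (var 1)) trivial
    (fun M env => by simp [sat, sub_zero', add_zero'])
    (fun M env x => by simp +contextual [sat, add_suc, suc_sub_suc])
    (fun _ => x) y
  simpa [sat] using this

theorem eq_zero_or_suc (x : M.C) : x = 0 ∨ x = suc (prd x) := by
  have := Fm.absolute_pos.induction
    (φ := .or (.eq (var 0) .zero) (.eq (var 0) (.succ (.pred (var 0))))) ⟨trivial, trivial⟩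
    (fun M env => by simp [sat]) (fun M env x => by simp [sat, prd_suc])
    (fun _ => 0) x
  simpa [sat] using this

/-- Comparability is expressed with explicit differences, hence by a positive formula to which
induction already applies. -/
theorem eq_sub_add_or (x y : M.C) : x = x - y + y ∨ y = y - x + x := by
  have := Fm.absolute_pos.induction
    (φ := .or (.eq (var 1) (.add (.sub (var 1) (var 0)) (var 0)))
      (.eq (var 0) (.add (.sub (var 0) (var 1)) (var 1)))) ⟨trivial, trivial⟩
    (fun M env => by simp [sat, sub_zero', add_zero'])
    (fun M env y h => by
      simp only [sat, eval_sub, eval_add, eval_var, scons_zero, scons_succ] at h ⊢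
      generalize env 0 = x at h ⊢
      rcases h with h | h
      · rcases eq_zero_or_suc (x - y) with h0 | h0
        · right
          rw [h0, zero_add'] at h
          subst h
          have := add_sub_self (suc 0) x
          rw [suc_add, zero_add'] at this
          rw [this, suc_add, zero_add']
        · left
          rw [sub_suc, add_suc, ← suc_add, ← h0]; exact h
      · right
        have := add_sub_self (suc (y - x)) x
        rw [suc_add, ← h] at this
        rw [this, suc_add, ← h])
    (fun _ => x) y
  simpa [sat] using this

theorem eq_or_eq_suc_add (x y : M.C) : x = y ∨ x = suc (prd (x - y)) + y ∨
    y = suc (prd (y - x)) + x := by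
  rcases eq_sub_add_or x y with h | h
  · rcases eq_zero_or_suc (x - y) with h0 | h0
    · rw [h0, zero_add'] at h; exact .inl h
    · rw [← h0]; exact .inr (.inl h)
  · rcases eq_zero_or_suc (y - x) with h0 | h0
    · rw [h0, zero_add'] at h; exact .inl h.symm
    · rw [← h0]; exact .inr (.inr h)

theorem ne_suc_add (x y : M.C) : x ≠ suc y + x := fun h => by
  have h1 := add_sub_self (suc y) x
  have h2 := add_sub_self 0 x
  rw [← h] at h1
  rw [zero_add', h1] at h2
  exact suc_ne_zero _ h2

/-- Implications are not yet covered, so `impI` moves the equation to the context and leaves the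
positive goal `⊥`. -/
theorem neg_eq_mem_of {s t u : Tm} (h : Fm.eq s (.add (.succ u) t) ∈ M.U) :
    Fm.neg (.eq s t) ∈ M.U ∧ Fm.neg (.eq t s) ∈ M.U := by
  constructor <;> refine M.closed (L := [.eq s (.add (.succ u) t)]) (.impI
    (Fm.absolute_pos.complete trivial (by simp [Fm.Pos]) fun M env h => ?_)) (by simpa) <;>
    simp [sat] at h ⊢
  · exact ne_suc_add _ _ (h.1.symm.trans h.2)
  · exact ne_suc_add _ _ (h.1.trans h.2)

/-- Trichotomy with explicit differences is a positive truth; primeness picks a disjunct, and a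
successor difference excludes equality. -/
theorem dec_eq (s t : Tm) : Fm.eq s t ∈ M.U ∨ Fm.neg (.eq s t) ∈ M.U := by
  have h := eq_or_eq_suc_add (cls s : M.C) (cls t)
  have : sat (fun i => (cls (scons s (fun _ => t) i) : M.C)) (.or (.eq (var 0) (var 1)) (.or
      (.eq (var 0) (.add (.succ (.pred (.sub (var 0) (var 1)))) (var 1)))
      (.eq (var 1) (.add (.succ (.pred (.sub (var 1) (var 0)))) (var 0))))) := by
    simpa [sat] using h
  rw [Fm.absolute_pos.sat_iff (by simp [Fm.Pos])] at this
  simp only [Fm.subst, mem_or] at this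
  rcases this with h | h | h
  · exact .inl h
  · exact .inr (neg_eq_mem_of h).1
  · exact .inr (neg_eq_mem_of h).2

theorem dec {φ : Fm} (h : φ.QF) : φ ∈ M.U ∨ Fm.neg φ ∈ M.U := by
  have hyp2 : ∀ {φ ψ : Fm}, Prov [φ] ψ → φ ∈ M.U → ψ ∈ M.U :=
    fun h h' => M.closed h (by simpa)
  have hyp3 : ∀ {φ ψ χ : Fm}, Prov [φ, ψ] χ → φ ∈ M.U → ψ ∈ M.U → χ ∈ M.U :=
    fun h h' h'' => M.closed h (by simp [h', h''])
  induction φ with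
  | eq s t => exact dec_eq s t
  | bot => exact .inr (M.mem_of_prov (.impI (.hyp (by simp))))
  | and φ ψ ih1 ih2 =>
    rcases ih1 h.1 with h1 | h1
    · rcases ih2 h.2 with h2 | h2
      · exact .inl (mem_and.2 ⟨h1, h2⟩)
      · exact .inr (hyp2 (.impI (.impE (φ := ψ) (.hyp (by simp [Fm.neg]))
          (.andR (φ := φ) (.hyp (by simp))))) h2)
    · exact .inr (hyp2 (.impI (.impE (φ := φ) (.hyp (by simp [Fm.neg]))
        (.andL (ψ := ψ) (.hyp (by simp))))) h1)
  | or φ ψ ih1 ih2 =>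
    rcases ih1 h.1 with h1 | h1
    · exact .inl (mem_or.2 (.inl h1))
    · rcases ih2 h.2 with h2 | h2
      · exact .inl (mem_or.2 (.inr h2))
      · exact .inr (hyp3 (.impI (.orE (φ := φ) (ψ := ψ) (.hyp (by simp))
          (.impE (φ := φ) (.hyp (by simp [Fm.neg])) (.hyp (by simp)))
          (.impE (φ := ψ) (.hyp (by simp [Fm.neg])) (.hyp (by simp))))) h1 h2)
  | imp φ ψ ih1 ih2 =>
    rcases ih1 h.1 with h1 | h1
    · rcases ih2 h.2 with h2 | h2
      · exact .inl (hyp2 (.impI (.hyp (by simp))) h2)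
      · exact .inr (hyp3 (.impI (.impE (φ := ψ) (.hyp (by simp [Fm.neg]))
          (.impE (φ := φ) (.hyp (by simp)) (.hyp (by simp))))) h1 h2)
    · exact .inl (hyp2 (.impI (.botE (.impE (φ := φ) (.hyp (by simp [Fm.neg]))
        (.hyp (by simp))))) h1)
  | allN | exN | allF | exF => exact h.elim

/-- In a prime intuitionistic theory implication need not be truth functional; decidability of the
antecedent makes it so. -/
theorem mem_imp {φ ψ : Fm} (h : φ.QF) : Fm.imp φ ψ ∈ M.U ↔ (φ ∈ M.U → ψ ∈ M.U) := by
  refine ⟨fun h => mp h, fun h' => ?_⟩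
  rcases dec (M := M) h with h1 | h1
  · exact M.closed (L := [ψ]) (.impI (.hyp (by simp))) (by simpa using h' h1)
  · exact M.closed (L := [.neg φ]) (.impI (.botE (.impE (φ := φ) (.hyp (by simp [Fm.neg]))
        (.hyp (by simp))))) (by simpa using h1)

end Mod

theorem Fm.absolute_qf : Absolute Fm.QF where
  qf h := h
  subst h σ ρ := h.subst σ ρ
  sat_iff {φ} h M σ := by
    induction φ <;> simp_all [Fm.QF, Mod.sat, Fm.subst, Mod.mem_and, Mod.mem_or, M.cons,
      Mod.eval_cls, Mod.cls_eq, Mod.mem_imp, Fm.QF.subst]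

/-! ### Completeness -/

namespace Fm

/-- Formulas true in every model in which they are members. -/
def Univ : Fm → Prop
  | eq _ _ => True
  | bot => True
  | and φ ψ => Univ φ ∧ Univ ψ
  | or φ ψ => QF φ ∧ QF ψ
  | imp φ ψ => QF φ ∧ Univ ψ
  | allN φ => Univ φ
  -- Existential formulas are excluded: a prime theory may contain one without containing any
  -- instance.
  | _ => False

/-- Formulas that are members of every model in which they are true. -/
def Exis : Fm → Prop
  | eq _ _ => True
  | bot => True
  | and φ ψ => Exis φ ∧ Exis ψ
  | or φ ψ => Exis φ ∧ Exis ψ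
  | imp φ ψ => QF φ ∧ QF ψ
  | exN φ => Exis φ
  -- Universal formulas are excluded: a theory may contain all term instances without the universal
  -- formula.
  | _ => False

/-- Formulas that are provable when they are true in all models. -/
def Goal : Fm → Prop
  | and φ ψ => Goal φ ∧ Goal ψ
  | imp φ ψ => Univ φ ∧ Goal ψ
  | allN φ => Goal φ
  | φ => Exis φ

theorem QF.univ {φ : Fm} (h : φ.QF) : φ.Univ := by
  induction φ <;> simp_all [QF, Univ]

theorem Univ.subst {φ : Fm} (h : φ.Univ) (σ : ℕ → Tm) (ρ : ℕ → ℕ) : (φ.subst σ ρ).Univ := by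
  induction φ generalizing σ <;> simp_all [Fm.subst, Univ, QF.subst]

theorem instN_subst_up (φ : Fm) (σ : ℕ → Tm) (t : Tm) :
    (φ.subst (Tm.up σ) id).instN t = φ.subst (scons t σ) id := by
  rw [instN, subst_subst]
  change φ.subst _ id = φ.subst _ id
  congr 1
  funext i
  cases i with
  | zero => rfl
  | succ i => exact Mod.subst_one_shift _ _

theorem Univ.sat {φ : Fm} (h : φ.Univ) {M : Mod} {σ : ℕ → Tm} (hm : φ.subst σ id ∈ M.U) :
    Mod.sat (fun i => (Mod.cls (σ i) : M.C)) φ := by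
  induction φ generalizing σ with
  | eq | bot | or => exact (absolute_qf.sat_iff (by simp_all [QF, Univ]) M σ).2 hm
  | and φ ψ ih1 ih2 =>
    rw [Fm.subst, Mod.mem_and] at hm
    exact ⟨ih1 h.1 hm.1, ih2 h.2 hm.2⟩
  | imp φ ψ ih1 ih2 =>
    exact fun h' => ih2 h.2 (Mod.mp hm ((absolute_qf.sat_iff h.1 M σ).1 h'))
  | allN φ ih =>
    intro x
    have h1 : (φ.subst (Tm.up σ) id).instN (Mod.rep x) ∈ M.U :=
      M.closed (L := [(Fm.allN φ).subst σ id]) (.allNE _ (.hyp (by simp [Fm.subst]))) (by simpa)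
    rw [instN_subst_up] at h1
    convert ih h h1 using 1
    funext i
    cases i with
    | zero => exact (Mod.cls_rep x).symm
    | succ i => rfl
  | exN | allF | exF => exact h.elim

theorem Exis.mem {φ : Fm} (h : φ.Exis) {M : Mod} {σ : ℕ → Tm}
    (hm : Mod.sat (fun i => (Mod.cls (σ i) : M.C)) φ) : φ.subst σ id ∈ M.U := by
  induction φ generalizing σ with
  | eq | bot | imp => exact (absolute_qf.sat_iff (by simp_all [QF, Exis]) M σ).1 hm
  | and φ ψ ih1 ih2 =>
    rw [Fm.subst, Mod.mem_and]
    exact ⟨ih1 h.1 hm.1, ih2 h.2 hm.2⟩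
  | or φ ψ ih1 ih2 =>
    rw [Fm.subst, Mod.mem_or]
    exact hm.imp (ih1 h.1) (ih2 h.2)
  | exN φ ih =>
    obtain ⟨x, hx⟩ := hm
    have h2 : φ.subst (scons (Mod.rep x) σ) id ∈ M.U := by
      apply ih h
      convert hx using 1
      funext i
      cases i with
      | zero => exact (Mod.cls_rep x)
      | succ i => rfl
    rw [← instN_subst_up] at h2
    exact M.closed (L := [(φ.subst (Tm.up σ) id).instN (Mod.rep x)])
      (.exNI (Mod.rep x) (.hyp (by simp))) (by simpa)
  | allN | allF | exF => exact h.elim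

end Fm

/-- Completeness for the class `Fm.Goal`. -/
theorem complete {Γ : List Fm} {χ : Fm} (hχ : χ.Goal)
    (h : ∀ (M : Mod) (env : ℕ → M.C), (∀ ψ ∈ Γ, ψ.Univ → Mod.sat env ψ) → Mod.sat env χ) :
    Prov Γ χ := by
  have base : ∀ (Γ : List Fm) (χ : Fm), χ.Exis → (∀ (M : Mod) (env : ℕ → M.C),
      (∀ ψ ∈ Γ, ψ.Univ → Mod.sat env ψ) → Mod.sat env χ) → Prov Γ χ := by
    intro Γ χ hχ h
    by_contra hcon
    obtain ⟨M, h1, h2⟩ := exists_mod hcon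
    apply h2
    have := hχ.mem (σ := Tm.var) (h M _ fun ψ hψ hu => hu.sat (by rw [Fm.subst_id]; exact h1 ψ hψ))
    rwa [Fm.subst_id] at this
  induction χ generalizing Γ with
  | and φ ψ ih1 ih2 =>
    exact .andI (ih1 hχ.1 fun M env h' => (h M env h').1) (ih2 hχ.2 fun M env h' => (h M env h').2)
  | imp φ ψ ih1 ih2 =>
    refine .impI (ih2 hχ.2 fun M env h' => h M env (fun χ h1 => h' χ (by simp [h1]))
      (h' φ (by simp) hχ.1))
  | allN φ ih =>
    refine .allNI (ih hχ fun M env h' => ?_)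
    have := h M (fun i => env (i + 1)) (fun ψ hψ hu => ?_) (env 0)
    · rwa [scons_head_tail] at this
    · rw [← Mod.sat_shiftN]
      exact h' _ (List.mem_map_of_mem hψ) (hu.subst _ _)
  | eq | bot | or | exN | allF | exF => exact base _ _ hχ h

/-! ## Characteristic terms and bounded quantifiers -/

/-- The value of `a` if `c` is zero, and of `b` otherwise. -/
def Tm.cite (c a b : Tm) : Tm := recur a (b.shift 2 0) c

/-- A term that is zero exactly when the quantifier free formula is true. -/
def Fm.chi : Fm → Tm
  | eq s t => .add (.sub s t) (.sub t s)
  | bot => .one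
  | and φ ψ => .add (chi φ) (chi ψ)
  | or φ ψ => .cite (chi φ) .zero (chi ψ)
  | imp φ ψ => .cite (chi φ) (chi ψ) .zero
  | _ => .zero

/-- Bounded universal quantification, as a quantifier free formula. -/
def Fm.ball (b : Tm) (φ : Fm) : Fm :=
  .eq (.recur .zero (.add (.var 0) (φ.chi.subst (scons (.var 1) fun i => .var (i + 2)) id)) b) .zero

/-- Bounded existential quantification, as a quantifier free formula. -/
def Fm.bex (b : Tm) (φ : Fm) : Fm := .neg (.ball b (.neg φ))

theorem Fm.QF.bex (b : Tm) (φ : Fm) : (Fm.bex b φ).QF := ⟨trivial, trivial⟩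

namespace Tm

variable (σ : ℕ → Tm) (ρ : ℕ → ℕ)

theorem subst_pred (a : Tm) : (pred a).subst σ ρ = pred (a.subst σ ρ) := rfl

theorem subst_add (a b : Tm) : (add a b).subst σ ρ = add (a.subst σ ρ) (b.subst σ ρ) := rfl

theorem subst_sub (a b : Tm) : (sub a b).subst σ ρ = sub (a.subst σ ρ) (b.subst σ ρ) := rfl

theorem subst_cite (a b c : Tm) :
    (cite a b c).subst σ ρ = cite (a.subst σ ρ) (b.subst σ ρ) (c.subst σ ρ) := by
  simp only [cite, subst, shift_two_subst_up_up]

end Tm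

theorem Fm.subst_chi (σ : ℕ → Tm) (ρ : ℕ → ℕ) (φ : Fm) :
    φ.chi.subst σ ρ = (φ.subst σ ρ).chi := by
  induction φ <;>
    simp_all [chi, Fm.subst, Tm.subst_add, Tm.subst_sub, Tm.subst_cite] <;> rfl

theorem Fm.subst_ball (σ : ℕ → Tm) (ρ : ℕ → ℕ) (b : Tm) (φ : Fm) :
    (ball b φ).subst σ ρ = ball (b.subst σ ρ) (φ.subst (Tm.up σ) ρ) := by
  simp only [ball, Fm.subst, Tm.subst, Tm.subst_add, ← subst_chi, Tm.subst_subst]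
  congr 4
  funext i
  rcases i with _ | i
  · rfl
  · rw [scons_succ, Tm.subst, Tm.up_up_add_two, Tm.up, Tm.subst_shift, Tm.shift_eq_subst]
    simp

theorem Fm.subst_bex (σ : ℕ → Tm) (ρ : ℕ → ℕ) (b : Tm) (φ : Fm) :
    (bex b φ).subst σ ρ = bex (b.subst σ ρ) (φ.subst (Tm.up σ) ρ) := by
  simp only [bex, neg, Fm.subst, subst_ball]

namespace Mod

variable {M : Mod}

open Tm (var)

theorem add_eq_zero_iff' {x y : M.C} : x + y = 0 ↔ x = 0 ∧ y = 0 := by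
  rcases eq_zero_or_suc y with h | h
  · subst h; simp [add_zero']
  · rw [h, add_suc]
    simp [suc_ne_zero]

theorem sub_add_sub_eq_zero {x y : M.C} : (x - y) + (y - x) = 0 ↔ x = y := by
  rw [add_eq_zero_iff']
  constructor
  · rintro ⟨h1, h2⟩
    rcases eq_sub_add_or x y with h | h
    · rw [h1, zero_add'] at h; exact h
    · rw [h2, zero_add'] at h; exact h.symm
  · rintro rfl
    have := add_sub_self 0 x
    rw [zero_add'] at this
    exact ⟨this, this⟩

open Classical in
theorem eval_cite (env : ℕ → M.C) (c a b : Tm) :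
    eval env (.cite c a b) = if eval env c = 0 then eval env a else eval env b := by
  rw [Tm.cite, eval_recur]
  split_ifs with h
  · rw [h, prec_zero]
  · rw [(eq_zero_or_suc _).resolve_left h, prec_suc, eval_shift]; rfl

theorem eval_chi (env : ℕ → M.C) {φ : Fm} (h : φ.QF) : eval env φ.chi = 0 ↔ sat env φ := by
  induction φ with
  | eq s t => simp [Fm.chi, sat, sub_add_sub_eq_zero]
  | bot => simp [Fm.chi, sat, Tm.one, suc_ne_zero]
  | and φ ψ ih1 ih2 => simp [Fm.chi, sat, add_eq_zero_iff', ih1 h.1, ih2 h.2]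
  | or φ ψ ih1 ih2 =>
    rw [Fm.chi, eval_cite, sat, ← ih1 h.1, ← ih2 h.2]
    split_ifs with h1 <;> simp [h1]
  | imp φ ψ ih1 ih2 =>
    rw [Fm.chi, eval_cite, sat, ← ih1 h.1, ← ih2 h.2]
    split_ifs with h1 <;> simp [h1]
  | allN | exN | allF | exF => exact h.elim

theorem eval_chi_subst (env : ℕ → M.C) {φ : Fm} (h : φ.QF) (σ : ℕ → Tm) :
    eval env (φ.chi.subst σ id) = 0 ↔ sat (fun i => eval env (σ i)) φ := by
  rw [eval_subst, eval_chi _ h]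

/-! ### Induction -/

/-- Searches for a counterexample to the induction step. -/
def stepTm (φ : Fm) : Tm :=
  .cite (φ.chi.subst (scons (var 1) fun i => var (i + 2)) id)
    (.cite (φ.chi.subst (scons (.succ (var 1)) fun i => var (i + 2)) id) (var 0) (var 1)) (var 0)

/-- The step is known only for the elements of this one model, so its universal closure need not
belong to the theory and the axiom does not apply directly. A recursively computed counterexample to
the step internalizes the premise. -/
theorem sat_induction {φ : Fm} (hφ : φ.QF) (env : ℕ → M.C) (h0 : sat (scons 0 env) φ)
    (hs : ∀ x, sat (scons x env) φ → sat (scons (suc x) env) φ) (x : M.C) :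
    sat (scons x env) φ := by
  have e1 : ∀ {M : Mod} (env : ℕ → M.C) (g x : M.C),
      (fun i => eval (scons g (scons x env)) (scons (var 1) (fun i => var (i + 2)) i)) =
        scons x env := by
    intro M env g x; funext i; cases i <;> simp
  have e2 : ∀ {M : Mod} (env : ℕ → M.C) (g x : M.C),
      (fun i => eval (scons g (scons x env)) (scons (.succ (var 1)) (fun i => var (i + 2)) i)) =
        scons (suc x) env := by
    intro M env g x; funext i; cases i <;> simp
  have e3 : ∀ {M : Mod} (env : ℕ → M.C) (x : M.C) (t : Tm),
      (fun i => eval (scons x env) (scons t (fun i => var (i + 1)) i)) =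
        scons (eval (scons x env) t) env := by
    intro M env g x; funext i; cases i <;> simp
  have e4 : ∀ {M : Mod} (env : ℕ → M.C) (x : M.C),
      eval (scons x env) (.recur .zero ((stepTm φ).subst (Tm.up (Tm.up fun i => var (i + 1))) id)
        (var 0)) = prec env .zero (stepTm φ) x := fun env x => rfl
  set g : Tm := .recur .zero ((stepTm φ).subst (Tm.up (Tm.up fun i => var (i + 1))) id) (var 0)
  -- The formula says that `φ(0)` implies `φ(x)` or that the step fails at `g(x)`. Since `g` records
  -- the latest failure before `x`, this is inductive in every model.
  have key := Fm.absolute_qf.induction (φ := .imp (φ.subst (scons .zero fun i => var (i + 1)) id)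
    (.or φ (.and (φ.subst (scons g fun i => var (i + 1)) id)
      (.neg (φ.subst (scons (.succ g) fun i => var (i + 1)) id)))))
    ⟨hφ.subst _ _, hφ, hφ.subst _ _, hφ.subst _ _, trivial⟩
    (fun M env h => by
      rw [sat_subst, e3] at h
      exact .inl h)
    (fun M env x ih h => by
      have ih := ih (by rw [sat_subst, e3] at h ⊢; exact h)
      simp only [sat, sat_subst, e3, eval_succ', e4, Fm.neg] at ih ⊢
      rw [prec_suc]
      by_cases hx : sat (scons x env) φ
      · by_cases hx' : sat (scons (suc x) env) φ
        · exact .inl hx'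
        · right
          rw [stepTm, eval_cite, if_pos (by rwa [eval_chi_subst _ hφ, e1]), eval_cite, if_neg
            (by rwa [eval_chi_subst _ hφ, e2]), eval_var]
          exact ⟨hx, hx'⟩
      · right
        rw [stepTm, eval_cite, if_neg (by rwa [eval_chi_subst _ hφ, e1]), eval_var]
        exact ih.resolve_left hx) env x
  have key := key (by rw [sat_subst, e3]; exact h0)
  simp only [sat, sat_subst, e3, eval_succ', e4, Fm.neg] at key
  exact key.resolve_right fun h => h.2 (hs _ h.1)

/-! ### Definability -/

/-- Even places for the arguments, odd places for the parameters. -/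
def mix (e : ℕ → M.C) (i : ℕ) : M.C := if i % 2 = 0 then e (i / 2) else cls (var (i / 2))

/-- Definable functions, with parameters. -/
@[fun_prop]
def DefF (f : (ℕ → M.C) → M.C) : Prop := ∃ t, ∀ e, f e = eval (mix e) t

/-- Definable predicates, with parameters. -/
@[fun_prop]
def DefP (P : (ℕ → M.C) → Prop) : Prop := ∃ φ : Fm, φ.QF ∧ ∀ e, P e ↔ sat (mix e) φ

@[fun_prop]
theorem DefF.const (c : M.C) : DefF (fun _ => c) := by
  -- The variables of a representing term are sent to the odd places, where `mix` keeps their own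
  -- classes.
  refine ⟨(rep c).subst (fun i => var (2 * i + 1)) id, fun e => ?_⟩
  rw [eval_subst]
  have : (fun i => eval (mix e) (var (2 * i + 1))) = fun i => cls (var i) := by
    funext i
    rw [eval_var, mix, if_neg (by omega)]
    congr 2; omega
  rw [this, eval_cls, Tm.subst_id, cls_rep]

@[fun_prop]
theorem DefF.arg (i : ℕ) : DefF (fun e : ℕ → M.C => e i) :=
  ⟨var (2 * i), fun e => by simp [mix]⟩

theorem DefF.comp (t : Tm) {F : ℕ → (ℕ → M.C) → M.C} (h : ∀ i, DefF (F i)) :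
    DefF (fun e => eval (fun i => F i e) t) := by
  choose σ hσ using h
  exact ⟨t.subst σ id, fun e => by rw [eval_subst]; simp_rw [← hσ]⟩

theorem DefF.scons {f : (ℕ → M.C) → M.C} {F : ℕ → (ℕ → M.C) → M.C} (hf : DefF f)
    (h : ∀ i, DefF (F i)) (i : ℕ) : DefF (fun e => IRCA.scons (f e) (fun i => F i e) i) := by
  cases i with
  | zero => exact hf
  | succ i => exact h i

theorem DefF.unary (t : Tm) {f : (ℕ → M.C) → M.C} (hf : DefF f) :
    DefF (fun e => eval (fun _ => f e) t) := DefF.comp t fun _ => hf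

theorem DefF.binary (t : Tm) {f g : (ℕ → M.C) → M.C} (hf : DefF f) (hg : DefF g) :
    DefF (fun e => eval (IRCA.scons (f e) fun _ => g e) t) :=
  DefF.comp t (DefF.scons hf fun _ => hg)

@[fun_prop]
theorem DefF.fn (α : ℕ) {f : (ℕ → M.C) → M.C} (hf : DefF f) : DefF (fun e => fn α (f e)) :=
  DefF.unary _ hf

@[fun_prop]
theorem DefF.add {f g : (ℕ → M.C) → M.C} (hf : DefF f) (hg : DefF g) :
    DefF (fun e => f e + g e) := by
  simpa using DefF.binary (.add (var 0) (var 1)) hf hg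

@[fun_prop]
theorem DefF.sub {f g : (ℕ → M.C) → M.C} (hf : DefF f) (hg : DefF g) :
    DefF (fun e => f e - g e) := by
  simpa using DefF.binary (.sub (var 0) (var 1)) hf hg

@[fun_prop]
theorem DefF.mul {f g : (ℕ → M.C) → M.C} (hf : DefF f) (hg : DefF g) :
    DefF (fun e => f e * g e) := by
  simpa using DefF.binary (.mul (var 0) (var 1)) hf hg

@[fun_prop]
theorem DefP.eq {f g : (ℕ → M.C) → M.C} (hf : DefF f) (hg : DefF g) :
    DefP (fun e => f e = g e) := by
  obtain ⟨s, hs⟩ := hf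
  obtain ⟨t, ht⟩ := hg
  exact ⟨.eq s t, trivial, fun e => by simp [sat, hs, ht]⟩

@[fun_prop]
theorem DefP.and {P Q : (ℕ → M.C) → Prop} (hP : DefP P) (hQ : DefP Q) :
    DefP (fun e => P e ∧ Q e) := by
  obtain ⟨φ, h1, h2⟩ := hP
  obtain ⟨ψ, h3, h4⟩ := hQ
  exact ⟨.and φ ψ, ⟨h1, h3⟩, fun e => by simp [sat, h2, h4]⟩

@[fun_prop]
theorem DefP.imp {P Q : (ℕ → M.C) → Prop} (hP : DefP P) (hQ : DefP Q) :
    DefP (fun e => P e → Q e) := by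
  obtain ⟨φ, h1, h2⟩ := hP
  obtain ⟨ψ, h3, h4⟩ := hQ
  exact ⟨.imp φ ψ, ⟨h1, h3⟩, fun e => by simp [sat, h2, h4]⟩

@[fun_prop]
theorem DefP.const (P : Prop) : DefP (fun _ : ℕ → M.C => P) := by
  by_cases h : P
  · exact ⟨.imp .bot .bot, ⟨trivial, trivial⟩, fun e => by simp [sat, h]⟩
  · exact ⟨.bot, trivial, fun e => by simp [sat, h]⟩

@[fun_prop]
theorem DefP.not {P : (ℕ → M.C) → Prop} (hP : DefP P) : DefP (fun e => ¬ P e) :=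
  hP.imp (DefP.const False)

-- A definable predicate with parameters becomes a single formula: its first argument is the
-- induction variable, the other argument places are set to zero, and the odd places keep their
-- parameters.
@[elab_as_elim]
theorem ind {P : M.C → Prop} (x : M.C) (hP : DefP (fun e => P (e 0))) (h0 : P 0)
    (hs : ∀ x, P x → P (suc x)) : P x := by
  obtain ⟨φ, hφ, h⟩ := hP
  let σ : ℕ → Tm := fun i => if i = 0 then var 0 else if i % 2 = 0 then .zero else var (i / 2 + 1)
  have e : ∀ x, P x ↔ sat (scons x fun i => cls (var i)) (φ.subst σ id) := fun x => by
    rw [sat_subst]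
    refine (h (scons x fun _ => 0)).trans (iff_of_eq (congrArg (sat · φ) ?_))
    funext i
    simp only [mix, σ]
    by_cases h0 : i = 0
    · simp [h0]
    · by_cases h2 : i % 2 = 0
      · obtain ⟨j, hj⟩ : ∃ j, i / 2 = j + 1 := ⟨i / 2 - 1, by omega⟩
        simp [h0, h2, hj]
      · simp [h0, h2]
  rw [e]
  rw [e] at h0
  simp only [e] at hs
  exact sat_induction (hφ.subst _ _) _ h0 hs x

end Mod

namespace Mod

variable {M : Mod}

open Tm (var)

/-! ## Arithmetic -/

theorem add_assoc' (a b c : M.C) : a + b + c = a + (b + c) := by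
  induction c using ind with
  | hP => fun_prop
  | h0 => simp [add_zero']
  | hs x ih => simp [add_suc, ih]

theorem add_comm' (a b : M.C) : a + b = b + a := by
  induction b using ind with
  | hP => fun_prop
  | h0 => simp [add_zero', zero_add']
  | hs x ih => simp [add_suc, suc_add, ih]

theorem zero_mul' (a : M.C) : 0 * a = 0 := by
  induction a using ind with
  | hP => fun_prop
  | h0 => simp [mul_zero']
  | hs x ih => simp [mul_suc, ih, add_zero']

theorem suc_mul (a b : M.C) : suc a * b = a * b + b := by
  induction b using ind with
  | hP => fun_prop
  | h0 => simp [mul_zero', add_zero']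
  | hs x ih =>
    simp only [mul_suc, ih, add_suc]
    rw [add_assoc', add_comm' x a, ← add_assoc']

theorem mul_comm' (a b : M.C) : a * b = b * a := by
  induction b using ind with
  | hP => fun_prop
  | h0 => simp [mul_zero', zero_mul']
  | hs x ih => simp [mul_suc, suc_mul, ih]

theorem mul_add' (a b c : M.C) : a * (b + c) = a * b + a * c := by
  induction c using ind with
  | hP => fun_prop
  | h0 => simp [mul_zero', add_zero']
  | hs x ih => simp only [mul_suc, add_suc, ih, add_assoc']

theorem mul_assoc' (a b c : M.C) : a * b * c = a * (b * c) := by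
  induction c using ind with
  | hP => fun_prop
  | h0 => simp [mul_zero']
  | hs x ih => simp [mul_suc, mul_add', ih]

noncomputable instance : CommSemiring M.C where
  add_assoc := add_assoc'
  zero_add := zero_add'
  add_zero := add_zero'
  add_comm := add_comm'
  nsmul := nsmulRec
  left_distrib := mul_add'
  right_distrib a b c := by rw [mul_comm', mul_add', mul_comm' c a, mul_comm' c b]
  zero_mul := zero_mul'
  mul_zero := mul_zero'
  mul_assoc := mul_assoc'
  one_mul a := by rw [one_eq, suc_mul, zero_mul', zero_add']
  mul_one a := by rw [one_eq, mul_suc, mul_zero', zero_add']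
  mul_comm := mul_comm'

theorem add_right_cancel' {a b c : M.C} (h : a + c = b + c) : a = b := by
  rw [← add_sub_self a c, h, add_sub_self]

instance : IsCancelAdd M.C :=
  { add_left_cancel := fun a b c h => add_right_cancel' (c := a) (by simpa [add_comm] using h)
    add_right_cancel := fun a b c h => add_right_cancel' h }

/-! ### Order -/

@[elab_as_elim]
theorem induct {P : M.C → Prop} (x : M.C) (hP : DefP (fun e => P (e 0))) (h0 : P 0)
    (hs : ∀ x, P x → P (x + 1)) : P x := by
  simp only [← suc_eq] at hs
  exact ind x hP h0 hs

theorem eval_succ (env : ℕ → M.C) (t : Tm) : eval env (.succ t) = eval env t + 1 := by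
  rw [eval_succ', suc_eq]

attribute [simp] suc_eq

@[simp] theorem eval_one (env : ℕ → M.C) : eval env .one = 1 := by simp [Tm.one]

@[simp] theorem eval_two (env : ℕ → M.C) : eval env .two = 2 := by
  simp [Tm.two, one_add_one_eq_two]

theorem add_one_ne_zero (x : M.C) : x + 1 ≠ 0 := by rw [← suc_eq]; exact suc_ne_zero x

theorem prd_add_one (x : M.C) : prd (x + 1) = x := by rw [← suc_eq, prd_suc]

theorem zero_sub' (x : M.C) : 0 - x = 0 := by
  induction x using ind with
  | hP => fun_prop
  | h0 => exact sub_zero' 0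
  | hs x ih => rw [sub_suc, ih, prd_zero]

theorem sub_add_self (x y : M.C) : x - (x + y) = 0 := by
  induction x using ind with
  | hP => fun_prop
  | h0 => exact zero_sub' _
  | hs x ih => rw [suc_add, suc_sub_suc, ih]

theorem sub_eq_zero_iff {x y : M.C} : x - y = 0 ↔ ∃ z, y = x + z := by
  constructor
  · intro h
    rcases eq_sub_add_or x y with h' | h'
    · rw [h, zero_add] at h'; exact ⟨0, by rw [h', add_zero]⟩
    · exact ⟨y - x, by rw [add_comm]; exact h'⟩
  · rintro ⟨z, rfl⟩
    exact sub_add_self x z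

open Classical in
noncomputable instance : LinearOrder M.C where
  le x y := x - y = 0
  -- Matches the formula `Fm.lt`, so that its truth condition is the order by definition.
  lt x y := x + 1 - y = 0
  le_refl x := sub_eq_zero_iff.2 ⟨0, by simp⟩
  le_trans x y z h h' := by
    rw [sub_eq_zero_iff] at *
    obtain ⟨u, rfl⟩ := h
    obtain ⟨v, rfl⟩ := h'
    exact ⟨u + v, by ring⟩
  le_antisymm x y h h' := sub_add_sub_eq_zero.1 (by rw [h, h', add_zero])
  le_total x y := by
    simp only [sub_eq_zero_iff]
    rcases eq_sub_add_or x y with h' | h'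
    · exact .inr ⟨x - y, by rw [add_comm]; exact h'⟩
    · exact .inl ⟨y - x, by rw [add_comm]; exact h'⟩
  lt_iff_le_not_ge x y := by
    simp only [sub_eq_zero_iff]
    constructor
    · rintro ⟨z, rfl⟩
      refine ⟨⟨1 + z, by ring⟩, ?_⟩
      rintro ⟨u, hu⟩
      have : x + (z + u + 1) = x + 0 := by rw [add_zero]; nth_rewrite 2 [hu]; ring
      exact add_one_ne_zero _ (add_left_cancel this)
    · rintro ⟨⟨z, rfl⟩, h⟩
      rcases eq_zero_or_suc z with h0 | h0
      · exact absurd ⟨0, by simp [h0]⟩ h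
      · exact ⟨prd z, by nth_rewrite 1 [h0]; rw [suc_eq]; ring⟩
  toDecidableLE := inferInstance

theorem le_def {x y : M.C} : x ≤ y ↔ x - y = 0 := Iff.rfl

theorem lt_def {x y : M.C} : x < y ↔ x + 1 ≤ y := Iff.rfl

theorem le_iff {x y : M.C} : x ≤ y ↔ ∃ z, y = x + z := sub_eq_zero_iff

theorem lt_add_one_iff {x y : M.C} : x < y + 1 ↔ x ≤ y := by
  rw [lt_def, le_iff, le_iff]
  refine exists_congr fun z => ⟨fun h => ?_, fun h => by rw [h]; ring⟩
  refine add_right_cancel (b := 1) (h.trans ?_)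
  ring

instance : IsOrderedAddMonoid M.C where
  add_le_add_left a b h c := by
    obtain ⟨z, rfl⟩ := le_iff.1 h
    exact le_iff.2 ⟨z, by ring⟩

instance : CanonicallyOrderedAdd M.C where
  exists_add_of_le h := le_iff.1 h
  le_add_self a b := le_iff.2 ⟨b, by ring⟩
  le_self_add a b := le_iff.2 ⟨b, rfl⟩

instance : Nontrivial M.C := ⟨0, 1, fun h => add_one_ne_zero (0 : M.C) (by simpa using h.symm)⟩

instance : IsStrictOrderedRing M.C where
  le_of_add_le_add_left a b c h := by
    obtain ⟨z, hz⟩ := le_iff.1 h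
    exact le_iff.2 ⟨z, add_left_cancel (a := a) (by rw [hz]; ring)⟩
  zero_le_one := zero_le
  mul_lt_mul_of_pos_left c hc a b h := by
    obtain ⟨x, rfl⟩ := le_iff.1 (lt_def.1 h)
    obtain ⟨y, rfl⟩ := le_iff.1 (lt_def.1 hc)
    exact lt_def.2 (le_iff.2 ⟨x + y + x * y, by ring⟩)
  mul_lt_mul_of_pos_right c hc a b h := by
    obtain ⟨x, rfl⟩ := le_iff.1 (lt_def.1 h)
    obtain ⟨y, rfl⟩ := le_iff.1 (lt_def.1 hc)
    exact lt_def.2 (le_iff.2 ⟨x + y + x * y, by ring⟩)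

instance : OrderedSub M.C where
  tsub_le_iff_right a b c := by
    rcases eq_sub_add_or a b with h | h
    · nth_rewrite 2 [h]
      exact (add_le_add_iff_right b).symm
    · have h1 : a - b = 0 := le_def.1 (le_iff.2 ⟨b - a, by rw [add_comm]; exact h⟩)
      rw [h1, h]
      exact ⟨fun _ => le_iff.2 ⟨c + (b - a), by ring⟩, fun _ => zero_le⟩

noncomputable instance : SuccOrder M.C := SuccOrder.ofSuccLeIff (fun x => x + 1) Iff.rfl

noncomputable instance : SuccAddOrder M.C := ⟨fun _ => rfl⟩

@[fun_prop]
theorem DefP.le {f g : (ℕ → M.C) → M.C} (hf : DefF f) (hg : DefF g) : DefP (fun e => f e ≤ g e) :=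
  DefP.eq (hf.sub hg) (DefF.const 0)

@[fun_prop]
theorem DefP.lt {f g : (ℕ → M.C) → M.C} (hf : DefF f) (hg : DefF g) : DefP (fun e => f e < g e) :=
  DefP.le (hf.add (DefF.const 1)) hg

theorem cases_add_one (x : M.C) : x = 0 ∨ ∃ y, x = y + 1 :=
  (eq_zero_or_suc x).imp_right fun h => ⟨prd x, by rw [← suc_eq]; exact h⟩

/-! ### Bounded quantifiers -/

theorem prec_add_one (env : ℕ → M.C) (a b : Tm) (x : M.C) :
    prec env a b (x + 1) = eval (scons (prec env a b x) (scons x env)) b := by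
  rw [← suc_eq, prec_suc]

theorem DefF.prec (env : ℕ → M.C) (a b : Tm) {f : (ℕ → M.C) → M.C} (hf : DefF f) :
    DefF (fun e => prec env a b (f e)) :=
  DefF.comp _ (DefF.scons hf fun _ => DefF.const _)

attribute [fun_prop] DefF.prec

/-- The recursion sums the characteristic values below the bound, and such a sum vanishes exactly
when every summand does. -/
theorem sat_ball (env : ℕ → M.C) (b : Tm) {φ : Fm} (h : φ.QF) :
    sat env (.ball b φ) ↔ ∀ x < eval env b, sat (scons x env) φ := by
  set c := Tm.add (var 0) (φ.chi.subst (scons (var 1) fun i => var (i + 2)) id)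
  have key : ∀ x, prec env .zero c (x + 1) = 0 ↔ prec env .zero c x = 0 ∧ sat (scons x env) φ := by
    intro x
    rw [prec_add_one, eval_add, add_eq_zero_iff', eval_chi_subst _ h, eval_var, scons_zero]
    rw [show (fun i => eval (scons (prec env .zero c x) (scons x env))
      (scons (var 1) (fun i => var (i + 2)) i)) = scons x env by funext i; cases i <;> simp]
  rw [Fm.ball, sat, eval_recur, eval_zero]
  generalize eval env b = n
  constructor
  · intro hn x hx
    have : ∀ m, prec env .zero c (x + 1 + m) = 0 → prec env .zero c (x + 1) = 0 := by
      intro m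
      induction m using induct with
      | hP => fun_prop
      | h0 => simp
      | hs m ih => exact fun h' => ih ((key (x + 1 + m)).1 (by rwa [add_assoc])).1
    obtain ⟨m, rfl⟩ := le_iff.1 (lt_def.1 hx)
    exact ((key x).1 (this m hn)).2
  · intro hn
    have : ∀ m, m ≤ n → prec env .zero c m = 0 := by
      intro m
      induction m using induct with
      | hP => fun_prop
      | h0 => exact fun _ => prec_zero _ _ _
      | hs m ih => exact fun h' => (key m).2 ⟨ih (le_of_lt h'), hn m h'⟩
    exact this n le_rfl

theorem sat_bex (env : ℕ → M.C) (b : Tm) {φ : Fm} (h : φ.QF) :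
    sat env (.bex b φ) ↔ ∃ x < eval env b, sat (scons x env) φ := by
  simp only [Fm.bex, Fm.neg, sat]
  rw [sat_ball env b (φ := .imp φ .bot) ⟨h, trivial⟩]
  simp [sat]

@[fun_prop]
theorem DefP.ball {f : (ℕ → M.C) → M.C} {P : M.C → (ℕ → M.C) → Prop} (hf : DefF f)
    (hP : DefP (fun e => P (e 0) (fun i => e (i + 1)))) : DefP (fun e => ∀ x < f e, P x e) := by
  obtain ⟨t, ht⟩ := hf
  obtain ⟨φ, hφ, h⟩ := hP
  -- The new bound variable takes the first argument place. Later argument places move back one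
  -- argument, which is two places, and everything then moves up one place under the binder.
  refine ⟨.ball t (φ.subst (fun i => if i = 0 then var 0 else if i % 2 = 0 then var (i - 1)
    else var (i + 1)) id), trivial, fun e => ?_⟩
  rw [sat_ball _ _ (hφ.subst _ _), ← ht]
  refine forall₂_congr fun x _ => ?_
  have := h (scons x e)
  simp only [scons_zero, scons_succ] at this
  rw [this, sat_subst]
  refine iff_of_eq (congrArg (sat · φ) ?_)
  funext i
  by_cases h0 : i = 0
  · simp [h0, mix]
  · obtain ⟨j, rfl⟩ := Nat.exists_eq_succ_of_ne_zero h0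
    by_cases h2 : (j + 1) % 2 = 0
    · obtain ⟨k, rfl⟩ : ∃ k, j = 2 * k + 1 := ⟨j / 2, by omega⟩
      have e1 : (2 * k + 1) % 2 = 1 := by omega
      have e2 : (2 * k + 1 + 1) / 2 = k + 1 := by omega
      have e3 : (2 * k + 1 + 1) % 2 = 0 := by omega
      simp [mix, e2, e3]
    · simp [h2, mix]

theorem DefP.bex {f : (ℕ → M.C) → M.C} {P : M.C → (ℕ → M.C) → Prop} (hf : DefF f)
    (hP : DefP (fun e => P (e 0) (fun i => e (i + 1)))) : DefP (fun e => ∃ x < f e, P x e) := by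
  have := (DefP.ball hf (P := fun x e => ¬ P x e) hP.not).not
  simpa using this

theorem DefP.bex_le {f : (ℕ → M.C) → M.C} {P : M.C → (ℕ → M.C) → Prop} (hf : DefF f)
    (hP : DefP (fun e => P (e 0) (fun i => e (i + 1)))) : DefP (fun e => ∃ x ≤ f e, P x e) := by
  simpa only [lt_add_one_iff] using DefP.bex (hf.add (DefF.const 1)) hP

attribute [fun_prop] DefP.bex DefP.bex_le

end Mod

namespace Mod

variable {M : Mod}

/-! ### The ring of integers of a model -/

-- Formal differences embed the carrier in an ordered commutative ring, where `linarith` can be used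
-- for the inequalities on lengths of sequences.
variable (M) in
def integerSetoid : Setoid (M.C × M.C) where
  r p q := p.1 + q.2 = q.1 + p.2
  iseqv := ⟨fun _ => rfl, fun h => h.symm, fun {p q s} h h' => by
    refine add_right_cancel (b := q.2) ?_
    calc p.1 + s.2 + q.2 = (p.1 + q.2) + s.2 := by ring
      _ = (q.1 + s.2) + p.2 := by rw [h]; ring
      _ = s.1 + p.2 + q.2 := by rw [h']; ring⟩

variable (M) in
/-- Formal differences of elements of the model. -/
def Z : Type := Quotient M.integerSetoid

namespace Z

noncomputable instance : Add M.Z := ⟨Quotient.map₂ (fun p q => (p.1 + q.1, p.2 + q.2)) (by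
  rintro ⟨a, b⟩ ⟨a', b'⟩ (h : a + b' = a' + b) ⟨c, d⟩ ⟨c', d'⟩ (h' : c + d' = c' + d)
  change a + c + (b' + d') = a' + c' + (b + d)
  rw [add_add_add_comm, h, h']; ring)⟩

noncomputable instance : Mul M.Z :=
  ⟨Quotient.map₂ (fun p q => (p.1 * q.1 + p.2 * q.2, p.1 * q.2 + p.2 * q.1)) (by
    rintro ⟨a, b⟩ ⟨a', b'⟩ (h : a + b' = a' + b) ⟨c, d⟩ ⟨c', d'⟩ (h' : c + d' = c' + d)
    change a * c + b * d + (a' * d' + b' * c') = a' * c' + b' * d' + (a * d + b * c)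
    refine add_right_cancel (b := b' * c + b' * d + a' * c + a' * d) ?_
    calc _ = (a + b') * c + (a' + b) * d + a' * (c + d') + b' * (c' + d) := by ring
      _ = (a' + b) * c + (a + b') * d + a' * (c' + d) + b' * (c + d') := by rw [h, h']
      _ = _ := by ring)⟩

noncomputable instance : Neg M.Z := ⟨Quotient.map (fun p => (p.2, p.1)) (by
  rintro ⟨a, b⟩ ⟨a', b'⟩ (h : a + b' = a' + b)
  change b + a' = b' + a
  rw [add_comm, ← h, add_comm])⟩

noncomputable instance : Zero M.Z := ⟨Quotient.mk _ (0, 0)⟩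

noncomputable instance : One M.Z := ⟨Quotient.mk _ (1, 0)⟩

/-- The difference of two elements of the model. -/
def diff (a b : M.C) : M.Z := Quotient.mk _ (a, b)

theorem sound {a b c d : M.C} (h : a + d = c + b) :
    diff a b = diff c d := Quotient.sound h

noncomputable instance : CommRing M.Z where
  add_assoc := by rintro ⟨a⟩ ⟨b⟩ ⟨c⟩; exact sound (by ring)
  zero_add := by rintro ⟨a⟩; exact sound (by ring)
  add_zero := by rintro ⟨a⟩; exact sound (by ring)
  add_comm := by rintro ⟨a⟩ ⟨b⟩; exact sound (by ring)
  nsmul := nsmulRec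
  zsmul := zsmulRec
  neg_add_cancel := by rintro ⟨a⟩; exact sound (by ring)
  left_distrib := by rintro ⟨a⟩ ⟨b⟩ ⟨c⟩; exact sound (by ring)
  right_distrib := by rintro ⟨a⟩ ⟨b⟩ ⟨c⟩; exact sound (by ring)
  zero_mul := by rintro ⟨a⟩; exact sound (by ring)
  mul_zero := by rintro ⟨a⟩; exact sound (by ring)
  mul_assoc := by rintro ⟨a⟩ ⟨b⟩ ⟨c⟩; exact sound (by ring)
  one_mul := by rintro ⟨a⟩; exact sound (by ring)
  mul_one := by rintro ⟨a⟩; exact sound (by ring)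
  mul_comm := by rintro ⟨a⟩ ⟨b⟩; exact sound (by ring)

noncomputable instance : LE M.Z := ⟨Quotient.lift₂ (fun p q => p.1 + q.2 ≤ q.1 + p.2) (by
  have key : ∀ a b c d a' b' c' d' : M.C, a + b' = a' + b → c + d' = c' + d →
      a + d ≤ c + b → a' + d' ≤ c' + b' := by
    intro a b c d a' b' c' d' h h' h1
    have : a' + d' + (b + d) ≤ c' + b' + (b + d) := by
      calc a' + d' + (b + d) = (a' + b) + d + d' := by ring
        _ = (a + d) + (b' + d') := by rw [← h]; ring
        _ ≤ (c + b) + (b' + d') := by gcongr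
        _ = (c + d') + b + b' := by ring
        _ = c' + b' + (b + d) := by rw [h']; ring
    exact le_of_add_le_add_right this
  rintro ⟨a, b⟩ ⟨c, d⟩ ⟨a', b'⟩ ⟨c', d'⟩ (h : a + b' = a' + b) (h' : c + d' = c' + d)
  exact propext ⟨key _ _ _ _ _ _ _ _ h h', key _ _ _ _ _ _ _ _ h.symm h'.symm⟩)⟩

theorem mk_le {a b c d : M.C} :
    diff a b ≤ diff c d ↔ a + d ≤ c + b := Iff.rfl

open Classical in
noncomputable instance : LinearOrder M.Z where
  le_refl := by rintro ⟨a, b⟩; exact mk_le.2 le_rfl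
  le_trans := by
    rintro ⟨a, b⟩ ⟨c, d⟩ ⟨e, f⟩ h h'
    have h : a + d ≤ c + b := h
    have h' : c + f ≤ e + d := h'
    refine mk_le.2 (le_of_add_le_add_right (a := d) ?_)
    calc a + f + d = (a + d) + f := by ring
      _ ≤ (c + b) + f := by gcongr
      _ = (c + f) + b := by ring
      _ ≤ (e + d) + b := by gcongr
      _ = e + b + d := by ring
  le_antisymm := by
    rintro ⟨a, b⟩ ⟨c, d⟩ h h'
    exact sound (le_antisymm (mk_le.1 h) (mk_le.1 h'))
  le_total := by
    rintro ⟨a, b⟩ ⟨c, d⟩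
    exact le_total (a + d) (c + b)
  toDecidableLE := inferInstance

instance : IsOrderedAddMonoid M.Z where
  add_le_add_left := by
    rintro ⟨a, b⟩ ⟨c, d⟩ h ⟨e, f⟩
    have h : a + d ≤ c + b := h
    refine mk_le.2 ?_
    calc a + e + (d + f) = (a + d) + (e + f) := by ring
      _ ≤ (c + b) + (e + f) := by gcongr
      _ = _ := by ring

theorem mk_lt {a b c d : M.C} :
    diff a b < diff c d ↔ a + d < c + b := by
  rw [← not_le, mk_le, not_le]

instance : Nontrivial M.Z := ⟨0, 1, fun h => by
  have : (0 : M.C) + 0 = 1 + 0 := Quotient.exact h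
  simp at this⟩

instance : ZeroLEOneClass M.Z := ⟨mk_le.2 (by simp)⟩

instance : IsStrictOrderedRing M.Z := IsStrictOrderedRing.of_mul_pos (by
  rintro ⟨a, b⟩ ⟨c, d⟩ h h'
  have h : 0 + b < a + 0 := mk_lt.1 h
  have h' : 0 + d < c + 0 := mk_lt.1 h'
  rw [zero_add, add_zero] at h h'
  obtain ⟨x, rfl⟩ := le_iff.1 (lt_def.1 h)
  obtain ⟨y, rfl⟩ := le_iff.1 (lt_def.1 h')
  refine mk_lt.2 (lt_def.2 (le_iff.2 ⟨x + y + x * y, by ring⟩)))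

/-- The embedding of the model into its ring of integers. -/
noncomputable def of (x : M.C) : M.Z := diff x 0

theorem inj {x y : M.C} : of x = of y ↔ x = y := by
  refine ⟨fun h => ?_, fun h => by rw [h]⟩
  have : x + 0 = y + 0 := Quotient.exact h
  simpa using this

theorem le {x y : M.C} : of x ≤ of y ↔ x ≤ y := by
  rw [of, of, mk_le, add_zero, add_zero]

theorem lt {x y : M.C} : of x < of y ↔ x < y := by
  rw [← not_le, le, not_le]

theorem add (x y : M.C) : of (x + y) = of x + of y := sound (by ring)

theorem mul (x y : M.C) : of (x * y) = of x * of y := sound (by ring)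

theorem zero : of (0 : M.C) = 0 := rfl

theorem one : of (1 : M.C) = 1 := rfl

theorem two : of (2 : M.C) = 2 := by
  rw [← one_add_one_eq_two, add, one, one_add_one_eq_two]

theorem nonneg (x : M.C) : 0 ≤ of x := by rw [← zero, le]; exact _root_.zero_le

theorem lt_iff {x y : M.C} : x < y ↔ of x + 1 ≤ of y := by
  rw [← one, ← add, le]; exact Iff.rfl

end Z

end Mod

namespace Mod

variable {M : Mod}

open Tm (var)

/-! ### Powers and division -/

/-- Powers in the model. -/
noncomputable def pw (x y : M.C) : M.C := prec (fun _ => x) .one (.mul (var 0) (var 2)) y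

@[simp] theorem eval_pow (env : ℕ → M.C) (a b : Tm) :
    eval env (.pow a b) = pw (eval env a) (eval env b) := by
  refine (eval_recur _ _ _ _).trans ?_
  have := prec_subst env (fun _ => a) .one (.mul (var 0) (var 2)) (eval env b)
  rw [pw, ← this]
  congr 1
  simp only [Tm.mul, Tm.subst, Tm.up_up_add_two]
  rfl

@[simp] theorem pw_zero (x : M.C) : pw x 0 = 1 := by rw [pw, prec_zero, eval_one]

@[simp] theorem pw_add_one (x y : M.C) : pw x (y + 1) = pw x y * x := by
  rw [pw, prec_add_one, eval_mul]; simp [pw]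

@[fun_prop]
theorem DefF.pw {f g : (ℕ → M.C) → M.C} (hf : DefF f) (hg : DefF g) :
    DefF (fun e => pw (f e) (g e)) := by
  simpa using DefF.binary (.pow (var 0) (var 1)) hf hg

/-- Quotients in the model. -/
noncomputable def qo (x y : M.C) : M.C := eval (scons x fun _ => y) (.quo (var 0) (var 1))

/-- Remainders in the model. -/
noncomputable def rm (x y : M.C) : M.C := x - y * qo x y

theorem eval_fun_scons_zero (env : ℕ → M.C) (a b : Tm) :
    (fun i => eval env (scons a (fun _ => b) i)) = scons (eval env a) fun _ => eval env b := by
  funext i; cases i <;> rfl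

@[simp] theorem eval_quo (env : ℕ → M.C) (a b : Tm) :
    eval env (.quo a b) = qo (eval env a) (eval env b) := by
  have := eval_subst env (scons a fun _ => b) (.quo (var 0) (var 1))
  rw [eval_fun_scons_zero] at this
  rw [qo, ← this]
  congr 1
  simp only [Tm.quo, Tm.mul, Tm.subst, Tm.subst_add, Tm.subst_sub, Tm.shift_two_subst_up_up]
  rfl

@[simp] theorem eval_rem (env : ℕ → M.C) (a b : Tm) :
    eval env (.rem a b) = rm (eval env a) (eval env b) := by
  simp [Tm.rem, rm]

@[fun_prop]
theorem DefF.qo {f g : (ℕ → M.C) → M.C} (hf : DefF f) (hg : DefF g) :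
    DefF (fun e => qo (f e) (g e)) := DefF.binary _ hf hg

@[fun_prop]
theorem DefF.rm {f g : (ℕ → M.C) → M.C} (hf : DefF f) (hg : DefF g) :
    DefF (fun e => rm (f e) (g e)) := by
  unfold Mod.rm; fun_prop

/-- The recursion counts the `n` with `(n + 1) * y ≤ x`: its value at `n` grows as `n` up to `q` and
stays at `q` from then on. -/
theorem qo_mul_add (y q r : M.C) (hr : r < y) : qo (y * q + r) y = q := by
  set x := y * q + r with hx
  set Q := prec (scons x fun _ => y) .zero
    (.add (var 0) (.sub .one (.sub (.mul (.succ (var 1)) (var 3)) (var 2)))) with hQ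
  have h0 : Q 0 = 0 := prec_zero _ _ _
  have h1 : ∀ n, Q (n + 1) = Q n + (1 - ((n + 1) * y - x)) := fun n => by
    rw [hQ, prec_add_one, eval_add, eval_sub, eval_sub, eval_mul, eval_one, eval_succ]
    simp [scons]
  have hq : qo x y = Q x := (eval_recur _ _ _ _).trans (by rw [eval_var]; rfl)
  have hQd : ∀ {f : (ℕ → M.C) → M.C}, DefF f → DefF fun e => Q (f e) := fun hf => hf.prec _ _ _
  have hlow : ∀ n, n ≤ q → Q n = n := fun n => by
    induction n using induct with
    | hP => exact (DefP.le (.arg 0) (.const q)).imp (.eq (hQd (.arg 0)) (.arg 0))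
    | h0 => exact fun _ => h0
    | hs n ih =>
      intro hn
      have : (n + 1) * y ≤ x := by
        calc (n + 1) * y ≤ q * y := by gcongr
          _ ≤ x := by rw [hx, mul_comm]; exact le_self_add
      rw [h1, ih (le_of_lt hn), tsub_eq_zero_of_le this, tsub_zero]
  have hhigh : ∀ n, Q (q + n) = q := fun n => by
    induction n using induct with
    | hP => exact .eq (hQd (.add (.const q) (.arg 0))) (.const q)
    | h0 => rw [add_zero]; exact hlow q le_rfl
    | hs n ih =>
      have : x + 1 ≤ (q + n + 1) * y := by
        have := lt_def.1 hr
        calc x + 1 = y * q + (r + 1) := by rw [hx]; ring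
          _ ≤ y * q + y := by gcongr
          _ ≤ y * q + y + n * y := le_self_add
          _ = _ := by ring
      have h2 : 1 ≤ (q + n + 1) * y - x := by
        rw [le_tsub_iff_left (le_trans le_self_add this)]; exact this
      rw [← add_assoc, h1, ih, tsub_eq_zero_of_le h2, add_zero]
  -- The recursion runs for `x` steps, so it must be seen to reach the constant phase.
  have hqx : q ≤ x := by
    have : 1 ≤ y := lt_def.1 (pos_of_gt hr) |>.trans' (by simp)
    calc q = 1 * q := by ring
      _ ≤ y * q := by gcongr
      _ ≤ x := le_self_add
  obtain ⟨n, hn⟩ := le_iff.1 hqx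
  rw [hq, hn, hhigh]

theorem rm_mul_add (y q r : M.C) (hr : r < y) : rm (y * q + r) y = r := by
  rw [rm, qo_mul_add y q r hr, add_tsub_cancel_left]

theorem exists_mul_add (x : M.C) {y : M.C} (hy : 0 < y) : ∃ q ≤ x, ∃ r < y, x = y * q + r := by
  induction x using induct with
  | hP => fun_prop
  | h0 => exact ⟨0, le_rfl, 0, hy, by ring⟩
  | hs x ih =>
    obtain ⟨q, hq, r, hr, rfl⟩ := ih
    rcases (lt_def.1 hr).lt_or_eq with h | h
    · exact ⟨q, hq.trans le_self_add, r + 1, h, by ring⟩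
    · exact ⟨q + 1, by gcongr, 0, hy, by rw [← h]; ring⟩

theorem rm_lt (x : M.C) {y : M.C} (hy : 0 < y) : rm x y < y := by
  obtain ⟨q, -, r, hr, rfl⟩ := exists_mul_add x hy
  rwa [rm_mul_add _ _ _ hr]

theorem qo_add_mul (x c : M.C) {y : M.C} (hy : 0 < y) : qo (x + y * c) y = qo x y + c := by
  obtain ⟨q, -, r, hr, rfl⟩ := exists_mul_add x hy
  rw [qo_mul_add _ _ _ hr, show y * q + r + y * c = y * (q + c) + r by ring, qo_mul_add _ _ _ hr]

theorem rm_add_mul (x c : M.C) {y : M.C} (hy : 0 < y) : rm (x + y * c) y = rm x y := by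
  obtain ⟨q, -, r, hr, rfl⟩ := exists_mul_add x hy
  rw [rm_mul_add _ _ _ hr, show y * q + r + y * c = y * (q + c) + r by ring, rm_mul_add _ _ _ hr]

theorem qo_of_lt {x y : M.C} (h : x < y) : qo x y = 0 := by
  have := qo_mul_add y 0 x h
  rwa [mul_zero, zero_add] at this

theorem rm_of_lt {x y : M.C} (h : x < y) : rm x y = x := by
  have := rm_mul_add y 0 x h
  rwa [mul_zero, zero_add] at this

theorem pw_pos {x : M.C} (hx : 0 < x) (n : M.C) : 0 < pw x n := by
  induction n using induct with
  | hP => fun_prop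
  | h0 => simp
  | hs n ih => rw [pw_add_one]; exact mul_pos ih hx

theorem pw_add (x m n : M.C) : pw x (m + n) = pw x m * pw x n := by
  induction n using induct with
  | hP => fun_prop
  | h0 => simp
  | hs n ih => rw [← add_assoc, pw_add_one, ih, pw_add_one]; ring

theorem pw_le_pw {x m n : M.C} (hx : 0 < x) (h : m ≤ n) : pw x m ≤ pw x n := by
  obtain ⟨z, rfl⟩ := le_iff.1 h
  rw [pw_add]
  exact le_mul_of_one_le_right' (lt_def.1 (pw_pos hx z) |>.trans' (by simp))

theorem lt_pw_two (m : M.C) : m < pw 2 m := by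
  induction m using induct with
  | hP => fun_prop
  | h0 => simp
  | hs m ih =>
    rw [pw_add_one]
    have := lt_def.1 ih
    rw [lt_def]
    calc m + 1 + 1 ≤ (m + 1) + (m + 1) := by gcongr; exact le_add_self
      _ ≤ pw 2 m + pw 2 m := by gcongr
      _ = _ := by ring

/-! ### Digits -/

@[simp] theorem eval_digit (env : ℕ → M.C) (k s a : Tm) : eval env (.digit k s a) =
    rm (qo (eval env s) (pw (eval env k) (eval env a))) (eval env k) := by
  simp [Tm.digit]

/-- The code of the first `n` values of the function variable `γ` in base `k`. -/
def _root_.IRCA.Tm.seqCode (γ : ℕ) (k n : Tm) : Tm :=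
  .recur .zero (.add (var 0) (.mul (.app γ (var 1)) (.pow (k.shift 2 0) (var 1)))) n

/-- The code of the first `n` values of the function variable `γ` in base `k`. -/
noncomputable def seqCode (γ : ℕ) (k n : M.C) : M.C :=
  prec (fun _ => k) .zero (.add (var 0) (.mul (.app γ (var 1)) (.pow (var 2) (var 1)))) n

theorem _root_.IRCA.Tm.subst_mul (σ : ℕ → Tm) (ρ : ℕ → ℕ) (a b : Tm) :
    (Tm.mul a b).subst σ ρ = .mul (a.subst σ ρ) (b.subst σ ρ) := by
  simp only [Tm.mul, Tm.subst, Tm.subst_add, Tm.shift_two_subst_up_up]; rfl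

theorem _root_.IRCA.Tm.subst_pow (σ : ℕ → Tm) (ρ : ℕ → ℕ) (a b : Tm) :
    (Tm.pow a b).subst σ ρ = .pow (a.subst σ ρ) (b.subst σ ρ) := by
  simp only [Tm.pow, Tm.subst, Tm.subst_mul, Tm.shift_two_subst_up_up]; rfl

@[simp] theorem eval_seqCode (env : ℕ → M.C) (γ : ℕ) (k n : Tm) :
    eval env (.seqCode γ k n) = seqCode γ (eval env k) (eval env n) := by
  refine (eval_recur _ _ _ _).trans ?_
  have := prec_subst env (fun _ => k) .zero
    (.add (var 0) (.mul (.app γ (var 1)) (.pow (var 2) (var 1)))) (eval env n)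
  rw [seqCode, ← this]
  congr 1
  simp only [Tm.subst, Tm.subst_add, Tm.subst_mul, Tm.subst_pow, Tm.up_up_add_two]
  rfl

@[fun_prop]
theorem DefF.seqCode (γ : ℕ) (k : M.C) {f : (ℕ → M.C) → M.C} (hf : DefF f) :
    DefF (fun e => seqCode γ k (f e)) := DefF.prec _ _ _ hf

theorem seqCode_zero (γ : ℕ) (k : M.C) : seqCode γ k 0 = 0 := prec_zero _ _ _

theorem seqCode_add_one (γ : ℕ) (k n : M.C) :
    seqCode γ k (n + 1) = seqCode γ k n + fn γ n * pw k n := by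
  rw [seqCode, prec_add_one]; simp [scons]; rfl

/-- The digits below place `a` sum to less than `k ^ a` and vanish in the quotient; those above
contribute multiples of `k` to the quotient and vanish in the remainder. -/
theorem digit_seqCode (γ : ℕ) {k n : M.C} (hg : ∀ x < n, fn γ x < k) {a : M.C} (ha : a < n) :
    rm (qo (seqCode γ k n) (pw k a)) k = fn γ a := by
  have hk : 0 < k := pos_of_gt (hg a ha)
  have hlt : ∀ m, m ≤ n → seqCode γ k m < pw k m := fun m => by
    induction m using induct with
    | hP => fun_prop
    | h0 => intro _; rw [seqCode_zero, pw_zero]; exact zero_lt_one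
    | hs m ih =>
      intro hm
      have h1 := ih (le_of_lt hm)
      rw [seqCode_add_one, pw_add_one]
      calc seqCode γ k m + fn γ m * pw k m < pw k m + fn γ m * pw k m := by gcongr
        _ = pw k m * (fn γ m + 1) := by ring
        _ ≤ pw k m * k := by gcongr; exact hg m hm
  have key : ∀ m, a + 1 + m ≤ n → rm (qo (seqCode γ k (a + 1 + m)) (pw k a)) k = fn γ a := fun m => by
    induction m using induct with
    | hP => fun_prop
    | h0 =>
      intro _
      rw [add_zero, seqCode_add_one, mul_comm, qo_add_mul _ _ (pw_pos hk a),
        qo_of_lt (hlt a ha.le), zero_add, rm_of_lt (hg a ha)]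
    | hs m ih =>
      intro hm
      rw [← add_assoc] at hm ⊢
      rw [seqCode_add_one, show pw k (a + 1 + m) = pw k a * k * pw k m by
        rw [pw_add, pw_add_one],
        show fn γ (a + 1 + m) * (pw k a * k * pw k m) =
          pw k a * (k * (pw k m * fn γ (a + 1 + m))) by ring,
        qo_add_mul _ _ (pw_pos hk a), rm_add_mul _ _ hk]
      exact ih (le_of_lt hm)
  obtain ⟨m, rfl⟩ := le_iff.1 (lt_def.1 ha)
  exact key m le_rfl

/-! ### Pairs -/

/-- The sum of all numbers below `b`. -/
noncomputable def tri (b : M.C) : M.C := prec (fun _ => 0) .zero (.add (var 0) (var 1)) b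

@[simp] theorem eval_tri (env : ℕ → M.C) (b : Tm) : eval env (.tri b) = tri (eval env b) :=
  (eval_recur _ _ _ _).trans
    (prec_subst env (fun _ => .zero) .zero (.add (var 0) (var 1)) (eval env b))

theorem tri_zero : tri (0 : M.C) = 0 := prec_zero _ _ _

theorem tri_add_one (b : M.C) : tri (b + 1) = tri b + b := by
  rw [tri, prec_add_one]; simp [scons]; rfl

@[fun_prop]
theorem DefF.tri {f : (ℕ → M.C) → M.C} (hf : DefF f) : DefF (fun e => tri (f e)) :=
  DefF.prec _ _ _ hf

/-- The code of an increasing pair. -/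
noncomputable def ec (a b : M.C) : M.C := tri b + a

/-- The code of a pair. -/
noncomputable def pr (i n : M.C) : M.C := ec i (i + n + 1)

@[simp] theorem eval_edgeCode (env : ℕ → M.C) (a b : Tm) :
    eval env (.edgeCode a b) = ec (eval env a) (eval env b) := by simp [Tm.edgeCode, ec]

@[simp] theorem eval_pair (env : ℕ → M.C) (a b : Tm) :
    eval env (.pair a b) = pr (eval env a) (eval env b) := by simp [Tm.pair, pr]

@[fun_prop]
theorem DefF.ec {f g : (ℕ → M.C) → M.C} (hf : DefF f) (hg : DefF g) :
    DefF (fun e => ec (f e) (g e)) := by unfold Mod.ec; fun_prop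

@[fun_prop]
theorem DefF.pr {f g : (ℕ → M.C) → M.C} (hf : DefF f) (hg : DefF g) :
    DefF (fun e => pr (f e) (g e)) := by unfold Mod.pr; fun_prop

theorem tri_mono {a b : M.C} (h : a ≤ b) : tri a ≤ tri b := by
  obtain ⟨z, rfl⟩ := le_iff.1 h
  induction z using induct with
  | hP => fun_prop
  | h0 => simp
  | hs z ih => rw [← add_assoc, tri_add_one]; exact (ih le_self_add).trans le_self_add

/-- The codes of pairs with larger member `b` fill the interval from `tri b` up to, but not
including, `tri (b + 1)`. -/
theorem ec_lt {a b b' : M.C} (h : a < b) (hb : b < b') (a' : M.C) : ec a b < ec a' b' :=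
  calc tri b + a < tri b + b := by gcongr
    _ = tri (b + 1) := (tri_add_one b).symm
    _ ≤ tri b' := tri_mono hb
    _ ≤ tri b' + a' := le_self_add

theorem ec_inj {a b a' b' : M.C} (h : a < b) (h' : a' < b') (he : ec a b = ec a' b') :
    a = a' ∧ b = b' := by
  rcases lt_trichotomy b b' with hb | rfl | hb
  · exact absurd he (ec_lt h hb a').ne
  · exact ⟨add_left_cancel he, rfl⟩
  · exact absurd he (ec_lt h' hb a).ne'

theorem le_ec_right {a b : M.C} (h : a < b) : b ≤ ec a b + 1 := by
  rcases cases_add_one b with rfl | ⟨b, rfl⟩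
  · exact zero_le
  · rw [ec, tri_add_one]
    gcongr
    rw [add_assoc]
    exact le_self_add.trans le_add_self

theorem exists_ec (x : M.C) : ∃ b ≤ x + 1, ∃ a < b, x = ec a b := by
  induction x using induct with
  | hP => fun_prop
  | h0 => exact ⟨1, by simp, 0, by simp, by
      rw [ec, ← zero_add (1 : M.C), tri_add_one, tri_zero]; simp⟩
  | hs x ih =>
    obtain ⟨b, hb, a, ha, rfl⟩ := ih
    rcases (lt_def.1 ha).lt_or_eq with h | h
    · exact ⟨b, hb.trans le_self_add, a + 1, h, by rw [ec, ec, add_assoc]⟩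
    · exact ⟨b + 1, by gcongr, 0, by simp, by rw [ec, ec, tri_add_one, add_assoc, h, add_zero]⟩

theorem lt_pr_aux (i n : M.C) : i < i + n + 1 := by
  rw [lt_add_one_iff]; exact le_self_add

theorem pr_inj {i n i' n' : M.C} (h : pr i n = pr i' n') : i = i' ∧ n = n' := by
  obtain ⟨rfl, h2⟩ := ec_inj (lt_pr_aux i n) (lt_pr_aux i' n') h
  exact ⟨rfl, add_left_cancel (add_right_cancel h2)⟩

theorem add_le_pr (i n : M.C) : i + n ≤ pr i n :=
  le_of_add_le_add_right (le_ec_right (lt_pr_aux i n))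

theorem le_pr_left (i n : M.C) : i ≤ pr i n := le_self_add.trans (add_le_pr i n)

theorem le_pr_right (i n : M.C) : n ≤ pr i n := le_add_self.trans (add_le_pr i n)

theorem exists_pr (x : M.C) : ∃ i n, x = pr i n := by
  obtain ⟨b, -, a, ha, rfl⟩ := exists_ec x
  obtain ⟨n, rfl⟩ := le_iff.1 (lt_def.1 ha)
  exact ⟨a, n, by rw [pr]; congr 1; ring⟩

theorem pr_lt_pr (i : M.C) {n n' : M.C} (h : n < n') : pr i n < pr i n' :=
  ec_lt (lt_pr_aux i n) (by gcongr) i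

/-! ### Binary sequences -/

theorem parity (x : M.C) : ∃ y ≤ x, x = 2 * y ∨ x = 2 * y + 1 := by
  obtain ⟨q, hq, r, hr, rfl⟩ := exists_mul_add x (y := 2) (by simp)
  refine ⟨q, hq, ?_⟩
  rcases cases_add_one r with rfl | ⟨s, rfl⟩
  · exact .inl (add_zero _)
  · rw [← one_add_one_eq_two, add_lt_add_iff_right, ← zero_add (1 : M.C), lt_add_one_iff] at hr
    rw [le_zero_iff.1 hr, zero_add]; exact .inr rfl

theorem one_lt_two' : (1 : M.C) < 2 := by
  rw [← one_add_one_eq_two, lt_add_one_iff]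

/-- The parent of a node of the binary tree. -/
noncomputable def par (c : M.C) : M.C := qo (prd c) 2

/-- The ancestors of a node. -/
noncomputable def anc (c j : M.C) : M.C :=
  prec (fun _ => c) (var 0) (.quo (.pred (var 0)) .two) j

@[simp] theorem eval_ancestor (env : ℕ → M.C) (c j : Tm) :
    eval env (.ancestor c j) = anc (eval env c) (eval env j) :=
  (eval_recur _ _ _ _).trans
    (prec_subst env (fun _ => c) (var 0) (.quo (.pred (var 0)) .two) (eval env j))

theorem eval_anc_eq (c j : M.C) :
    anc c j = eval (scons c fun _ => j) (.ancestor (var 0) (var 1)) := by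
  rw [eval_ancestor, eval_var, eval_var]; rfl

@[fun_prop]
theorem DefF.anc {f g : (ℕ → M.C) → M.C} (hf : DefF f) (hg : DefF g) :
    DefF (fun e => anc (f e) (g e)) := by
  simp only [eval_anc_eq]
  exact DefF.binary _ hf hg

@[simp] theorem anc_zero (c : M.C) : anc c 0 = c := by rw [anc, prec_zero, eval_var]

theorem anc_add_one (c j : M.C) : anc c (j + 1) = par (anc c j) := by
  rw [anc, prec_add_one]; simp [scons, par]; rfl

theorem par_zero : par (0 : M.C) = 0 := by rw [par, prd_zero, qo_of_lt (by simp)]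

theorem par_left (c : M.C) : par (2 * c + 1) = c := by
  rw [par, prd_add_one]
  have := qo_mul_add 2 c 0 (by simp)
  rwa [add_zero] at this

theorem par_right (c : M.C) : par (2 * c + 2) = c := by
  rw [par, ← one_add_one_eq_two, ← add_assoc, prd_add_one, one_add_one_eq_two]
  exact qo_mul_add 2 c 1 one_lt_two'

theorem cases_par (c : M.C) : c = 0 ∨ c = 2 * par c + 1 ∨ c = 2 * par c + 2 := by
  rcases cases_add_one c with h | ⟨d, rfl⟩
  · exact .inl h
  · obtain ⟨y, -, rfl | rfl⟩ := parity d
    · rw [par_left]; exact .inr (.inl rfl)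
    · rw [add_assoc, one_add_one_eq_two, par_right]; exact .inr (.inr rfl)

theorem anc_add (c i j : M.C) : anc c (i + j) = anc (anc c i) j := by
  induction j using induct with
  | hP => fun_prop
  | h0 => simp
  | hs j ih => rw [← add_assoc, anc_add_one, anc_add_one, ih]

/-- The code of the first `m` values of a function variable. -/
noncomputable def seg (p : ℕ) (m : M.C) : M.C :=
  prec (fun _ => 0) .zero (.succ (.add (.mul .two (var 0)) (.app p (var 1)))) m

@[simp] theorem eval_initSeg (env : ℕ → M.C) (p : ℕ) (m : Tm) :
    eval env (.initSeg p m) = seg p (eval env m) :=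
  (eval_recur _ _ _ _).trans (prec_subst env (fun _ => .zero) .zero
    (.succ (.add (.mul .two (var 0)) (.app p (var 1)))) (eval env m))

@[fun_prop]
theorem DefF.seg (p : ℕ) {f : (ℕ → M.C) → M.C} (hf : DefF f) : DefF (fun e => seg p (f e)) :=
  DefF.prec _ _ _ hf

theorem seg_zero (p : ℕ) : (seg p 0 : M.C) = 0 := prec_zero _ _ _

theorem seg_add_one (p : ℕ) (m : M.C) : seg p (m + 1) = 2 * seg p m + fn p m + 1 := by
  rw [seg, prec_add_one]; simp [scons]; rfl

theorem lt_two_iff {x : M.C} : x < 2 ↔ x = 0 ∨ x = 1 := by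
  rw [← one_add_one_eq_two, lt_add_one_iff]
  rcases cases_add_one x with rfl | ⟨y, rfl⟩
  · simp
  · simp

theorem par_seg {p : ℕ} {m : M.C} (hp : fn p m < 2) : par (seg p (m + 1)) = seg p m := by
  rw [seg_add_one]
  rcases lt_two_iff.1 hp with h | h
  · rw [h, add_zero, par_left]
  · rw [h, add_assoc, one_add_one_eq_two, par_right]

/-- No bound on `j` is needed: the empty sequence is its own parent, in step with truncated
subtraction. -/
theorem anc_seg {p : ℕ} {m : M.C} (hp : ∀ x < m, fn p x < 2) (j : M.C) :
    anc (seg p m) j = seg p (m - j) := by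
  induction j using induct with
  | hP => fun_prop
  | h0 => simp
  | hs j ih =>
    rw [anc_add_one, ih, ← tsub_tsub]
    rcases cases_add_one (m - j) with h | ⟨y, h⟩
    · rw [h, seg_zero, par_zero, zero_tsub, seg_zero]
    · have hy : y < m := lt_of_lt_of_le (by rw [h]; simp) (tsub_le_self (b := j))
      rw [h, par_seg (hp y hy), add_tsub_cancel_right]

/-- The length of a node. -/
def HL (c m : M.C) : Prop := pw 2 m ≤ c + 1 ∧ c + 1 < pw 2 (m + 1)

theorem sat_hasLength (env : ℕ → M.C) (c m : Tm) :
    sat env (.hasLength c m) ↔ HL (eval env c) (eval env m) := by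
  simp only [Fm.hasLength, Fm.lt, Fm.le, sat, eval_sub, eval_pow, eval_two, eval_succ]
  exact Iff.rfl

@[fun_prop]
theorem DefP.HL {f g : (ℕ → M.C) → M.C} (hf : DefF f) (hg : DefF g) :
    DefP (fun e => HL (f e) (g e)) := by unfold Mod.HL; fun_prop

theorem HL.unique {c m n : M.C} (h : HL c m) (h' : HL c n) : m = n := by
  have key : ∀ {m n : M.C}, HL c m → HL c n → n ≤ m := fun {m n} h h' => by
    by_contra! hc
    exact absurd (h.2.trans_le (pw_le_pw (by simp) hc)) h'.1.not_gt
  exact le_antisymm (key h' h) (key h h')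

theorem HL.le {c m : M.C} (h : HL c m) : m ≤ c := lt_add_one_iff.1 ((lt_pw_two m).trans_le h.1)

theorem HL.zero : HL (0 : M.C) 0 := by
  refine ⟨by simp, ?_⟩
  rw [pw_add_one, pw_zero]; simp

theorem HL.par {c m : M.C} (h : HL c (m + 1)) : HL (par c) m := by
  obtain ⟨h1, h2⟩ := h
  simp only [HL, pw_add_one] at *
  have hpos := pw_pos (x := (2 : M.C)) (by simp) m
  set y := Mod.par c
  set P := pw 2 m
  rw [Z.lt_iff] at hpos
  simp only [← Z.lt, ← Z.le, Z.add, Z.mul, Z.one, Z.two, Z.zero] at h1 h2 hpos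
  rcases cases_par c with h0 | h0 | h0 <;> rw [← Z.inj] at h0 <;>
    simp only [Z.add, Z.mul, Z.one, Z.two, Z.zero] at h0
  · linarith
  · constructor <;> simp only [← Z.lt, ← Z.le, Z.add, Z.mul, Z.one, Z.two] <;> linarith
  · constructor
    · by_contra! hc
      rw [Z.lt_iff, Z.add, Z.one] at hc
      linarith
    · simp only [← Z.lt, Z.add, Z.mul, Z.one, Z.two]; linarith

theorem HL.child {c m b : M.C} (h : HL c m) (hb : b < 2) : HL (2 * c + b + 1) (m + 1) := by
  obtain ⟨h1, h2⟩ := h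
  simp only [HL, pw_add_one] at *
  have hb0 := Z.nonneg b
  set P := pw 2 m
  rw [Z.lt_iff] at h2 hb
  simp only [← Z.le, Z.add, Z.mul, Z.one, Z.two] at h1 h2 hb
  constructor <;> simp only [← Z.lt, ← Z.le, Z.add, Z.mul, Z.one, Z.two] <;> linarith

theorem HL.seg {p : ℕ} {m : M.C} (hp : ∀ x < m, fn p x < 2) : HL (seg p m) m := by
  have : ∀ n, n ≤ m → HL (Mod.seg p n) n := fun n => by
    induction n using induct with
    | hP => fun_prop
    | h0 => intro _; rw [seg_zero]; exact HL.zero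
    | hs n ih => intro hn; rw [seg_add_one]; exact (ih (le_of_lt hn)).child (hp n hn)
  exact this m le_rfl

end Mod

namespace Mod

variable {M : Mod}

open Tm (var)

/-! ### The pigeonhole principle -/

theorem DefF.ite {P : (ℕ → M.C) → Prop} [∀ e, Decidable (P e)] {f g : (ℕ → M.C) → M.C}
    (hP : DefP P) (hf : DefF f) (hg : DefF g) : DefF (fun e => if P e then f e else g e) := by
  obtain ⟨φ, hφ, h⟩ := hP
  obtain ⟨s, hs⟩ := hf
  obtain ⟨t, ht⟩ := hg
  refine ⟨.cite φ.chi s t, fun e => ?_⟩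
  rw [eval_cite, ← hs, ← ht]
  have := eval_chi (mix e) hφ
  rw [← h] at this
  by_cases hp : P e
  · rw [if_pos (this.2 hp)]; exact if_pos hp
  · rw [if_neg (mt this.1 hp)]; exact if_neg hp

theorem DefF.of_one {F : M.C → M.C} (hF : DefF fun e => F (e 0)) {f : (ℕ → M.C) → M.C}
    (hf : DefF f) : DefF fun e => F (f e) := by
  obtain ⟨t, ht⟩ := hF
  have : (fun e => F (f e)) = fun e : ℕ → M.C => eval (fun i => mix (fun _ => f e) i) t := by
    funext e; exact ht fun _ => f e
  rw [this]
  refine DefF.comp t fun i => ?_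
  simp only [mix]
  split_ifs
  · exact hf
  · exact .const _

theorem exists_sum {f : M.C → M.C → M.C} (hf : DefF fun e => f (e 0) (e 1)) :
    ∃ S : M.C → M.C → M.C, (∀ m, S m 0 = 0) ∧ (∀ m n, S m (n + 1) = S m n + f m n) ∧
      ∀ g h : (ℕ → M.C) → M.C, DefF g → DefF h → DefF fun e => S (g e) (h e) := by
  obtain ⟨t, ht⟩ := hf
  -- Inside the recursion, variable `0` is the partial sum, `1` the summation index, `2` the
  -- argument `m`, and the parameters come after them.
  let τ : ℕ → Tm := fun i => if i % 2 = 0 then (if i = 0 then var 2 else var 1) else var (i / 2 + 3)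
  refine ⟨fun m n => prec (scons m fun i => cls (var i)) .zero (.add (var 0) (t.subst τ id)) n,
    fun m => prec_zero _ _ _, fun m n => ?_, fun g h hg hh => ?_⟩
  · beta_reduce
    rw [prec_add_one, eval_add, eval_var, scons_zero, eval_subst,
      show f m n = _ from ht (scons m fun _ => n)]
    congr 2
    funext i
    simp only [τ, mix]
    split_ifs with h1 h2
    · simp [h2, scons]
    · obtain ⟨j, hj⟩ : ∃ j, i / 2 = j + 1 := ⟨i / 2 - 1, by omega⟩
      simp [hj, scons]
    · simp [scons]
  · exact DefF.comp _ (DefF.scons hh (DefF.scons hg fun i => .const _))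

/-- `S m j` counts the values below `j` that `F` takes on arguments below `m`. It is at most `j`,
but injectivity would raise it by one with every new argument, giving `S (k + 1) k = k + 1`. -/
theorem pigeonhole {F : M.C → M.C} (hF : DefF fun e => F (e 0)) {k : M.C}
    (hlt : ∀ x ≤ k, F x < k) : ∃ x y, x < y ∧ y ≤ k ∧ F x = F y := by
  classical
  by_contra! hinj
  have hd : DefP fun e : ℕ → M.C => ∃ x < e 0, F x = e 1 :=
    .bex (.arg 0) (.eq (.of_one hF (.arg 0)) (.arg 2))
  obtain ⟨S, hS0, hS1, hS⟩ := exists_sum (f := fun m j => if ∃ x < m, F x = j then 1 else 0)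
    (.ite hd (.const 1) (.const 0))
  have hle : ∀ m j, S m j ≤ j := fun m j => by
    induction j using induct with
    | hP => exact .le (hS _ _ (.const m) (.arg 0)) (.arg 0)
    | h0 => rw [hS0]
    | hs j ih =>
      rw [hS1]
      gcongr
      split_ifs <;> simp
  have hzero : ∀ j, S 0 j = 0 := fun j => by
    induction j using induct with
    | hP => exact .eq (hS _ _ (.const 0) (.arg 0)) (.const 0)
    | h0 => exact hS0 0
    | hs j ih => rw [hS1, ih, if_neg (by simp), add_zero]
  -- A new argument `m` adds the single new value `F m`, so counts change only beyond that value.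
  have hstep : ∀ m ≤ k, ∀ j, (j ≤ F m → S (m + 1) j = S m j) ∧
      (F m < j → S (m + 1) j = S m j + 1) := fun m hm j => by
    induction j using induct with
    | hP =>
      exact (DefP.imp (.le (.arg 0) (.const _)) (.eq (hS _ _ (.const _) (.arg 0))
        (hS _ _ (.const _) (.arg 0)))).and (.imp (.lt (.const _) (.arg 0))
        (.eq (hS _ _ (.const _) (.arg 0)) (.add (hS _ _ (.const _) (.arg 0)) (.const 1))))
    | h0 => exact ⟨fun _ => by rw [hS0, hS0], fun h => absurd h (by simp)⟩
    | hs j ih =>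
      have hne : j ≠ F m → ((∃ x < m + 1, F x = j) ↔ ∃ x < m, F x = j) := fun hj => by
        constructor
        · rintro ⟨x, hx, rfl⟩
          rcases (lt_add_one_iff.1 hx).lt_or_eq with h | rfl
          · exact ⟨x, h, rfl⟩
          · exact absurd rfl hj
        · rintro ⟨x, hx, h⟩
          exact ⟨x, hx.trans (lt_add_one_iff.2 le_rfl), h⟩
      rw [hS1, hS1]
      constructor
      · intro h
        rw [ih.1 (le_of_lt h)]
        simp only [hne (ne_of_lt h)]
      · intro h
        rcases (lt_add_one_iff.1 h).lt_or_eq with h' | h'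
        · rw [ih.2 h']
          simp only [hne h'.ne']
          ring
        · rw [ih.1 h'.ge, if_pos ⟨m, lt_add_one_iff.2 le_rfl, h'⟩, if_neg, add_zero]
          rintro ⟨x, hx, h2⟩
          exact hinj x m hx hm (h2.trans h'.symm)
  have hcount : ∀ m, m ≤ k + 1 → S m k = m := fun m => by
    induction m using induct with
    | hP => exact .imp (.le (.arg 0) (.const _)) (.eq (hS _ _ (.arg 0) (.const _)) (.arg 0))
    | h0 => exact fun _ => hzero k
    | hs m ih =>
      intro hm
      have hm' : m ≤ k := by simpa using hm
      rw [(hstep m hm' k).2 (hlt m hm'), ih (le_of_lt hm)]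
  have := hle (k + 1) k
  rw [hcount _ le_rfl] at this
  exact absurd this (not_le.2 (lt_add_one_iff.2 le_rfl))

/-- Outside a clique of `K` vertices, only two of `K + 2` colors are left. -/
theorem no_three_colors {g : M.C → M.C} (hg : DefF fun e => g (e 0)) {K p q r : M.C}
    (hlt : ∀ x < K, g x < K + 2) (hinj : ∀ x y, x < y → y < K → g x ≠ g y)
    (hp : p < K + 2) (hq : q < K + 2) (hr : r < K + 2) (hgp : ∀ x < K, g x ≠ p)
    (hgq : ∀ x < K, g x ≠ q) (hgr : ∀ x < K, g x ≠ r) (hpq : p ≠ q) (hpr : p ≠ r)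
    (hqr : q ≠ r) : False := by
  classical
  -- The clique followed by `p`, `q`, `r` gives `K + 3` distinct values below `K + 2`.
  let F : M.C → M.C := fun x => if x < K then g x else if x = K then p else if x = K + 1 then q else r
  have hF : DefF fun e => F (e 0) := .ite (.lt (.arg 0) (.const K)) hg (.ite (.eq (.arg 0) (.const _))
    (.const p) (.ite (.eq (.arg 0) (.const _)) (.const q) (.const r)))
  have hcase : ∀ x, (x < K ∧ F x = g x) ∨ (x = K ∧ F x = p) ∨ (x = K + 1 ∧ F x = q) ∨
      (K + 1 < x ∧ F x = r) := fun x => by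
    simp only [F]
    by_cases h1 : x < K
    · simp [h1]
    · by_cases h2 : x = K
      · simp [h2]
      · by_cases h3 : x = K + 1
        · simp [h3]
        · right; right; right
          refine ⟨lt_of_le_of_ne (lt_of_le_of_ne (not_lt.1 h1) (Ne.symm h2)) (Ne.symm h3), ?_⟩
          simp [h1, h2, h3]
  obtain ⟨x, y, hxy, hy, he⟩ := pigeonhole hF (k := K + 2) fun x _ => by
    rcases hcase x with ⟨h, h'⟩ | ⟨-, h'⟩ | ⟨-, h'⟩ | ⟨-, h'⟩ <;> rw [h']
    exacts [hlt x h, hp, hq, hr]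
  rw [← one_add_one_eq_two, ← add_assoc] at hy
  rcases hcase y with ⟨h, h'⟩ | ⟨h, h'⟩ | ⟨h, h'⟩ | ⟨h, h'⟩ <;>
    rcases hcase x with ⟨l, l'⟩ | ⟨l, l'⟩ | ⟨l, l'⟩ | ⟨l, l'⟩ <;> rw [h', l'] at he
  · exact hinj x y hxy h he
  · rw [l] at hxy; exact lt_asymm hxy h
  · rw [l] at hxy; exact lt_asymm (hxy.trans h) (lt_add_one_iff.2 le_rfl)
  · exact lt_asymm ((l.trans hxy).trans h) (lt_add_one_iff.2 le_rfl)
  · exact hgp x l he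
  · rw [h, l] at hxy; exact lt_irrefl _ hxy
  · rw [h, l] at hxy; exact lt_asymm hxy (lt_add_one_iff.2 le_rfl)
  · rw [h] at hxy; exact lt_asymm (l.trans hxy) (lt_add_one_iff.2 le_rfl)
  · exact hgq x l he
  · exact hpq he
  · rw [h, l] at hxy; exact lt_irrefl _ hxy
  · rw [h] at hxy; exact lt_asymm l hxy
  · exact hgr x l he
  · exact hpr he
  · exact hqr he
  · exact absurd (lt_of_lt_of_le hxy hy) (not_lt.2 l)

end Mod

open Tm (var one two pair edgeCode digit ancestor initSeg)

/-! ## Renaming function variables -/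

namespace Tm

theorem shiftF_one (ρ : ℕ → ℕ) (σ : ℕ → Tm) : one.subst σ ρ = one := rfl

theorem shiftF_two (ρ : ℕ → ℕ) (σ : ℕ → Tm) : two.subst σ ρ = two := rfl

theorem subst_edgeCode (σ : ℕ → Tm) (ρ : ℕ → ℕ) (a b : Tm) :
    (edgeCode a b).subst σ ρ = edgeCode (a.subst σ ρ) (b.subst σ ρ) := rfl

theorem subst_pair (σ : ℕ → Tm) (ρ : ℕ → ℕ) (a b : Tm) :
    (pair a b).subst σ ρ = pair (a.subst σ ρ) (b.subst σ ρ) := rfl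

theorem subst_quo (σ : ℕ → Tm) (ρ : ℕ → ℕ) (a b : Tm) :
    (quo a b).subst σ ρ = quo (a.subst σ ρ) (b.subst σ ρ) := by
  simp only [quo, subst, subst_add, subst_sub, subst_mul, shift_two_subst_up_up]; rfl

theorem subst_digit (σ : ℕ → Tm) (ρ : ℕ → ℕ) (k s a : Tm) :
    (digit k s a).subst σ ρ = digit (k.subst σ ρ) (s.subst σ ρ) (a.subst σ ρ) := by
  simp only [digit, rem, subst_sub, subst_mul, subst_quo, subst_pow]

theorem subst_ancestor (σ : ℕ → Tm) (ρ : ℕ → ℕ) (c j : Tm) :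
    (ancestor c j).subst σ ρ = ancestor (c.subst σ ρ) (j.subst σ ρ) := by
  simp only [ancestor, subst, subst_quo, subst_pred]; rfl

end Tm

namespace Fm

theorem subst_le (σ : ℕ → Tm) (ρ : ℕ → ℕ) (a b : Tm) :
    (le a b).subst σ ρ = le (a.subst σ ρ) (b.subst σ ρ) := rfl

theorem subst_lt (σ : ℕ → Tm) (ρ : ℕ → ℕ) (a b : Tm) :
    (lt a b).subst σ ρ = lt (a.subst σ ρ) (b.subst σ ρ) := rfl

theorem subst_ne (σ : ℕ → Tm) (ρ : ℕ → ℕ) (a b : Tm) :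
    (ne a b).subst σ ρ = ne (a.subst σ ρ) (b.subst σ ρ) := rfl

theorem subst_iff (σ : ℕ → Tm) (ρ : ℕ → ℕ) (φ ψ : Fm) :
    (iff φ ψ).subst σ ρ = iff (φ.subst σ ρ) (ψ.subst σ ρ) := rfl

theorem subst_edge (σ : ℕ → Tm) (ρ : ℕ → ℕ) (e : ℕ) (i a b : Tm) :
    (edge e i a b).subst σ ρ = edge (ρ e) (i.subst σ ρ) (a.subst σ ρ) (b.subst σ ρ) := rfl

theorem subst_hasLength (σ : ℕ → Tm) (ρ : ℕ → ℕ) (c m : Tm) :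
    (hasLength c m).subst σ ρ = hasLength (c.subst σ ρ) (m.subst σ ρ) := by
  simp only [hasLength, Fm.subst, subst_le, subst_lt, Tm.subst_pow, Tm.shiftF_two, Tm.subst]

theorem subst_inTree (σ : ℕ → Tm) (ρ : ℕ → ℕ) (t : ℕ) (c : Tm) :
    (inTree t c).subst σ ρ = inTree (ρ t) (c.subst σ ρ) := by
  simp only [inTree, Fm.subst, subst_ne, Tm.subst, Tm.subst_ancestor, Tm.shift_one_subst_up]; rfl

end Fm

/-! ### Quantifier-free formulas and truth conditions -/

namespace Fm

theorem qf_eq (a b : Tm) : (eq a b).QF ↔ True := Iff.rfl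

theorem qf_and (φ ψ : Fm) : (and φ ψ).QF ↔ φ.QF ∧ ψ.QF := Iff.rfl

theorem qf_or (φ ψ : Fm) : (or φ ψ).QF ↔ φ.QF ∧ ψ.QF := Iff.rfl

theorem qf_imp (φ ψ : Fm) : (imp φ ψ).QF ↔ φ.QF ∧ ψ.QF := Iff.rfl

theorem qf_neg (φ : Fm) : (neg φ).QF ↔ φ.QF := ⟨fun h => h.1, fun h => ⟨h, trivial⟩⟩

theorem qf_iff (φ ψ : Fm) : (iff φ ψ).QF ↔ φ.QF ∧ ψ.QF :=
  ⟨fun h => h.1, fun h => ⟨h, h.symm⟩⟩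

theorem qf_ball (b : Tm) (φ : Fm) : (ball b φ).QF ↔ True := Iff.rfl

theorem qf_bex (b : Tm) (φ : Fm) : (bex b φ).QF ↔ True := iff_true_intro (QF.bex b φ)

theorem qf_le (a b : Tm) : (le a b).QF ↔ True := Iff.rfl

theorem qf_lt (a b : Tm) : (lt a b).QF ↔ True := Iff.rfl

theorem qf_ne (a b : Tm) : (ne a b).QF ↔ True := iff_true_intro ⟨trivial, trivial⟩

theorem qf_edge (e : ℕ) (i a b : Tm) : (edge e i a b).QF ↔ True := qf_ne _ _

theorem qf_hasLength (c m : Tm) : (hasLength c m).QF ↔ True := iff_true_intro ⟨trivial, trivial⟩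

attribute [simp] qf_eq qf_and qf_or qf_imp qf_neg qf_iff qf_ball qf_bex qf_le qf_lt qf_ne
  qf_edge qf_hasLength

end Fm

namespace Mod

variable {M : Mod} (env : ℕ → M.C)

theorem sat_le (a b : Tm) : sat env (.le a b) ↔ eval env a ≤ eval env b := by
  rw [Fm.le, sat, eval_sub, eval_zero]; exact Iff.rfl

theorem sat_lt (a b : Tm) : sat env (.lt a b) ↔ eval env a < eval env b := by
  rw [Fm.lt, sat_le, eval_succ]; exact Iff.rfl

theorem sat_ne (a b : Tm) : sat env (.ne a b) ↔ eval env a ≠ eval env b := Iff.rfl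

theorem sat_neg (φ : Fm) : sat env (.neg φ) ↔ ¬ sat env φ := Iff.rfl

theorem sat_eq (a b : Tm) : sat env (.eq a b) ↔ eval env a = eval env b := Iff.rfl

theorem sat_and (φ ψ : Fm) : sat env (.and φ ψ) ↔ sat env φ ∧ sat env ψ := Iff.rfl

theorem sat_or (φ ψ : Fm) : sat env (.or φ ψ) ↔ sat env φ ∨ sat env ψ := Iff.rfl

theorem sat_imp (φ ψ : Fm) : sat env (.imp φ ψ) ↔ (sat env φ → sat env ψ) := Iff.rfl

theorem sat_allN (φ : Fm) : sat env (.allN φ) ↔ ∀ x, sat (scons x env) φ := Iff.rfl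

theorem sat_exN (φ : Fm) : sat env (.exN φ) ↔ ∃ x, sat (scons x env) φ := Iff.rfl

theorem sat_iff (φ ψ : Fm) : sat env (.iff φ ψ) ↔ (sat env φ ↔ sat env ψ) :=
  iff_iff_implies_and_implies.symm

theorem sat_edge (e : ℕ) (i a b : Tm) : sat env (.edge e i a b) ↔
    fn e (pr (eval env i) (ec (eval env a) (eval env b))) ≠ 0 := by
  simp only [Fm.edge, sat_ne, eval_app, eval_pair, eval_edgeCode, eval_zero]

theorem sat_inTree (t : ℕ) (c : Tm) :
    sat env (.inTree t c) ↔ ∀ j, fn t (anc (eval env c) j) ≠ 0 := by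
  simp only [Fm.inTree, sat_allN, sat_ne, eval_app, eval_ancestor, eval_shift, eval_var, eval_zero]
  rfl

attribute [simp] sat_le sat_lt sat_ne sat_neg sat_eq sat_and sat_or sat_imp sat_allN sat_exN
  sat_iff sat_edge sat_inTree sat_hasLength

end Mod

/-- The chosen function becomes function variable `0`, and its defining property is replaced by a
consequence `N` that need only be checked in models. The primed data are the syntactic shifts under
the new function variable, supplied in simplified form. -/
theorem Prov.choice_to {Γ Γ' : List Fm} {φ φ' N ψ ψ' : Fm} (hφ : φ.QF)
    (h : Prov Γ (.allN (.exN φ))) (hφ' : φ.shiftF = φ') (hΓ' : Γ.map Fm.shiftF = Γ')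
    (hψ : ψ.shiftF = ψ') (hN : N.Goal)
    (hN' : ∀ (M : Mod) (env : ℕ → M.C),
      (∀ x, Mod.sat (scons (Mod.fn 0 x) (scons x env)) φ') → Mod.sat env N)
    (hs : Prov (N :: Γ') ψ') : Prov Γ ψ := by
  refine Prov.choice hφ h ?_
  rw [hΓ', hψ]
  refine .impE (.impI (hs.mono ?_)) (complete hN fun M env h' => hN' M env fun x => ?_)
  · exact List.cons_subset_cons _ (List.subset_cons_self _ _)
  · have h1 := h' _ List.mem_cons_self ((hφ.subst _ _).univ) x
    rw [show φ.subst (scons (Tm.app 0 (var 0)) (scons (var 0) fun n => var (n + 1))) Nat.succ =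
      φ'.subst (scons (Tm.app 0 (var 0)) (scons (var 0) fun n => var (n + 1))) id by
        rw [← hφ', Fm.shiftF, Fm.subst_subst]; rfl, Mod.sat_subst] at h1
    convert h1 using 1
    funext i
    rcases i with _ | _ | i
    · simp
    · simp
    · simp

open Tm (var one two pair edgeCode digit ancestor initSeg)

/-! ## Weak König's Lemma implies the coloring principle -/

namespace Fm

/-- The number `s` codes a coloring of the graph `i` up to `m`. -/
def isCode (k : Tm) (e : ℕ) (i m s : Tm) : Fm :=
  allN (allN (imp (lt (var 0) (var 1)) (imp (le (var 1) (m.shift 2 0))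
    (imp (edge e (i.shift 2 0) (var 0) (var 1))
      (ne (digit (k.shift 2 0) (s.shift 2 0) (var 0))
        (digit (k.shift 2 0) (s.shift 2 0) (var 1)))))))

/-- All graphs are locally colorable with `k + 2` colors for the number variable `k`. -/
def locallyColorable (e k : ℕ) : Fm :=
  allN (allN (colorableUpTo (var (k + 2)) e (var 1) (var 0)))

/-- The number `s` codes a coloring of the graph `i` up to `m`, where `x` codes the pair of `i`
and `m`, with `s`, `x` and `k` as number variables `0`, `1` and `2`. -/
def codeChoice (e : ℕ) : Fm :=
  ball (.succ (var 1)) (ball (.succ (var 2)) (imp (eq (var 3) (pair (var 1) (var 0)))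
    (ball (.succ (var 0)) (ball (var 0) (imp (edge e (var 3) (var 0) (var 1))
      (ne (digit (var 6) (var 4) (var 0)) (digit (var 6) (var 4) (var 1))))))))

/-- The function `S` provides codes of colorings. -/
def codes (S e k : ℕ) : Fm :=
  allN (allN (isCode (var (k + 2)) e (var 1) (var 0) (.app S (pair (var 1) (var 0)))))

/-- The bit of the sequence `c` of length `l` at place `x` is `1`. -/
def bit (c l x : Tm) : Fm :=
  eq (ancestor c (.sub l (.succ x))) (.succ (.succ (.mul two (ancestor c (.sub l x)))))

/-- The sequence in number variable `c` codes a partial coloring of all graphs: the bit at the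
place of `((i, a), j)` tells whether the color of `a` in the graph `i` is `j`. -/
def partialColoring (e c k : ℕ) : Fm :=
  ball (.succ (var c)) (imp (hasLength (var (c + 1)) (var 0)) (and
    (ball (var 0) (ball (var 1) (ball (var 2) (ball (var (k + 4))
      (imp (lt (var 2) (var 3)) (imp (edge e (var 1) (var 2) (var 3))
        (imp (lt (pair (pair (var 1) (var 2)) (var 0)) (var 4))
        (imp (lt (pair (pair (var 1) (var 3)) (var 0)) (var 4))
        (imp (bit (var (c + 5)) (var 4) (pair (pair (var 1) (var 2)) (var 0)))
        (neg (bit (var (c + 5)) (var 4) (pair (pair (var 1) (var 3)) (var 0)))))))))))))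
    -- The places `(y, j)` with `j < k` precede `(y, k)`, so a length of at least that code means
    -- that all colors of `y` have been decided. More than one of them may be allowed.
    (ball (var 0) (imp (le (pair (var 0) (var (k + 2))) (var 1))
      (bex (var (k + 2)) (bit (var (c + 3)) (var 2) (pair (var 1) (var 0))))))))

/-- The tree `t` consists of partial colorings. -/
def coloringTree (t e k : ℕ) : Fm :=
  allN (iff (ne (.app t (var 0)) .zero) (partialColoring e 0 (k + 1)))

/-- The bit `0` at place `1` of the sequence of colorings coded by `S` up to `2`, for `3` colors
(numbers of variables). -/
def bitChoice (S : ℕ) : Fm :=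
  and (lt (var 0) two) (iff (eq (var 0) one) (bex (.succ (var 1)) (bex (.succ (var 2))
    (bex (.succ (var 3)) (and (eq (var 4) (pair (pair (var 2) (var 1)) (var 0)))
      (eq (var 0) (digit (var 6) (.app S (pair (var 2) (var 5))) (var 1))))))))

/-- The function `q` gives the bits of the colorings coded by `S` up to number variable `0`. -/
def bits (q S : ℕ) : Fm :=
  and (allN (lt (.app q (var 0)) two)) (allN (allN (allN
    (iff (eq (.app q (pair (pair (var 2) (var 1)) (var 0))) one)
      (eq (var 0) (digit (var 4) (.app S (pair (var 2) (var 3))) (var 1)))))))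

/-- The function `p` is a path in the tree `t`. -/
def isPath (p t : ℕ) : Fm :=
  and (allN (lt (.app p (var 0)) two)) (allN (inTree t (initSeg p (var 0))))

/-- The color `0` of the vertex code `1`, read from the path `p`. -/
def colorChoice (p : ℕ) : Fm :=
  and (lt (var 0) (var 2)) (eq (.app p (pair (var 1) (var 0))) one)

/-- The function `f` reads colors from the path `p`. -/
def colors (f p : ℕ) : Fm :=
  allN (and (lt (.app f (var 0)) (var 1)) (eq (.app p (pair (var 0) (.app f (var 0)))) one))

theorem qf_bit (c l x : Tm) : (bit c l x).QF ↔ True := Iff.rfl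

theorem qf_partialColoring (e c k : ℕ) : (partialColoring e c k).QF ↔ True := Iff.rfl

attribute [simp] qf_bit qf_partialColoring

theorem coloringTree_univ (t e k : ℕ) : (coloringTree t e k).Univ :=
  ⟨⟨⟨trivial, trivial⟩, trivial⟩, trivial, trivial, trivial⟩

theorem isCode_univ (k : Tm) (e : ℕ) (i m s : Tm) : (isCode k e i m s).Univ :=
  ⟨trivial, trivial, QF.univ (by simp)⟩

theorem subst_bit (σ : ℕ → Tm) (ρ : ℕ → ℕ) (c l x : Tm) :
    (Fm.bit c l x).subst σ ρ = Fm.bit (c.subst σ ρ) (l.subst σ ρ) (x.subst σ ρ) := by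
  simp only [Fm.bit, Fm.subst, Tm.subst, Tm.subst_ancestor, Tm.subst_sub, Tm.subst_mul,
    Tm.shiftF_two]

theorem neg_subst (σ : ℕ → Tm) (ρ : ℕ → ℕ) (φ : Fm) : (neg φ).subst σ ρ = neg (φ.subst σ ρ) := rfl

theorem shiftF_partialColoring (e c k : ℕ) :
    (Fm.partialColoring e c k).shiftF = Fm.partialColoring (e + 1) c k := by
  simp only [Fm.partialColoring, shiftF, subst_ball, subst_bex, Fm.subst, subst_lt, subst_le,
    subst_edge, subst_hasLength, neg_subst, subst_bit, Tm.subst_pair, Tm.subst, Tm.up_var]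

end Fm

/-! ### Partial colorings in models -/

namespace Mod

variable {M : Mod}

/-- The bit of the sequence `c` of length `l` at place `x` is `1`. -/
def Bit (c l x : M.C) : Prop := anc c (l - (x + 1)) = 2 * anc c (l - x) + 1 + 1

theorem sat_bit (env : ℕ → M.C) (c l x : Tm) :
    sat env (.bit c l x) ↔ Bit (eval env c) (eval env l) (eval env x) := by
  simp [Fm.bit, Bit]

/-- The sequence `c` codes a partial coloring of all graphs. -/
def PartialColoring (e : ℕ) (k c : M.C) : Prop :=
  ∀ l < c + 1, HL c l → (∀ b < l, ∀ a < l, ∀ i < l, ∀ j < k, a < b → fn e (pr i (ec a b)) ≠ 0 →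
    pr (pr i a) j < l → pr (pr i b) j < l → Bit c l (pr (pr i a) j) → ¬ Bit c l (pr (pr i b) j)) ∧
    ∀ y < l, pr y k ≤ l → ∃ j < k, Bit c l (pr y j)

theorem sat_partialColoring (env : ℕ → M.C) (e c k : ℕ) :
    sat env (.partialColoring e c k) ↔ PartialColoring e (env k) (env c) := by
  simp [Fm.partialColoring, sat_ball, sat_bex, sat_bit, PartialColoring]


theorem sat_isCode (env : ℕ → M.C) (k : Tm) (e : ℕ) (i m s : Tm) :
    sat env (.isCode k e i m s) ↔ ∀ b a, a < b → b ≤ eval env m →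
      fn e (pr (eval env i) (ec a b)) ≠ 0 →
      rm (qo (eval env s) (pw (eval env k) a)) (eval env k) ≠
        rm (qo (eval env s) (pw (eval env k) b)) (eval env k) := by
  simp [Fm.isCode, eval_shift]

theorem bit_seg {p : ℕ} {l x : M.C} (hp : ∀ x < l, fn p x < 2) (hx : x < l) :
    Bit (seg p l) l x ↔ fn p x = 1 := by
  rw [Bit, anc_seg hp, anc_seg hp, tsub_tsub_cancel_of_le hx.le,
    tsub_tsub_cancel_of_le (lt_def.1 hx), seg_add_one, add_left_inj, add_right_inj]

/-- The initial segments of the sequence of bits of colorings are partial colorings. -/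
theorem partialColoring_seg {e S q : ℕ} {k m : M.C} (hk : 0 < k)
    (hS : ∀ i b a, a < b → b ≤ m → fn e (pr i (ec a b)) ≠ 0 →
      rm (qo (fn S (pr i m)) (pw k a)) k ≠ rm (qo (fn S (pr i m)) (pw k b)) k)
    (hq : ∀ x : M.C, fn q x < 2) (hqb : ∀ i n j, fn q (pr (pr i n) j) = 1 ↔
      j = rm (qo (fn S (pr i m)) (pw k n)) k) {n : M.C} (hn : n ≤ m) :
    PartialColoring e k (seg q n) := by
  intro l _ hl
  obtain rfl := hl.unique (HL.seg fun x _ => hq x)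
  constructor
  · intro b hb a _ i _ j _ hab he hja hjb h1 h2
    rw [bit_seg (fun x _ => hq x) hja, hqb] at h1
    rw [bit_seg (fun x _ => hq x) hjb, hqb] at h2
    exact hS i b a hab (hb.le.trans hn) he (h1.symm.trans h2)
  · intro y _ hyk
    obtain ⟨i, a, rfl⟩ := exists_pr y
    have hj := rm_lt (qo (fn S (pr i m)) (pw k a)) hk
    refine ⟨_, hj, ?_⟩
    rw [bit_seg (fun x _ => hq x) ((pr_lt_pr _ hj).trans_le hyk), hqb]

/-- Every vertex code receives a color on a path of partial colorings. -/
theorem exists_color {e p : ℕ} {k : M.C} (hp : ∀ x : M.C, fn p x < 2)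
    (ht : ∀ m, PartialColoring e k (seg p m)) (y : M.C) : ∃ j < k, fn p (pr y j) = 1 := by
  -- The extra one puts `y` itself below the length, as the bounded quantifier requires.
  have hl := HL.seg (p := p) (m := pr y k + 1) fun x _ => hp x
  obtain ⟨j, hj, h⟩ := (ht _ _ (lt_add_one_iff.2 hl.le) hl).2 y
    (lt_add_one_iff.2 (le_pr_left y k)) le_self_add
  refine ⟨j, hj, ?_⟩
  rwa [bit_seg (fun x _ => hp x) ((pr_lt_pr y hj).trans (lt_add_one_iff.2 le_rfl))] at h

/-- Colors read from a path of partial colorings differ on edges. -/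
theorem color_ne {e p : ℕ} {k : M.C} (hp : ∀ x : M.C, fn p x < 2)
    (ht : ∀ m, PartialColoring e k (seg p m)) {i a b j : M.C} (hj : j < k) (hab : a < b)
    (he : fn e (pr i (ec a b)) ≠ 0) (ha : fn p (pr (pr i a) j) = 1) :
    fn p (pr (pr i b) j) ≠ 1 := by
  intro hb
  -- A length beyond both places makes both bits, and hence the conflict, visible.
  set l := pr (pr i a) j + pr (pr i b) j + 1
  have hl := HL.seg (p := p) (m := l) fun x _ => hp x
  have h1 : pr (pr i a) j < l := lt_add_one_iff.2 le_self_add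
  have h2 : pr (pr i b) j < l := lt_add_one_iff.2 le_add_self
  have h3 := (le_pr_left (pr i b) j).trans_lt h2
  have h4 := (le_pr_left (pr i a) j).trans_lt h1
  refine (ht _ _ (lt_add_one_iff.2 hl.le) hl).1 b ((le_pr_right i b).trans_lt h3) a
    ((le_pr_right i a).trans_lt h4) i ((le_pr_left i b).trans_lt h3) j
    hj hab he h1 h2 ?_ ?_
  · rwa [bit_seg (fun x _ => hp x) h1]
  · rwa [bit_seg (fun x _ => hp x) h2]

end Mod

/-! ### Derivation of the coloring principle -/

theorem Mod.sat_head {M : Mod} {env : ℕ → M.C} {φ : Fm} {Γ : List Fm}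
    (h : ∀ ψ ∈ φ :: Γ, ψ.Univ → Mod.sat env ψ) (hφ : φ.Univ) : Mod.sat env φ :=
  h φ List.mem_cons_self hφ

theorem Mod.sat_tail {M : Mod} {env : ℕ → M.C} {φ : Fm} {Γ : List Fm}
    (h : ∀ ψ ∈ φ :: Γ, ψ.Univ → Mod.sat env ψ) : ∀ ψ ∈ Γ, ψ.Univ → Mod.sat env ψ :=
  fun ψ hψ => h ψ (List.mem_cons_of_mem _ hψ)

theorem codeChoice_shiftF (e : ℕ) : (Fm.codeChoice e).shiftF = Fm.codeChoice (e + 1) := by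
  simp only [Fm.codeChoice, Fm.shiftF, Fm.subst_ball, Fm.subst, Fm.subst_ne,
    Fm.subst_edge, Tm.subst_pair, Tm.subst_digit, Tm.subst, Tm.up_var]

theorem bitChoice_shiftF (S : ℕ) : (Fm.bitChoice S).shiftF = Fm.bitChoice (S + 1) := by
  simp only [Fm.bitChoice, Fm.shiftF, Fm.subst_bex, Fm.subst, Fm.subst_lt, Fm.subst_iff,
    Tm.subst_pair, Tm.subst_digit, Tm.subst, Tm.up_var, Tm.shiftF_one, Tm.shiftF_two]

theorem coloringTree_shiftF (t e k : ℕ) :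
    (Fm.coloringTree t e k).shiftF = Fm.coloringTree (t + 1) (e + 1) k := by
  have := Fm.shiftF_partialColoring e 0 (k + 1)
  simp only [Fm.coloringTree, Fm.shiftF, Fm.subst, Fm.subst_ne, Fm.subst_iff, Tm.subst,
    Tm.up_var] at this ⊢
  rw [this]

theorem coloringTree_shiftN (t e k : ℕ) :
    (Fm.coloringTree t e k).shiftN = Fm.coloringTree t e (k + 1) := by
  simp only [Fm.coloringTree, Fm.shiftN, Fm.partialColoring, Fm.subst_ball, Fm.subst_bex, Fm.subst,
    Fm.subst_ne, Fm.subst_iff, Fm.subst_lt, Fm.subst_le, Fm.subst_edge, Fm.subst_hasLength,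
    Fm.neg_subst, Fm.subst_bit, Tm.subst_pair, Tm.subst]
  rfl

theorem Mod.sat_codeChoice {M : Mod} (env : ℕ → M.C) (e : ℕ) :
    Mod.sat env (Fm.codeChoice e) ↔ ∀ i < env 1 + 1, ∀ m < env 1 + 1,
      env 1 = Mod.pr i m → ∀ b < m + 1, ∀ a < b, Mod.fn e (Mod.pr i (Mod.ec a b)) ≠ 0 →
      Mod.rm (Mod.qo (env 0) (Mod.pw (env 2) a)) (env 2) ≠
        Mod.rm (Mod.qo (env 0) (Mod.pw (env 2) b)) (env 2) := by
  simp [Fm.codeChoice, Mod.sat_ball]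

/-- Local colorability is existential, hence unusable through truth in models; its instance at the
decoded pair is eliminated in the calculus, and only the remaining universal statement is
transferred. -/
theorem prov_exists_code :
    Prov [Fm.locallyColorable 0 0, Fm.WKL, .le two (var 0)] (.allN (.exN (Fm.codeChoice 0))) := by
  refine .allNI ?_
  have h0 : Prov [Fm.locallyColorable 0 1, Fm.WKL, .le two (var 1)]
      (.exN (.exN (.eq (var 2) (pair (var 1) (var 0))))) := complete trivial fun M env _ => by
    obtain ⟨i, m, h⟩ := Mod.exists_pr (env 0)
    exact ⟨i, m, by simpa using h⟩
  refine .exNE h0 ?_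
  refine .exNE (φ := .eq (var 2) (pair (var 1) (var 0))) (.hyp (.head _)) ?_
  have h1 : Prov [.eq (var 2) (pair (var 1) (var 0)),
      .exN (.eq (var 3) (pair (var 2) (var 0))), Fm.locallyColorable 0 3, Fm.WKL, .le two (var 3)]
      (Fm.locallyColorable 0 3) := .hyp (.tail _ (.tail _ (.head _)))
  have h2 : Prov _ (Fm.colorableUpTo (var 3) 0 (var 1) (var 0)) :=
    .allNE (var 0) (.allNE (var 1) h1)
  refine .exNE h2 (.exNI (var 0) (complete trivial fun M env h => ?_))
  have hA : Mod.sat env (Fm.isCode (var 4) 0 (var 2) (var 1) (var 0)) :=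
    Mod.sat_head h (Fm.isCode_univ _ _ _ _ _)
  have hB : Mod.sat env (.eq (var 3) (pair (var 2) (var 1))) :=
    Mod.sat_head (Mod.sat_tail h) trivial
  rw [Mod.sat_isCode] at hA
  simp only [Mod.sat_eq, Mod.eval_pair, Mod.eval_var] at hA hB
  simp only [Mod.sat_instN, Mod.sat_subst, Mod.sat_codeChoice, Tm.up, Tm.shift, Tm.rename,
    Mod.eval_var, scons, Nat.reduceAdd]
  intro i _ m _ hx b hb a hab he
  obtain ⟨rfl, rfl⟩ := Mod.pr_inj (hB.symm.trans hx)
  exact hA b a hab (Mod.lt_add_one_iff.1 hb) he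

open Tm (var one two pair edgeCode digit ancestor initSeg)

theorem Fm.QF.exis {φ : Fm} (h : φ.QF) : φ.Exis := by
  induction φ <;> simp_all [QF, Exis]

theorem Fm.QF.goal {φ : Fm} (h : φ.QF) : φ.Goal := by
  induction φ <;> simp_all [QF, Goal, QF.exis, QF.univ, Exis]

/-- The sequence of graphs `e` has a sequence of colorings. -/
def Fm.hasColoring (e : ℕ) : Fm := exF (allN (isColoring (var 1) (e + 1) (var 0) 0))

theorem Fm.codes_shiftF (S e k : ℕ) : (codes S e k).shiftF = codes (S + 1) (e + 1) k := by
  simp only [codes, isCode, shiftF, subst, subst_lt, subst_le, subst_edge, subst_ne,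
    Tm.subst_digit, Tm.subst, Tm.up_var, Tm.shift, Tm.rename, pair, edgeCode, Tm.tri, Tm.add]

theorem Fm.codes_shiftN (S e k : ℕ) : (codes S e k).shiftN = codes S e (k + 1) := by
  simp only [codes, isCode, shiftN, subst, subst_lt, subst_le, subst_edge, subst_ne,
    Tm.subst_digit, Tm.subst, Tm.shift, Tm.rename]
  rfl

theorem Fm.isPath_shiftF (p t : ℕ) : (isPath p t).shiftF = isPath (p + 1) (t + 1) := by
  simp only [isPath, shiftF, subst, subst_lt, subst_inTree, Tm.subst, Tm.up_var]
  rfl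

theorem Fm.codes_univ (S e k : ℕ) : (codes S e k).Univ :=
  isCode_univ _ _ _ _ _

theorem Fm.codes_goal (S e k : ℕ) : (codes S e k).Goal :=
  ⟨trivial, trivial, QF.goal (by simp)⟩

theorem Fm.bits_univ (q S : ℕ) : (bits q S).Univ :=
  ⟨trivial, ⟨trivial, trivial⟩, trivial, trivial⟩

theorem Fm.isPath_univ (p t : ℕ) : (isPath p t).Univ :=
  ⟨trivial, trivial, trivial⟩

namespace Mod

variable {M : Mod} (env : ℕ → M.C)

theorem sat_codes (S e k : ℕ) : sat env (.codes S e k) ↔ ∀ i m b a, a < b → b ≤ m →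
    fn e (pr i (ec a b)) ≠ 0 → rm (qo (fn S (pr i m)) (pw (env k) a)) (env k) ≠
      rm (qo (fn S (pr i m)) (pw (env k) b)) (env k) := by
  simp [Fm.codes, sat_isCode]

theorem sat_coloringTree (t e k : ℕ) :
    sat env (.coloringTree t e k) ↔ ∀ c, fn t c ≠ 0 ↔ PartialColoring e (env k) c := by
  simp [Fm.coloringTree, sat_partialColoring]

theorem sat_bitChoice (S : ℕ) : sat env (.bitChoice S) ↔ env 0 < 2 ∧ (env 0 = 1 ↔
    ∃ i < env 1 + 1, ∃ n < env 1 + 1, ∃ j < env 1 + 1, env 1 = pr (pr i n) j ∧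
      j = rm (qo (fn S (pr i (env 2))) (pw (env 3) n)) (env 3)) := by
  simp [Fm.bitChoice, sat_bex]

theorem sat_bits (q S : ℕ) : sat env (.bits q S) ↔ (∀ x : M.C, fn q x < 2) ∧
    ∀ i n j, fn q (pr (pr i n) j) = 1 ↔
      j = rm (qo (fn S (pr i (env 0))) (pw (env 1) n)) (env 1) := by
  simp [Fm.bits]

theorem sat_isPath (p t : ℕ) : sat env (.isPath p t) ↔ (∀ x : M.C, fn p x < 2) ∧
    ∀ m j : M.C, fn t (anc (seg p m) j) ≠ 0 := by
  simp [Fm.isPath]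

theorem sat_colors (f p : ℕ) : sat env (.colors f p) ↔
    ∀ y, fn f y < env 0 ∧ fn p (pr y (fn f y)) = 1 := by
  simp [Fm.colors]

end Mod

-- The witness is the initial segment of length `m` of the bits obtained from colorings up to `m`;
-- its ancestors are shorter initial segments, all of them partial colorings.
open IRCA.Mod in
theorem prov_exists_long :
    Prov [Fm.bits 0 2, Fm.coloringTree 1 3 1, Fm.codes 2 3 1, .le two (var 1)]
      (.exN (.and (.hasLength (var 0) (var 1)) (Fm.inTree 1 (var 0)))) := by
  refine .exNI (initSeg 0 (var 0)) (complete ⟨⟨trivial, trivial⟩, ⟨trivial, trivial⟩⟩ ?_)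
  intro M env h
  have h1 := (sat_bits env _ _).1 (h _ (.head _) (Fm.bits_univ _ _))
  have h2 := (sat_coloringTree env _ _ _).1 (h _ (.tail _ (.head _)) (Fm.coloringTree_univ _ _ _))
  have h3 := (sat_codes env _ _ _).1 (h _ (.tail _ (.tail _ (.head _))) (Fm.codes_univ _ _ _))
  have h4 := h _ (.tail _ (.tail _ (.tail _ (.head _)))) trivial
  simp only [sat_le, eval_two, eval_var] at h4
  simp only [sat_instN, sat_and, sat_hasLength, sat_inTree, eval_var, scons_zero, scons_succ,
    eval_initSeg]
  refine ⟨HL.seg fun x _ => h1.1 x, fun j => ?_⟩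
  rw [anc_seg fun x _ => h1.1 x, h2]
  exact partialColoring_seg ((pos_iff_ne_zero.2 two_ne_zero).trans_le h4)
    (fun i b a hab hb he => h3 i _ b a hab hb he) h1.1 h1.2 tsub_le_self

-- For each fixed `m`, the bits of all the colorings `S(i, m)` are assembled into one auxiliary
-- function by choice; the bounded search for the components of a place keeps the choice formula
-- quantifier free.
open IRCA.Mod in
theorem prov_long :
    Prov [Fm.coloringTree 0 2 0, Fm.codes 1 2 0, Fm.WKL, .le two (var 0)]
      (.allN (.exN (.and (.hasLength (var 0) (var 1)) (Fm.inTree 0 (var 0))))) := by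
  refine .allNI ?_
  have hs : Prov [Fm.coloringTree 0 2 1, Fm.codes 1 2 1, .le two (var 1)]
      (.exN (.and (.hasLength (var 0) (var 1)) (Fm.inTree 0 (var 0)))) := by
    refine Prov.choice_to (φ := Fm.bitChoice 1) (N := Fm.bits 0 2) (by simp [Fm.bitChoice]) ?_
      (bitChoice_shiftF 1) rfl rfl ⟨trivial, ⟨trivial, trivial⟩, trivial, trivial⟩ ?_ ?_
    · refine complete ⟨trivial, ⟨trivial, trivial, trivial⟩, ⟨trivial, trivial⟩, trivial⟩
        fun M env _ x => ?_
      simp only [sat_exN, sat_bitChoice, scons_zero, scons_succ]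
      by_cases hx : ∃ i < x + 1, ∃ n < x + 1, ∃ j < x + 1, x = pr (pr i n) j ∧
          j = rm (qo (fn 1 (pr i (env 0))) (pw (env 1) n)) (env 1)
      · exact ⟨1, one_lt_two', iff_of_true rfl hx⟩
      · exact ⟨0, pos_iff_ne_zero.2 two_ne_zero, iff_of_false zero_ne_one hx⟩
    · intro M env h
      simp only [sat_bitChoice, scons_zero, scons_succ] at h
      rw [sat_bits]
      refine ⟨fun x => (h x).1, fun i n j => (h _).2.trans ⟨?_, fun hj => ?_⟩⟩
      · rintro ⟨i', _, n', _, j', _, hx, hj⟩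
        obtain ⟨h1, rfl⟩ := pr_inj hx
        obtain ⟨rfl, rfl⟩ := pr_inj h1
        exact hj
      · have h1 := le_pr_left (pr i n) j
        exact ⟨i, lt_add_one_iff.2 ((le_pr_left i n).trans h1), n,
          lt_add_one_iff.2 ((le_pr_right i n).trans h1), j,
          lt_add_one_iff.2 (le_pr_right _ j), rfl, hj⟩
    · refine prov_exists_long.mono ?_
      rw [← coloringTree_shiftF, ← Fm.codes_shiftF]
      exact List.Subset.refl _
  refine hs.mono ?_
  rw [← coloringTree_shiftN, ← Fm.codes_shiftN]
  change [(Fm.coloringTree 0 2 0).shiftN, (Fm.codes 1 2 0).shiftN, Fm.le two (var 1)] ⊆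
    [(Fm.coloringTree 0 2 0).shiftN, (Fm.codes 1 2 0).shiftN, Fm.WKL, Fm.le two (var 1)]
  simp

-- A path may allow several colors at a vertex. Choice selects any one of them, which suffices
-- because adjacent vertices have no allowed color in common.
open IRCA.Mod in
theorem prov_hasColoring_of_path :
    Prov [Fm.isPath 0 1, Fm.coloringTree 1 3 0] (Fm.hasColoring 3) := by
  refine Prov.choice_to (φ := Fm.colorChoice 0) (N := Fm.colors 0 1) ⟨trivial, trivial⟩ ?_
    (φ' := Fm.colorChoice 1) rfl rfl rfl ⟨trivial, trivial⟩ ?_ (ψ' := Fm.hasColoring 4) ?_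
  · refine complete ⟨trivial, trivial⟩ fun M env h x => ?_
    have h1 := (sat_isPath env _ _).1 (h _ (.head _) (Fm.isPath_univ _ _))
    have h2 := (sat_coloringTree env _ _ _).1
      (h _ (.tail _ (.head _)) (Fm.coloringTree_univ _ _ _))
    obtain ⟨j, hj⟩ := exists_color h1.1 (fun m => (h2 _).1 (by simpa using h1.2 m 0)) x
    exact ⟨j, by simpa [Fm.colorChoice] using hj⟩
  · intro M env h
    rw [sat_colors]
    simpa only [Fm.colorChoice, sat_and, sat_lt, sat_eq, eval_var, eval_app, eval_pair, eval_one,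
      scons_zero, scons_succ, scons] using h
  · rw [List.map_cons, List.map_cons, List.map_nil, Fm.isPath_shiftF, coloringTree_shiftF]
    refine .exFI 0 (complete (χ := .allN (Fm.isColoring (var 1) 4 (var 0) 0))
      ⟨trivial, trivial, Fm.QF.univ (by simp), trivial, trivial⟩ ?_)
    intro M env h i
    have h0 := (sat_colors env _ _).1 (h _ (.head _) ⟨trivial, trivial⟩)
    have h1 := (sat_isPath env _ _).1 (h _ (.tail _ (.head _)) (Fm.isPath_univ _ _))
    have h2 := (sat_coloringTree env _ _ _).1
      (h _ (.tail _ (.tail _ (.head _))) (Fm.coloringTree_univ _ _ _))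
    have h3 (m : M.C) := (h2 _).1 (by simpa using h1.2 m 0)
    simp only [Fm.isColoring, sat_and, sat_allN, sat_imp, sat_lt, sat_ne, sat_edge, eval_app,
      eval_pair, eval_shift, eval_var, scons_zero, scons_succ]
    refine ⟨fun a => (h0 _).1, fun b a hab he hf => ?_⟩
    have h4 := h0 (pr i b)
    refine color_ne h1.1 h3 (h0 (pr i a)).1 hab he (h0 (pr i a)).2 ?_
    have h5 : fn 0 (pr i a) = fn 0 (pr i b) := hf
    rw [h5]
    exact h4.2

open IRCA.Mod in
/-- Weak König's Lemma implies the coloring principle. -/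
theorem prov_seqColoring_of_wkl :
    Prov [Fm.WKL, .le two (var 0)] (Fm.seqColoring (var 0)) := by
  refine .allFI (.impI ?_)
  -- This choice provides `S`, coding a coloring of the graph `i` up to `m` at the pair `(i, m)`.
  refine Prov.choice_to (N := Fm.codes 0 1 0) (ψ := Fm.hasColoring 0) (by simp [Fm.codeChoice])
    prov_exists_code (codeChoice_shiftF 0) rfl rfl (Fm.codes_goal _ _ _) ?_
    (ψ' := Fm.hasColoring 1) ?_
  · intro M env h
    simp only [sat_codeChoice, scons_zero, scons_succ] at h
    rw [sat_codes]
    intro i m b a hab hb he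
    exact h (pr i m) i (lt_add_one_iff.2 (le_pr_left i m)) m (lt_add_one_iff.2 (le_pr_right i m)) rfl b
      (lt_add_one_iff.2 hb) a hab he
  have hq : (Fm.iff (.ne (var 0) .zero) (Fm.partialColoring 1 1 2)).QF := by simp
  have hq' : (Fm.iff (.ne (.app 0 (var 0)) .zero) (Fm.partialColoring 2 0 1)).QF := by simp
  -- This choice provides the tree, as a function that is nonzero exactly at the partial colorings.
  refine Prov.choice_to (N := Fm.coloringTree 0 2 0) (ψ := Fm.hasColoring 1)
    (φ' := .iff (.ne (var 0) .zero) (Fm.partialColoring 2 1 2))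
    hq ?_ ?_ rfl rfl hq'.goal ?_ (ψ' := Fm.hasColoring 2) ?_
  · refine complete hq.exis fun M env _ x => ?_
    simp only [sat_exN, sat_iff, sat_ne, sat_partialColoring, eval_var, eval_zero, scons_zero,
      scons_succ]
    by_cases hx : PartialColoring 1 (env 0) x
    · exact ⟨1, iff_of_true one_ne_zero hx⟩
    · exact ⟨0, iff_of_false (· rfl) hx⟩
  · have h := Fm.shiftF_partialColoring 1 1 2
    simp only [Fm.shiftF] at h
    simp only [Fm.shiftF, Fm.subst_iff, Fm.subst_ne, Tm.subst, h]
  · intro M env h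
    simp only [sat_iff, sat_ne, sat_partialColoring, eval_var, eval_zero, scons_zero,
      scons_succ] at h
    exact (sat_coloringTree _ _ _ _).2 h
  rw [List.map_cons, Fm.codes_shiftF]
  have hW : Prov [Fm.coloringTree 0 2 0, Fm.codes 1 2 0, Fm.locallyColorable 2 0, Fm.WKL,
      .le two (var 0)] (.exF (Fm.isPath 0 1)) := by
    refine .impE (.allFE 0 (.hyp (.tail _ (.tail _ (.tail _ (.head _)))))) (prov_long.mono ?_)
    simp
  refine .exFE hW ((prov_hasColoring_of_path).mono ?_)
  rw [List.map_cons, coloringTree_shiftF]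
  simp

open Tm (var one two pair edgeCode digit ancestor initSeg)

/-! ## Trees and the graphs that decide them -/

namespace Fm

/-- The sequence `σ` of length `m` has an extension of length `s` in the tree `t`. -/
def alive (t : ℕ) (m σ s : Tm) : Fm :=
  -- Sequences of length `s` have codes below `2 ^ (s + 1)`, so the search for an extension is
  -- bounded.
  bex (.pow two (.succ s)) (and (hasLength (var 0) (s.shift 1 0))
    (and (eq (ancestor (var 0) (.sub (s.shift 1 0) (m.shift 1 0))) (σ.shift 1 0))
      (ball (.succ (s.shift 1 0)) (ne (.app t (ancestor (var 1) (var 0))) .zero))))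

/-- At length `s`, the child `a` of the sequence with code `i` is dead and the child `b` alive. -/
def outlives (t : ℕ) (b a i s : Tm) : Fm :=
  bex (.succ i) (bex (.succ (i.shift 1 0)) (and (eq (i.shift 2 0) (pair (var 1) (var 0)))
    (and (lt (var 1) (s.shift 2 0))
    (and (neg (alive t (.succ (var 1)) (.succ (.add (.mul two (var 0)) (a.shift 2 0)))
        (s.shift 2 0)))
      (alive t (.succ (var 1)) (.succ (.add (.mul two (var 0)) (b.shift 2 0)))
        (s.shift 2 0))))))

/-- For `a < b`, the vertices `a` and `b` are joined in the graph with index `i` that decides which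
child of the sequence with code `i` to take. -/
def joined (t : ℕ) (k i a b : Tm) : Fm :=
  -- Vertices below `k - 2` are joined to everything; vertices above `k - 2` are joined across
  -- parity classes counted from `k - 1`.
  or (lt a (.sub k two)) (or
    (and (lt (.sub k two) a) (ne (.rem (.sub a (.succ (.sub k two))) two)
      (.rem (.sub b (.succ (.sub k two))) two)))
    -- The decision vertex is joined to the odd side when the right child outlives the left, and to
    -- the even side, which contains `k - 1`, when the left outlives the right.
    (and (eq a (.sub k two)) (bex (.succ b) (or
      (and (eq (b.shift 1 0) (.add (.succ (.sub (k.shift 1 0) two)) (.succ (.mul two (var 0)))))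
        (outlives t one .zero (i.shift 1 0) (var 0)))
      (and (eq (b.shift 1 0) (.add (.succ (.sub (k.shift 1 0) two)) (.mul two (var 0))))
        (outlives t .zero one (i.shift 1 0) (var 0)))))))

/-- The number `x` codes an edge in the sequence of graphs deciding the tree `t`. -/
def graphEdge (t : ℕ) (k x : Tm) : Fm :=
  bex (.succ x) (bex (.succ (.succ (x.shift 1 0))) (bex (var 0) (and
    (eq (x.shift 3 0) (pair (var 2) (edgeCode (var 0) (var 1))))
    (joined t (k.shift 3 0) (var 2) (var 0) (var 1)))))

theorem qf_alive (t : ℕ) (m σ s : Tm) : (alive t m σ s).QF ↔ True := qf_bex _ _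

theorem qf_outlives (t : ℕ) (b a i s : Tm) : (outlives t b a i s).QF ↔ True := qf_bex _ _

attribute [simp] qf_alive qf_outlives

theorem qf_joined (t : ℕ) (k i a b : Tm) : (joined t k i a b).QF ↔ True := by
  simp [joined]

theorem qf_graphEdge (t : ℕ) (k x : Tm) : (graphEdge t k x).QF ↔ True := qf_bex _ _

attribute [simp] qf_joined qf_graphEdge

variable (θ : ℕ → Tm) (ρ : ℕ → ℕ) (t : ℕ)

theorem subst_alive (m σ s : Tm) : (alive t m σ s).subst θ ρ =
    alive (ρ t) (m.subst θ ρ) (σ.subst θ ρ) (s.subst θ ρ) := by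
  simp only [alive, subst_bex, subst_ball, Fm.subst, subst_hasLength, subst_ne, Tm.subst_ancestor,
    Tm.subst_sub, Tm.subst_pow, Tm.subst, Tm.shift_one_subst_up, Tm.shiftF_two]
  rfl

theorem subst_outlives (b a i s : Tm) : (outlives t b a i s).subst θ ρ =
    outlives (ρ t) (b.subst θ ρ) (a.subst θ ρ) (i.subst θ ρ) (s.subst θ ρ) := by
  simp only [outlives, subst_bex, Fm.subst, neg_subst, subst_lt, subst_alive, Tm.subst_pair,
    Tm.subst_add, Tm.subst_mul, Tm.subst, Tm.shift_one_subst_up, Tm.shift_two_subst_up_up,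
    Tm.shiftF_two]
  rfl

theorem _root_.IRCA.Tm.subst_rem (a b : Tm) :
    (Tm.rem a b).subst θ ρ = .rem (a.subst θ ρ) (b.subst θ ρ) := by
  simp only [Tm.rem, Tm.subst_sub, Tm.subst_mul, Tm.subst_quo]

theorem subst_joined (k i a b : Tm) : (joined t k i a b).subst θ ρ =
    joined (ρ t) (k.subst θ ρ) (i.subst θ ρ) (a.subst θ ρ) (b.subst θ ρ) := by
  simp only [joined, subst_bex, Fm.subst, subst_lt, subst_ne, subst_outlives, Tm.subst_rem,
    Tm.subst_add, Tm.subst_sub, Tm.subst_mul, Tm.subst, Tm.shift_one_subst_up, Tm.shiftF_two,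
    Tm.shiftF_one]
  rfl

end Fm

/-! ### Surviving children and deciding graphs in models -/

namespace Mod

variable {M : Mod}

/-- The sequence `σ` of length `m` has an extension of length `s` in the tree `t`. -/
def Alive (t : ℕ) (m σ s : M.C) : Prop :=
  ∃ c < pw 2 (s + 1), HL c s ∧ anc c (s - m) = σ ∧ ∀ j < s + 1, fn t (anc c j) ≠ 0

/-- At length `s`, the child `a` of the sequence with code `i` is dead and the child `b` alive. -/
def Outlives (t : ℕ) (b a i s : M.C) : Prop :=
  ∃ m < i + 1, ∃ σ < i + 1, i = pr m σ ∧ m < s ∧ ¬ Alive t (m + 1) (2 * σ + a + 1) s ∧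
    Alive t (m + 1) (2 * σ + b + 1) s

/-- For `a < b`, the vertices `a` and `b` are joined in the graph with index `i` that decides which
child of the sequence with code `i` to take. -/
def Joined (t : ℕ) (k i a b : M.C) : Prop :=
  a < k - 2 ∨ (k - 2 < a ∧ rm (a - (k - 2 + 1)) 2 ≠ rm (b - (k - 2 + 1)) 2) ∨
    (a = k - 2 ∧ ∃ s < b + 1, (b = k - 2 + 1 + (2 * s + 1) ∧ Outlives t 1 0 i s) ∨
      (b = k - 2 + 1 + 2 * s ∧ Outlives t 0 1 i s))

theorem sat_alive (env : ℕ → M.C) (t : ℕ) (m σ s : Tm) :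
    sat env (.alive t m σ s) ↔ Alive t (eval env m) (eval env σ) (eval env s) := by
  simp [Fm.alive, Alive, sat_bex, sat_ball, eval_shift]

theorem sat_outlives (env : ℕ → M.C) (t : ℕ) (b a i s : Tm) : sat env (.outlives t b a i s) ↔
    Outlives t (eval env b) (eval env a) (eval env i) (eval env s) := by
  simp [Fm.outlives, Outlives, sat_bex, sat_alive, eval_shift]

theorem sat_joined (env : ℕ → M.C) (t : ℕ) (k i a b : Tm) : sat env (.joined t k i a b) ↔
    Joined t (eval env k) (eval env i) (eval env a) (eval env b) := by
  simp [Fm.joined, Joined, sat_bex, sat_outlives, eval_shift]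

theorem sat_graphEdge (env : ℕ → M.C) (t : ℕ) (k x : Tm) : sat env (.graphEdge t k x) ↔
    ∃ i a b, a < b ∧ eval env x = pr i (ec a b) ∧ Joined t (eval env k) i a b := by
  simp only [Fm.graphEdge, sat_bex, Fm.qf_bex, Fm.qf_and, Fm.qf_eq, Fm.qf_joined, and_self,
    sat_and, sat_eq, sat_joined, eval_shift, eval_pair, eval_edgeCode, eval_var, eval_succ,
    scons_zero, scons_succ]
  constructor
  · rintro ⟨i, _, b, _, a, hab, hx, h⟩
    exact ⟨i, a, b, hab, hx, h⟩
  · rintro ⟨i, a, b, hab, hx, h⟩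
    refine ⟨i, ?_, b, ?_, a, hab, hx, h⟩
    · rw [hx]; exact lt_add_one_iff.2 (le_pr_left _ _)
    · rw [lt_add_one_iff]
      refine (le_ec_right hab).trans ?_
      gcongr
      exact (le_pr_right _ _).trans hx.ge

theorem joined_iff {t : ℕ} {k i a b : M.C} (hab : a < b) :
    (∃ i' a' b', a' < b' ∧ pr i (ec a b) = pr i' (ec a' b') ∧ Joined t k i' a' b') ↔
      Joined t k i a b := by
  refine ⟨?_, fun h => ⟨i, a, b, hab, rfl, h⟩⟩
  rintro ⟨i', a', b', hab', he, h⟩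
  obtain ⟨rfl, h1⟩ := pr_inj he
  obtain ⟨rfl, rfl⟩ := ec_inj hab hab' h1
  exact h

theorem outlives_pr {t : ℕ} {b a m σ s : M.C} : Outlives t b a (pr m σ) s ↔
    m < s ∧ ¬ Alive t (m + 1) (2 * σ + a + 1) s ∧ Alive t (m + 1) (2 * σ + b + 1) s := by
  constructor
  · rintro ⟨m', _, σ', _, he, h⟩
    obtain ⟨rfl, rfl⟩ := pr_inj he
    exact h
  · exact fun h => ⟨m, lt_add_one_iff.2 (le_pr_left _ _), σ, lt_add_one_iff.2 (le_pr_right _ _),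
      rfl, h⟩

theorem HL.anc {c j l : M.C} (h : HL c (l + j)) : HL (anc c j) l := by
  have key : ∀ x, x ≤ l + j → HL (Mod.anc c x) (l + j - x) := fun x => by
    induction x using induct with
    | hP => fun_prop
    | h0 => intro _; simpa using h
    | hs x ih =>
      intro hx
      rw [anc_add_one]
      refine HL.par ?_
      obtain ⟨d, hd⟩ := le_iff.1 hx
      have h1 := ih (le_of_lt hx)
      rw [hd, add_tsub_cancel_left]
      rwa [hd, add_assoc, add_tsub_cancel_left, add_comm] at h1
  simpa using key j le_add_self

theorem HL.eq_zero {c : M.C} (h : HL c 0) : c = 0 := by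
  have := h.2
  rw [pw_add_one, pw_zero, one_mul, ← one_add_one_eq_two] at this
  simpa using (add_lt_add_iff_right 1).1 this

/-- The witness at the later stage is cut down to length `s`. -/
theorem Alive.of_le {t : ℕ} {m σ s s' : M.C} (h : Alive t m σ s') (hm : m ≤ s) (hs : s ≤ s') :
    Alive t m σ s := by
  obtain ⟨c, -, hc, rfl, ht⟩ := h
  obtain ⟨d, rfl⟩ := le_iff.1 hs
  obtain ⟨u, rfl⟩ := le_iff.1 hm
  refine ⟨anc c d, ?_, hc.anc, ?_, fun j hj => ?_⟩
  · exact le_self_add.trans_lt hc.anc.2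
  · rw [← anc_add, add_assoc, add_tsub_cancel_left, add_tsub_cancel_left, add_comm]
  · rw [← anc_add]
    refine ht _ ?_
    rw [lt_add_one_iff] at hj ⊢
    rw [add_comm]
    gcongr

/-- Being alive is inherited by earlier stages. The child alive at the later of the two stages is
therefore alive at the earlier one, where it was declared dead. -/
theorem Outlives.not {t : ℕ} {b a i s s' : M.C} (h : Outlives t b a i s) :
    ¬ Outlives t a b i s' := by
  obtain ⟨m, -, σ, -, rfl, h⟩ := h
  rw [outlives_pr]
  intro h'
  rcases le_total s s' with hs | hs
  · exact h.2.1 (h'.2.2.of_le (lt_def.1 h.1) hs)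
  · exact h'.2.1 (h.2.2.of_le (lt_def.1 h'.1) hs)

/-- An extension longer than `m` passes through one of the two children. -/
theorem Alive.child {t : ℕ} {m σ s : M.C} (h : Alive t m σ s) (hm : m < s) :
    Alive t (m + 1) (2 * σ + 0 + 1) s ∨ Alive t (m + 1) (2 * σ + 1 + 1) s := by
  obtain ⟨c, hc', hc, rfl, ht⟩ := h
  obtain ⟨d, rfl⟩ := le_iff.1 (lt_def.1 hm)
  have h1 : m + 1 + d - (m + 1) = d := add_tsub_cancel_left _ _
  have h2 : m + 1 + d - m = d + 1 := by rw [add_assoc, add_tsub_cancel_left, add_comm]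
  rw [h2, anc_add_one, add_zero, add_assoc _ 1 1, one_add_one_eq_two]
  rcases cases_par (anc c d) with h | h | h
  · have h3 := hc.anc
    rw [h] at h3
    have h4 := h3.1
    rw [zero_add] at h4
    exact absurd ((lt_pw_two (m + 1)).trans_le h4) (by simp)
  · exact .inl ⟨c, hc', hc, by rw [h1]; exact h, ht⟩
  · exact .inr ⟨c, hc', hc, by rw [h1]; exact h, ht⟩

end Mod

namespace Mod

variable {M : Mod}

theorem rm_even (s : M.C) : rm (2 * s) 2 = 0 := by
  simpa using rm_mul_add 2 s 0 (pos_iff_ne_zero.2 two_ne_zero)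

theorem rm_odd (s : M.C) : rm (2 * s + 1) 2 = 1 := rm_mul_add 2 s 1 one_lt_two'

/-- In a coloring of the graph of the sequence `σ` of length `m`, the vertices `k - 2` and `k - 1`
have equal colors only if the left child is alive or the right child is dead. -/
theorem not_outlives_of_coloring {t f : ℕ} {k i s : M.C} (hk : 2 ≤ k)
    (hlt : ∀ n, fn f (pr i n) < k)
    (hne : ∀ b a, a < b → Joined t k i a b → fn f (pr i a) ≠ fn f (pr i b)) :
    (fn f (pr i (k - 2)) = fn f (pr i (k - 2 + 1)) → ¬ Outlives t 0 1 i s) ∧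
    (fn f (pr i (k - 2)) ≠ fn f (pr i (k - 2 + 1)) → ¬ Outlives t 1 0 i s) := by
  obtain ⟨K, rfl⟩ := le_iff.1 hk
  rw [add_comm] at hlt hne ⊢
  simp only [Joined, add_tsub_cancel_right] at hne ⊢
  have hz (u : M.C) : K < K + 1 + u := (lt_add_one_iff.2 le_rfl).trans_le le_self_add
  have hlow : ∀ {x a : M.C}, x < K → K ≤ a → fn f (pr i x) ≠ fn f (pr i a) :=
    fun hx ha => hne _ _ (hx.trans_le ha) (.inl hx)
  have hpar : ∀ {u v : M.C}, u < v → rm u 2 ≠ rm v 2 →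
      fn f (pr i (K + 1 + u)) ≠ fn f (pr i (K + 1 + v)) := fun {u v} huv h => by
    refine hne _ _ (by gcongr) (.inr (.inl ⟨hz u, ?_⟩))
    rwa [add_tsub_cancel_left, add_tsub_cancel_left]
  -- Three vertices outside the clique cannot have pairwise different colors.
  have key : ∀ {a b c : M.C}, K ≤ a → K ≤ b → K ≤ c → fn f (pr i a) ≠ fn f (pr i b) →
      fn f (pr i a) ≠ fn f (pr i c) → fn f (pr i b) ≠ fn f (pr i c) → False :=
    fun ha hb hc => no_three_colors (K := K) (g := fun x => fn f (pr i x)) (by fun_prop)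
      (fun x _ => hlt x) (fun x y hxy hy => hne _ _ hxy (.inl (hxy.trans hy))) (hlt _) (hlt _)
      (hlt _) (fun x hx => hlow hx ha) (fun x hx => hlow hx hb) (fun x hx => hlow hx hc)
  have h01 : fn f (pr i (K + 1)) ≠ fn f (pr i (K + 1 + 1)) := by
    have := hpar (u := 0) (v := 1) zero_lt_one
      (by rw [rm_of_lt one_lt_two', rm_of_lt (pos_iff_ne_zero.2 two_ne_zero)]; exact zero_ne_one)
    rwa [add_zero] at this
  constructor
  · intro he ho
    obtain ⟨m, -, σ, -, -, hm, -⟩ := id ho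
    -- As `s` is positive, the vertex `k - 1 + 2 * s` comes after `k`, so the two are joined. With
    -- `k - 2`, whose color differs from that of `k` by assumption, they need three colors.
    have hs2 : 1 < 2 * s := by
      refine one_lt_two'.trans_le ?_
      have hs : (0 : M.C) + 1 ≤ s := pos_of_gt hm
      simpa using mul_le_mul_right (c := s) (b := 0 + 1) hs 2
    have h1 : fn f (pr i K) ≠ fn f (pr i (K + 1 + 2 * s)) :=
      hne _ _ (hz _) (.inr (.inr ⟨rfl, s, lt_add_one_iff.2 (two_mul s ▸ le_self_add.trans le_add_self),
        .inr ⟨rfl, ho⟩⟩))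
    have h2 : fn f (pr i (K + 1 + 1)) ≠ fn f (pr i (K + 1 + 2 * s)) :=
      hpar hs2 (by rw [rm_even, rm_of_lt one_lt_two']; exact one_ne_zero)
    exact key le_rfl (hz 1).le (hz _).le (he.trans_ne h01) h1 h2
  · intro he ho
    obtain ⟨m, -, σ, -, -, hm, -⟩ := id ho
    -- Here the three vertices are `k - 2`, `k - 1` and the odd vertex `k - 1 + (2 * s + 1)`.
    have h1 : fn f (pr i K) ≠ fn f (pr i (K + 1 + (2 * s + 1))) :=
      hne _ _ (hz _) (.inr (.inr ⟨rfl, s, lt_add_one_iff.2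
        (two_mul s ▸ le_self_add.trans (le_self_add.trans le_add_self)), .inl ⟨rfl, ho⟩⟩))
    have h2 : fn f (pr i (K + 1 + 0)) ≠ fn f (pr i (K + 1 + (2 * s + 1))) :=
      hpar (by simp) (by rw [rm_odd, rm_of_lt (pos_iff_ne_zero.2 two_ne_zero)]; exact zero_ne_one)
    rw [add_zero] at h2
    exact key le_rfl (lt_add_one_iff.2 le_rfl).le (hz _).le he h1 h2

/-- A path through the tree `t` read from a coloring. -/
theorem alive_seg {t f p : ℕ} {k : M.C} (hk : 2 ≤ k) (hlt : ∀ i n, fn f (pr i n) < k)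
    (hne : ∀ i b a, a < b → Joined t k i a b → fn f (pr i a) ≠ fn f (pr i b))
    (hp : ∀ m : M.C, fn p m < 2) (hpf : ∀ m : M.C, fn p m = 1 ↔
      fn f (pr (pr m (seg p m)) (k - 2)) = fn f (pr (pr m (seg p m)) (k - 2 + 1)))
    (hroot : ∀ s : M.C, Alive t 0 0 s) {m n : M.C} : m ≤ n → Alive t m (seg p m) n := by
  induction m using induct with
  -- The final stage `n` is fixed and the search for an extension is bounded, so the statement is
  -- definable.
  | hP => unfold Alive; fun_prop
  | h0 => intro _; rw [seg_zero]; exact hroot n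
  | hs m ih =>
    intro hm
    have h1 := ih (le_of_lt hm)
    obtain ⟨h2, h3⟩ := not_outlives_of_coloring (s := n) hk (hlt (pr m (seg p m)))
      (hne (pr m (seg p m)))
    rw [← hpf] at h2
    rw [Ne, ← hpf] at h3
    rw [outlives_pr] at h2 h3
    rw [seg_add_one]
    rcases lt_two_iff.1 (hp m) with h | h <;> rw [h]
    -- Bit `0` means different colors, so the right child never outlives the left; were the left
    -- dead, the right would be alive by `Alive.child`.
    · by_contra h4
      exact h3 (by rw [h]; exact zero_ne_one) ⟨hm, h4, (h1.child hm).resolve_left h4⟩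
    · by_contra h4
      exact h2 h ⟨hm, h4, (h1.child hm).resolve_right h4⟩

/-- The colors of a coloring up to `m` of the graph with index `i`. -/
theorem ne_of_joined {t : ℕ} {k i m : M.C} {g : M.C → M.C} (hk : 2 ≤ k)
    (h1 : ∀ a, a < k - 2 → g a = a)
    (h2 : ∀ a, k - 2 < a → g a = k - 2 + rm (a - (k - 2 + 1)) 2)
    (h3 : (∃ s < m + 1, Outlives t 0 1 i s) → g (k - 2) = k - 2 + 1)
    (h4 : (¬ ∃ s < m + 1, Outlives t 0 1 i s) → g (k - 2) = k - 2) {a b : M.C} (hab : a < b)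
    (hb : b ≤ m) (hj : Joined t k i a b) : g a ≠ g b := by
  obtain ⟨K, rfl⟩ := le_iff.1 hk
  rw [add_comm 2 K] at hj h1 h2 h3 h4
  simp only [Joined, add_tsub_cancel_right] at hj h1 h2 h3 h4
  have hle : ∀ {x : M.C}, K ≤ x → K ≤ g x := fun {x} hx => by
    rcases hx.eq_or_lt with rfl | hx
    · by_cases h : ∃ s < m + 1, Outlives t 0 1 i s
      · rw [h3 h]; exact le_self_add
      · rw [h4 h]
    · rw [h2 x hx]; exact le_self_add
  have hz (u : M.C) : K < K + 1 + u := (lt_add_one_iff.2 le_rfl).trans_le le_self_add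
  rcases hj with ha | ⟨ha, hr⟩ | ⟨rfl, s, -, ⟨rfl, ho⟩ | ⟨rfl, ho⟩⟩
  · rw [h1 a ha]
    rcases lt_or_ge b K with hb | hb
    · rw [h1 b hb]; exact hab.ne
    · exact (ha.trans_le (hle hb)).ne
  · rw [h2 a ha, h2 b (ha.trans hab)]
    simpa using hr
  -- An edge to the odd side excludes the opposite outcome at every stage, so the decision vertex
  -- has color `k - 2` and the odd vertex has `k - 1`.
  · rw [h2 _ (hz _), h4 fun ⟨s', _, h⟩ => ho.not h, add_tsub_cancel_left, rm_odd]
    exact (lt_add_one_iff.2 le_rfl).ne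
  -- The stage responsible for the edge is at most the endpoint `b ≤ m`, so the search up to `m` has
  -- found it.
  · have hs : s ≤ a + 1 + 2 * s := by rw [two_mul]; exact le_self_add.trans le_add_self
    rw [h2 _ (hz _), h3 ⟨s, lt_add_one_iff.2 (hs.trans hb), ho⟩,
      add_tsub_cancel_left, rm_even, add_zero]
    exact (lt_add_one_iff.2 le_rfl).ne'

end Mod

open Tm (var one two pair edgeCode digit ancestor initSeg)

/-! ## The coloring principle implies weak König's Lemma -/

/-- The function `α` is the characteristic function of `φ`. -/
def Fm.isChar (α : ℕ) (φ : Fm) : Fm :=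
  allN (and (lt (.app α (var 0)) two) (iff (eq (.app α (var 0)) one) φ))

theorem Fm.isChar_shiftF (α : ℕ) (φ : Fm) : (isChar α φ).shiftF = isChar (α + 1) φ.shiftF := by
  simp only [isChar, shiftF, Fm.subst, subst_lt, subst_iff, Tm.up_var, Tm.subst, Tm.shiftF_two,
    Tm.shiftF_one]

theorem Fm.isChar_univ {α : ℕ} {φ : Fm} (h : φ.QF) : (isChar α φ).Univ :=
  QF.univ (φ := .and _ _) (by simp [h])

theorem Fm.isChar_goal {α : ℕ} {φ : Fm} (h : φ.QF) : (isChar α φ).Goal :=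
  QF.goal (φ := .and _ _) (by simp [h])

theorem Mod.sat_isChar {M : Mod} (env : ℕ → M.C) (α : ℕ) (φ : Fm) : sat env (.isChar α φ) ↔
    ∀ x : M.C, fn α x < 2 ∧ (fn α x = 1 ↔ sat (scons x env) φ) := by
  simp only [Fm.isChar, sat_allN, sat_and, sat_lt, sat_iff, sat_eq, eval_app, eval_var, eval_one,
    eval_two, scons_zero]

theorem Fm.shiftN_shiftF (φ : Fm) : φ.shiftN.shiftF = φ.shiftF.shiftN := by
  simp only [shiftN, shiftF, subst_subst]
  rfl

/-- Quantifier free formulas have characteristic functions. -/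
theorem Prov.characteristic {Γ Γ' : List Fm} {φ φ' ψ ψ' : Fm} (hφ : φ.QF) (hφ' : φ.shiftF = φ')
    (hΓ' : Γ.map Fm.shiftF = Γ') (hψ : ψ.shiftF = ψ') (hs : Prov (.isChar 0 φ' :: Γ') ψ') :
    Prov Γ ψ := by
  have hq : (Fm.and (.lt (var 0) two) (.iff (.eq (var 0) one) φ.shiftN)).QF := by
    simp only [Fm.qf_and, Fm.qf_lt, Fm.qf_iff, Fm.qf_eq, true_and]
    exact hφ.subst _ _
  refine Prov.choice_to hq ?_ (φ' := .and (.lt (var 0) two) (.iff (.eq (var 0) one) φ'.shiftN)) ?_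
    hΓ' hψ (Fm.isChar_goal (hφ' ▸ hφ.subst _ _)) ?_ hs
  · refine complete hq.exis fun M env _ x => ?_
    simp only [Mod.sat_exN, Mod.sat_and, Mod.sat_lt, Mod.sat_iff, Mod.sat_eq, Mod.sat_shiftN,
      Mod.eval_var, Mod.eval_two, Mod.eval_one, scons_zero, scons_succ]
    by_cases h : Mod.sat (scons x env) φ
    · exact ⟨1, Mod.one_lt_two', iff_of_true rfl h⟩
    · exact ⟨0, pos_iff_ne_zero.2 two_ne_zero, iff_of_false zero_ne_one h⟩
  · have h := Fm.shiftN_shiftF φ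
    rw [hφ'] at h
    rw [← h]
    rfl
  · intro M env h
    simpa only [Mod.sat_isChar, Mod.sat_and, Mod.sat_lt, Mod.sat_iff, Mod.sat_eq, Mod.sat_shiftN,
      Mod.eval_var, Mod.eval_two, Mod.eval_one, scons_zero, scons_succ] using h

/-! ### Formulas for the converse and their truth conditions -/

namespace Fm

theorem subst_graphEdge (σ : ℕ → Tm) (ρ : ℕ → ℕ) (t : ℕ) (k x : Tm) :
    (graphEdge t k x).subst σ ρ = graphEdge (ρ t) (k.subst σ ρ) (x.subst σ ρ) := by
  have h (s : Tm) : (s.shift 3 0).subst (Tm.up (Tm.up (Tm.up σ))) ρ = (s.subst σ ρ).shift 3 0 := by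
    rw [show s.shift 3 0 = (s.shift 2 0).shift 1 0 by rw [Tm.shift_shift], Tm.shift_one_subst_up,
      Tm.shift_two_subst_up_up, Tm.shift_shift]
  simp only [graphEdge, subst_bex, Fm.subst, subst_joined, Tm.subst_pair, Tm.subst_edgeCode,
    Tm.subst, Tm.shift_one_subst_up, h]
  rfl

/-- The tree `t` has sequences of every length. -/
def rootAlive (t : ℕ) : Fm := allN (alive t .zero .zero (var 0))

/-- The graphs deciding the tree `t`, for `k` colors. -/
def isGraph (e t k : ℕ) : Fm := isChar e (graphEdge t (var (k + 1)) (var 0))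

/-- The color `y` of the vertex in number variable `n`, in the graph that decides the tree `t`, where
the next three variables are a bound for the vertices, the index of the graph, and the number of
colors. -/
def colorRule (t : ℕ) (y : Tm) (n : ℕ) : Fm :=
  and (imp (lt (var n) (.sub (var (n + 3)) two)) (eq y (var n)))
    (and (imp (lt (.sub (var (n + 3)) two) (var n)) (eq y (.add (.sub (var (n + 3)) two)
      (.rem (.sub (var n) (.succ (.sub (var (n + 3)) two))) two))))
    (and (imp (and (eq (var n) (.sub (var (n + 3)) two))
        (bex (.succ (var (n + 1))) (outlives t .zero one (var (n + 3)) (var 0))))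
      (eq y (.succ (.sub (var (n + 3)) two))))
    (imp (and (eq (var n) (.sub (var (n + 3)) two))
        (neg (bex (.succ (var (n + 1))) (outlives t .zero one (var (n + 3)) (var 0)))))
      (eq y (.sub (var (n + 3)) two)))))

end Fm

/-- The code of the path below `m` that takes the bits given by `B`. -/
def Tm.pathCode (B : ℕ) (m : Tm) : Tm :=
  recur zero (succ (add (mul two (var 0)) (app B (pair (var 1) (var 0))))) m

namespace Fm

/-- The function `p` takes the bits given by `B`. -/
def takesBits (p B : ℕ) : Fm :=
  allN (eq (.app p (var 0)) (.app B (pair (var 0) (.pathCode B (var 0)))))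

/-- The function `f` gives equal colors to the vertices `k - 2` and `k - 1` of the graph `0`. -/
def sameColor (f k : ℕ) : Fm :=
  eq (.app f (pair (var 0) (.sub (var k) two))) (.app f (pair (var 0) (.succ (.sub (var k) two))))

end Fm

namespace Mod

variable {M : Mod} (env : ℕ → M.C)

/-- The code of the path below `x` that takes the bits given by `B`. -/
noncomputable def pathCode (B : ℕ) (x : M.C) : M.C :=
  prec (fun _ => 0) .zero (.succ (.add (.mul two (var 0)) (.app B (pair (var 1) (var 0))))) x

theorem eval_pathCode (B : ℕ) (m : Tm) :
    eval env (.pathCode B m) = pathCode B (eval env m) :=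
  (eval_recur _ _ _ _).trans (prec_subst env (fun _ => .zero) .zero
    (.succ (.add (.mul two (var 0)) (.app B (pair (var 1) (var 0))))) (eval env m))

theorem sat_rootAlive (t : ℕ) : sat env (.rootAlive t) ↔ ∀ s : M.C, Alive t 0 0 s := by
  simp [Fm.rootAlive, sat_alive]

theorem sat_takesBits (p B : ℕ) :
    sat env (.takesBits p B) ↔ ∀ m : M.C, fn p m = fn B (pr m (pathCode B m)) := by
  simp [Fm.takesBits, eval_pathCode]

/-- The bit `p(m)` depends on the code of the earlier bits. `pathCode` computes that code from `B`
alone, which breaks the circularity. -/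
theorem pathCode_eq_seg {p B : ℕ} (h : ∀ m : M.C, fn p m = fn B (pr m (pathCode B m))) (m : M.C) :
    pathCode B m = seg p m := by
  unfold pathCode at *
  induction m using induct with
  | hP => exact .eq (.prec _ _ _ (.arg 0)) (.seg _ (.arg 0))
  | h0 => rw [prec_zero, seg_zero, eval_zero]
  | hs m ih =>
    rw [seg_add_one, h, prec_add_one, ih]
    simp [scons]

theorem sat_isGraph (e t k : ℕ) : sat env (.isGraph e t k) ↔ ∀ x : M.C, fn e x < 2 ∧ (fn e x = 1 ↔
    ∃ i a b, a < b ∧ x = pr i (ec a b) ∧ Joined t (env k) i a b) := by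
  simp only [Fm.isGraph, sat_isChar, sat_graphEdge, eval_var, scons_zero, scons_succ]

theorem edge_iff_joined {e t : ℕ} {k : M.C} (h : ∀ x : M.C, fn e x < 2 ∧ (fn e x = 1 ↔
    ∃ i a b, a < b ∧ x = pr i (ec a b) ∧ Joined t k i a b)) {i a b : M.C} (hab : a < b) :
    fn e (pr i (ec a b)) ≠ 0 ↔ Joined t k i a b := by
  rw [← joined_iff hab, ← (h _).2]
  rcases lt_two_iff.1 (h (pr i (ec a b))).1 with h | h <;> rw [h] <;> simp

theorem sat_colorRule (t : ℕ) (y : Tm) (n : ℕ) : sat env (.colorRule t y n) ↔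
    (env n < env (n + 3) - 2 → eval env y = env n) ∧
    (env (n + 3) - 2 < env n → eval env y =
      env (n + 3) - 2 + rm (env n - (env (n + 3) - 2 + 1)) 2) ∧
    (env n = env (n + 3) - 2 ∧ (∃ s < env (n + 1) + 1, Outlives t 0 1 (env (n + 2)) s) →
      eval env y = env (n + 3) - 2 + 1) ∧
    (env n = env (n + 3) - 2 ∧ (¬ ∃ s < env (n + 1) + 1, Outlives t 0 1 (env (n + 2)) s) →
      eval env y = env (n + 3) - 2) := by
  simp only [Fm.colorRule, sat_and, sat_imp, sat_lt, sat_eq, sat_neg, sat_bex, Fm.qf_outlives,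
    sat_outlives, eval_var, eval_zero, eval_one, eval_two, eval_add, eval_sub, eval_succ, eval_rem,
    scons_zero, scons_succ]

end Mod

theorem Fm.colorRule_shiftF (t n m : ℕ) :
    (colorRule t (var m) n).shiftF = colorRule (t + 1) (var m) n := by
  simp only [colorRule, shiftF, Fm.subst, neg_subst, subst_lt, subst_bex, subst_outlives,
    Tm.subst_add, Tm.subst_sub, Tm.subst_rem, Tm.subst, Tm.up_var, Tm.shiftF_two, Tm.shiftF_one]

theorem Fm.isGraph_shiftF (e t k : ℕ) : (isGraph e t k).shiftF = isGraph (e + 1) (t + 1) k := by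
  rw [isGraph, isChar_shiftF, shiftF, subst_graphEdge]
  rfl

theorem Fm.isGraph_shiftN (e t k : ℕ) : (isGraph e t k).shiftN = isGraph e t (k + 1) := by
  simp only [isGraph, isChar, shiftN, Fm.subst, subst_graphEdge, subst_lt, subst_iff, Tm.subst]
  rfl

theorem Fm.rootAlive_shiftF (t : ℕ) : (rootAlive t).shiftF = rootAlive (t + 1) := by
  simp only [rootAlive, shiftF, Fm.subst, subst_alive, Tm.subst, Tm.up_var]

theorem Fm.isGraph_univ (e t k : ℕ) : (isGraph e t k).Univ := isChar_univ (by simp)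

theorem Mod.exists_color_joined {M : Mod} (t : ℕ) (a m i k : M.C) : ∃ y,
    (a < k - 2 → y = a) ∧ (k - 2 < a → y = k - 2 + rm (a - (k - 2 + 1)) 2) ∧
    (a = k - 2 ∧ (∃ s < m + 1, Outlives t 0 1 i s) → y = k - 2 + 1) ∧
    (a = k - 2 ∧ (¬ ∃ s < m + 1, Outlives t 0 1 i s) → y = k - 2) := by
  rcases lt_trichotomy a (k - 2) with h | h | h
  · exact ⟨a, fun _ => rfl, fun h' => absurd h' h.not_gt, fun h' => absurd h'.1 h.ne,
      fun h' => absurd h'.1 h.ne⟩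
  · by_cases hW : ∃ s < m + 1, Outlives t 0 1 i s
    · exact ⟨_, fun h' => absurd h h'.ne, fun h' => absurd h h'.ne', fun _ => rfl,
        fun h' => absurd hW h'.2⟩
    · exact ⟨_, fun h' => absurd h h'.ne, fun h' => absurd h h'.ne', fun h' => absurd h'.2 hW,
        fun _ => rfl⟩
  · exact ⟨_, fun h' => absurd h' h.not_gt, fun _ => rfl, fun h' => absurd h'.1 h.ne',
      fun h' => absurd h'.1 h.ne'⟩

theorem Mod.color_lt {M : Mod} {t : ℕ} {a m i k y : M.C} (hk : 2 ≤ k) (h1 : a < k - 2 → y = a)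
    (h2 : k - 2 < a → y = k - 2 + rm (a - (k - 2 + 1)) 2)
    (h3 : a = k - 2 ∧ (∃ s < m + 1, Outlives t 0 1 i s) → y = k - 2 + 1)
    (h4 : a = k - 2 ∧ (¬ ∃ s < m + 1, Outlives t 0 1 i s) → y = k - 2) : y < k := by
  obtain ⟨K, rfl⟩ := le_iff.1 hk
  rw [add_comm 2 K] at *
  rw [add_tsub_cancel_right] at h1 h2 h3 h4
  have h2' : (0 : M.C) < 2 := pos_iff_ne_zero.2 two_ne_zero
  rcases lt_trichotomy a K with h | h | h
  · rw [h1 h]; exact h.trans_le le_self_add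
  · by_cases hW : ∃ s < m + 1, Outlives t 0 1 i s
    · rw [h3 ⟨h, hW⟩]; simp
    · rw [h4 ⟨h, hW⟩]; simp
  · rw [h2 h]; simpa using rm_lt _ h2'

/-- The graphs deciding a tree are locally colorable. -/
theorem prov_locallyColorable :
    Prov [Fm.isGraph 0 1 0, .le two (var 0)] (Fm.locallyColorable 0 0) := by
  refine .allNI (.allNI ?_)
  rw [List.map_cons, List.map_cons, Fm.isGraph_shiftN, Fm.isGraph_shiftN]
  have hq : (Fm.colorRule 1 (var 0) 1).QF := by simp [Fm.colorRule]
  have hq' : (Fm.colorRule 2 (.app 0 (var 0)) 0).QF := by simp [Fm.colorRule]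
  refine Prov.choice_to hq ?_ (Fm.colorRule_shiftF 1 1 0)
    (N := .allN (.colorRule 2 (.app 0 (var 0)) 0)) rfl rfl hq'.goal ?_
    (ψ' := Fm.colorableUpTo (var 2) 1 (var 1) (var 0)) ?_
  · refine complete hq.exis fun M env _ a => ?_
    simp only [Mod.sat_exN, Mod.sat_colorRule, Mod.eval_var, scons_zero, scons_succ]
    exact Mod.exists_color_joined 1 a (env 0) (env 1) (env 2)
  · intro M env h
    simpa only [Mod.sat_allN, Mod.sat_colorRule, Mod.eval_var, Mod.eval_app, scons_zero, scons_succ]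
      using h
  -- The vertices `0, …, m` require `m + 1` digits in base `k`.
  · refine .exNI (.seqCode 0 (var 2) (.succ (var 0))) (complete
      ⟨trivial, trivial, ⟨trivial, trivial⟩, trivial, trivial⟩ ?_)
    intro M env h
    rw [List.map_cons, Fm.isGraph_shiftF] at h
    have h1 := h _ (.head _) hq'.univ
    have h2 := (Mod.sat_isGraph _ _ _ _).1 (h _ (.tail _ (.head _)) (Fm.isGraph_univ _ _ _))
    have h3 : Mod.sat env (.le two (var 2)) := h _ (.tail _ (.tail _ (.head _))) trivial
    simp only [Mod.sat_allN, Mod.sat_colorRule, Mod.eval_var, Mod.eval_app, scons_zero,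
      scons_succ, Mod.sat_le, Mod.eval_two] at h1 h3
    simp [Mod.sat_instN, Mod.eval_shift]
    intro b a hab hb he
    have hlt : ∀ x < env 0 + 1, Mod.fn 0 x < env 2 := fun x _ =>
      Mod.color_lt h3 (h1 x).1 (h1 x).2.1 (h1 x).2.2.1 (h1 x).2.2.2
    rw [Mod.digit_seqCode 0 hlt (Mod.lt_add_one_iff.2 (hab.le.trans hb)),
      Mod.digit_seqCode 0 hlt (Mod.lt_add_one_iff.2 hb)]
    exact Mod.ne_of_joined h3 (fun a => (h1 a).1) (fun a => (h1 a).2.1)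
      (fun h => (h1 _).2.2.1 ⟨rfl, h⟩) (fun h => (h1 _).2.2.2 ⟨rfl, h⟩) hab hb
      ((Mod.edge_iff_joined h2 hab).1 he)

/-! ### Derivation of weak König's Lemma -/

open Tm (var one two pair edgeCode digit ancestor initSeg)
open IRCA.Mod

theorem Fm.sameColor_shiftF (f k : ℕ) : (sameColor f k).shiftF = sameColor (f + 1) k := by
  simp only [sameColor, shiftF, Fm.subst, Tm.subst, Tm.subst_pair, Tm.subst_sub, Tm.shiftF_two]

/-- The sequence of colorings `f` of the sequence of graphs `e`. -/
def Fm.areColorings (e f k : ℕ) : Fm := allN (isColoring (var (k + 1)) e (var 0) f)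

theorem Fm.areColorings_univ (e f k : ℕ) : (areColorings e f k).Univ :=
  ⟨trivial, trivial, QF.univ (by simp)⟩


theorem Mod.sat_areColorings {M : Mod} (env : ℕ → M.C) (e f k : ℕ) :
    sat env (.areColorings e f k) ↔ ∀ i, (∀ n, fn f (pr i n) < env k) ∧
      ∀ b a, a < b → fn e (pr i (ec a b)) ≠ 0 → fn f (pr i a) ≠ fn f (pr i b) := by
  simp [Fm.areColorings, Fm.isColoring, eval_shift]

/-- The hypothesis on the tree contains an unbounded existential and is lost in models; being alive
bounds the witness and makes the hypothesis usable there. -/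
theorem prov_rootAlive {Γ : List Fm} :
    Prov ((.allN (.exN (.and (.hasLength (var 0) (var 1)) (.inTree 0 (var 0))))) :: Γ)
      (Fm.rootAlive 0) := by
  refine Prov.mono (Γ := [_]) (.allNI ?_) (List.cons_subset_cons _ (List.nil_subset _))
  have h : Prov [(.allN (.exN (.and (.hasLength (var 0) (var 1)) (.inTree 0 (var 0)))))]
      (.exN (.and (.hasLength (var 0) (var 1)) (.inTree 0 (var 0)))) :=
    .allNE (var 0) (.hyp (.head _))
  refine .exNE h ?_
  rw [Fm.shiftN, Fm.subst_alive]
  refine complete ⟨trivial, trivial⟩ fun M env h => ?_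
  have h1 : sat env (.and (.hasLength (var 0) (var 1)) (.inTree 0 (var 0))) :=
    h _ (.head _) ⟨⟨trivial, trivial⟩, trivial, trivial⟩
  simp only [sat_and, sat_hasLength, sat_inTree, eval_var] at h1
  rw [sat_alive]
  simp only [Tm.subst, eval_zero, eval_var]
  refine ⟨env 0, le_self_add.trans_lt h1.1.2, h1.1, ?_, fun j _ => h1.2 j⟩
  rw [tsub_zero]
  -- Deleting all bits leaves a sequence of length `0`, which has code `0`.
  exact (HL.anc (by simpa using h1.1)).eq_zero

/-- A path of a tree from a coloring of the graphs that decide it. -/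
theorem prov_isPath :
    Prov [Fm.areColorings 1 0 0, Fm.isGraph 1 2 0, Fm.rootAlive 2, .le two (var 0)]
      (.exF (Fm.isPath 0 3)) := by
  -- This introduces `B`, which is `1` exactly at the indices of graphs whose vertices `k - 2` and
  -- `k - 1` have equal colors, that is, where the path should go right.
  refine Prov.characteristic (φ := Fm.sameColor 0 1) trivial (Fm.sameColor_shiftF 0 1) rfl rfl ?_
  rw [List.map_cons, List.map_cons, List.map_cons, Fm.isGraph_shiftF, Fm.rootAlive_shiftF]
  -- Choice for an equation only gives a function variable to a term: here the path `p(m)`, with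
  -- value `B` at `m` and the code of the path so far.
  refine Prov.choice_to (φ := .eq (var 0) (.app 0 (pair (var 1) (.pathCode 0 (var 1)))))
    (φ' := .eq (var 0) (.app 1 (pair (var 1) (.pathCode 1 (var 1)))))
    (N := Fm.takesBits 0 1) trivial ?_ rfl rfl rfl trivial ?_ (ψ' := .exF (Fm.isPath 0 5)) ?_
  · exact .allNI (.exNI (.app 0 (pair (var 0) (.pathCode 0 (var 0)))) (.eqRefl _))
  · intro M env h
    simpa [sat_takesBits, eval_pathCode] using h
  rw [List.map_cons, List.map_cons, List.map_cons, List.map_cons, Fm.isGraph_shiftF,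
    Fm.rootAlive_shiftF, Fm.isChar_shiftF, Fm.sameColor_shiftF]
  refine .exFI 0 (complete (χ := .isPath 0 4) ⟨trivial, trivial, trivial⟩ ?_)
  intro M env h
  have h1 := (sat_takesBits env _ _).1 (h _ (.head _) trivial)
  have h2 := (sat_isChar env _ _).1 (h _ (.tail _ (.head _)) (Fm.isChar_univ trivial))
  have h3 : sat env (Fm.areColorings 3 2 0) :=
    h _ (.tail _ (.tail _ (.head _))) (Fm.areColorings_univ 3 2 0)
  have h4 := (sat_isGraph env _ _ _).1 (h _ (.tail _ (.tail _ (.tail _ (.head _))))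
    (Fm.isGraph_univ _ _ _))
  have h5 := (sat_rootAlive env _).1 (h _ (.tail _ (.tail _ (.tail _ (.tail _ (.head _)))))
    ⟨trivial, trivial⟩)
  have h6 : sat env (.le two (var 0)) :=
    h _ (.tail _ (.tail _ (.tail _ (.tail _ (.tail _ (.head _)))))) trivial
  rw [sat_areColorings] at h3
  simp only [Fm.sameColor, sat_eq, sat_le, eval_app, eval_pair, eval_sub, eval_succ, eval_two,
    eval_var, scons_zero, scons_succ] at h2 h6
  have hpc := pathCode_eq_seg h1
  have hp (m : M.C) : fn 0 m < 2 := by rw [h1]; exact (h2 _).1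
  have key (m n : M.C) : m ≤ n → Alive 4 m (seg 0 m) n :=
    alive_seg h6 (fun i => (h3 i).1) (fun i b a hab hj => (h3 i).2 b a hab
      ((edge_iff_joined h4 hab).2 hj)) hp (fun m => by
        rw [h1, hpc]; exact (h2 _).2) h5
  rw [sat_isPath]
  refine ⟨hp, fun m j => ?_⟩
  rw [anc_seg fun x _ => hp x]
  -- A node alive at the stage equal to its own length is its own witness, so `t` is positive there.
  obtain ⟨c, -, hc, hs, ht⟩ := key (m - j) (m - j) le_rfl
  rw [tsub_self, anc_zero] at hs
  simpa [hs] using ht 0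

/-- The coloring principle implies weak König's Lemma. -/
theorem prov_wkl_of_seqColoring :
    Prov [Fm.seqColoring (var 0), .le two (var 0)] Fm.WKL := by
  refine .allFI (.impI ?_)
  -- The hypothesis on the tree is exchanged for `Fm.rootAlive`, which passes into models.
  refine Prov.cut (L := [Fm.rootAlive 0, Fm.seqColoring (var 0), .le two (var 0)]) ?_ ?_
  · refine Prov.characteristic (φ := Fm.graphEdge 0 (var 1) (var 0)) (by simp)
      (Fm.subst_graphEdge _ _ _ _ _) rfl rfl ?_
    rw [List.map_cons, Fm.rootAlive_shiftF]
    have hc : Prov [Fm.isGraph 0 1 0, Fm.rootAlive 1, Fm.seqColoring (var 0), .le two (var 0)]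
        (.exF (Fm.areColorings 1 0 0)) := by
      -- The coloring principle is applied to the edge function just obtained, by local colorability
      -- of the deciding graphs.
      refine .impE (.allFE 0 (.hyp (.tail _ (.tail _ (.head _))))) (prov_locallyColorable.mono ?_)
      simp
    refine .exFE hc (prov_isPath.mono ?_)
    change _ ⊆ [Fm.areColorings 1 0 0, (Fm.isGraph 0 1 0).shiftF, (Fm.rootAlive 1).shiftF,
      Fm.seqColoring (var 0), Fm.le two (var 0)]
    rw [Fm.isGraph_shiftF, Fm.rootAlive_shiftF]
    simp
  · simp only [List.mem_cons, List.not_mem_nil, or_false]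
    rintro ψ (rfl | rfl | rfl)
    · exact prov_rootAlive
    · exact .hyp (.tail _ (.head _))
    · exact .hyp (.tail _ (.tail _ (.head _)))

end IRCA

theorem mainTheorem5 :
    IRCA.Derivable IRCA.iRCA0 []
      (IRCA.Fm.allN (IRCA.Fm.imp (IRCA.Fm.le IRCA.Tm.two (IRCA.Tm.var 0))
        (IRCA.Fm.iff IRCA.Fm.WKL (IRCA.Fm.seqColoring (IRCA.Tm.var 0))))) :=
  .allNI (.impI (.andI (.impI IRCA.prov_seqColoring_of_wkl) (.impI IRCA.prov_wkl_of_seqColoring)))
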